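/- Let $M$ be a compact $d$-dimensional Riemannian manifold (smooth, without boundary, with smooth metric), with normalized Riemannian volume $\operatorname{Leb}$, and let $f\colon M\to M$ be a $C^2$ local diffeomorphism. Let $T$ be a metric space, $\Phi\colon T\to C^2(M,M)$, $t\mapsto f_t$, a continuous map (for the $C^2$ topology) with $f_{t^*}=f$ for some $t^*\in T$, and $(\theta_\epsilon)_{\epsilon>0}$ a family of Borel probability measures on $T$, each giving full measure to its support (automatic if $T$ is separable), with $\operatorname{supp}(\theta_\epsilon)\to\{t^*\}$ as $\epsilon\to0$; that is, every neighbourhood of $t^*$ contains $\operatorname{supp}(\theta_\epsilon)$ for all small $\epsilon>0$. For $\omega=(\omega_1,\omega_2,\dots)\in T^{\mathbb N}$ put $f_\omega^0=\mathrm{id}$ and $f_\omega^n=f_{\omega_n}\circ\cdots\circ f_{\omega_1}$. A Borel probability measure $m$ on $M$ is an *aces measure* for $(\Phi,\theta_\epsilon)$ if it is * absolutely continuous with respect to $\operatorname{Leb}$; * stationary: $\iint\varphi(f_t(x))\,dm(x)\,d\theta_\epsilon(t)=\int\varphi\,dm$ for all continuous $\varphi\colon M\to\mathbb R$; * ergodic: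 $m(A)\in\{0,1\}$ for every Borel set $A\subset M$ such that, for $m$-a.e. $x$, $x\in A$ implies $f_t(x)\in A$ for $\theta_\epsilon$-a.e. $t$, and $x\notin A$ implies $f_t(x)\notin A$ for $\theta_\epsilon$-a.e. $t$. An aces measure $m$ for $(\Phi,\theta_\epsilon)$ is *expanding* if for $(\theta_\epsilon^{\mathbb N}\times m)$-a.e. $(\omega,x)$ and all $v\in T_xM\setminus\{0\}$ the limit $\lambda(\omega,x,v)=\lim_{n\to\infty}\frac1n\log\|Df_\omega^n(x)v\|$ exists and is positive. An $f$-invariant probability measure $\mu$ is *expanding* if for $\mu$-a.e. $x$ and all $v\in T_xM\setminus\{0\}$ the limit $\lambda(x,v)=\lim_{n\to\infty}\frac1n\log\|Df^n(x)v\|$ exists and is positive. Let $\mu_1,\dots,\mu_p$ be finitely many expanding ergodic $f$-invariant probability measures, and assume that $f$ is stochastically stable with respect to $(\Phi,(\theta_\epsilon)_{\epsilon>0})$ with these limit measures: for every set $L\subset(0,\infty)$ of noise levels and every family $(m_\epsilon)_{\epsilon\in L}$ in which $m_\epsilon$ is an aces measure for $(\Phi,\theta_\epsilon)$, every weak$^*$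 accumulation point of $m_\epsilon$ as $\epsilon\to0$, $\epsilon\in L$, lies in the convex hull of $\mu_1,\dots,\mu_p$. Then there is $\epsilon_0>0$ such that for every $0<\epsilon<\epsilon_0$, every aces measure for $(\Phi,\theta_\epsilon)$ is expanding. -/

import Mathlib

open MeasureTheory Filter Topology Manifold ContDiff Bundle

noncomputable section

section Manifold

variable {d : ℕ} {M : Type*} [EMetricSpace M] [ChartedSpace (EuclideanSpace ℝ (Fin d)) M]

/-- Normalized Riemannian volume of a compact `d`-dimensional Riemannian manifold. The
`d`-dimensional Hausdorff measure of the Riemannian distance is the Riemannian volume up to a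
constant factor, which disappears in the normalization. -/
def normalizedVolume (d : ℕ) (M : Type*) [EMetricSpace M] [MeasurableSpace M] [BorelSpace M] :
    Measure M :=
  (μH[(d : ℝ)] (Set.univ : Set M))⁻¹ • (μH[(d : ℝ)] : Measure M)

/-- The second iterated tangent map `TTg : TTM → TTM` of a `C²` map `g : M → M`,
as a continuous map. -/
def secondTangentMap [IsManifold (𝓡 d) ∞ M] (g : C^2⟮𝓡 d, M; 𝓡 d, M⟯) :
    C(TangentBundle (𝓡 d).tangent (TangentBundle (𝓡 d) M),
      TangentBundle (𝓡 d).tangent (TangentBundle (𝓡 d) M)) where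
  toFun := tangentMap (𝓡 d).tangent (𝓡 d).tangent (tangentMap (𝓡 d) (𝓡 d) g)
  continuous_toFun :=
    (g.contMDiff.contMDiff_tangentMap (m := 1) (by norm_num [one_add_one_eq_two])).continuous_tangentMap
      le_rfl

/-- The `C²` topology on `C²(M, M)`: uniform convergence on compact sets of the map and its
derivatives up to order two, i.e. the topology induced by `g ↦ TTg` from the compact-open topology
on continuous self-maps of `TTM`. -/
@[reducible] def c2Topology (d : ℕ) (M : Type*) [EMetricSpace M] [ChartedSpace (EuclideanSpace ℝ (Fin d)) M]
    [IsManifold (𝓡 d) ∞ M] : TopologicalSpace C^2⟮𝓡 d, M; 𝓡 d, M⟯ :=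
  TopologicalSpace.induced secondTangentMap inferInstance

/-- The sequence of maps `g n` (for the deterministic or a random composition of length `n`) has
Lyapunov exponent `l` at `(x, v)`: the limit of `(1/n) log ‖D(g n)(x) v‖` exists and equals `l`. -/
def HasLyapunovExponent [RiemannianBundle (fun x : M => TangentSpace (𝓡 d) x)]
    (g : ℕ → M → M) (x : M) (v : TangentSpace (𝓡 d) x) (l : ℝ) : Prop :=
  Tendsto (fun n : ℕ => (1 / (n : ℝ)) * Real.log ‖mfderiv (𝓡 d) (𝓡 d) (g n) x v‖) atTop (𝓝 l)

/-- A measure on `M` is expanding for `f`: at almost every `x`, the Lyapunov exponent of every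
nonzero tangent vector exists and is positive. -/
def IsExpandingInvariant [RiemannianBundle (fun x : M => TangentSpace (𝓡 d) x)] [MeasurableSpace M]
    (f : M → M) (μ : Measure M) : Prop :=
  ∀ᵐ x ∂μ, ∀ v : TangentSpace (𝓡 d) x, v ≠ 0 →
    ∃ l : ℝ, HasLyapunovExponent (fun n => f^[n]) x v l ∧ 0 < l

end Manifold

section Random

variable {T M : Type*}

/-- `f_ω^n = f_{ω_{n-1}} ∘ ⋯ ∘ f_{ω_0}`, with realizations `ω` (here `w`) indexed from `0`. -/
def randomIterate (F : T → M → M) (w : ℕ → T) : ℕ → M → M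
  | 0 => id
  | n + 1 => F (w n) ∘ randomIterate F w n

variable [MeasurableSpace T] [MeasurableSpace M]

/-- `μ` is stationary for the i.i.d. random choice of maps `F t` with law `θ`. -/
def IsStationaryMeasure [TopologicalSpace M] (F : T → M → M) (θ : Measure T) (μ : Measure M) : Prop :=
  ∀ φ : C(M, ℝ), ∫ t, ∫ x, φ (F t x) ∂μ ∂θ = ∫ x, φ x ∂μ

/-- `A` is a random invariant set (with respect to `μ`). -/
def IsRandomInvariant (F : T → M → M) (θ : Measure T) (μ : Measure M) (A : Set M) : Prop :=
  ∀ᵐ x ∂μ, (x ∈ A → ∀ᵐ t ∂θ, F t x ∈ A) ∧ (x ∉ A → ∀ᵐ t ∂θ, F t x ∉ A)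

/-- Every (Borel) random invariant set has measure `0` or `1`. -/
def IsRandomErgodic (F : T → M → M) (θ : Measure T) (μ : Measure M) : Prop :=
  ∀ A : Set M, MeasurableSet A → IsRandomInvariant F θ μ A → μ A = 0 ∨ μ A = 1

/-- A probability measure on `M` is *aces* for `(F, θ)` if it is absolutely continuous with respect
to the normalized Riemannian volume, ergodic, and stationary. -/
structure IsAces (d : ℕ) [EMetricSpace M] [BorelSpace M] (F : T → M → M) (θ : Measure T)
    (μ : ProbabilityMeasure M) : Prop where
  absolutelyContinuous : (μ : Measure M) ≪ normalizedVolume d M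
  ergodic : IsRandomErgodic F θ (μ : Measure M)
  stationary : IsStationaryMeasure F θ (μ : Measure M)

/-- A measure on `M` is expanding for `(F, θ)`: for `θ^ℕ × μ`-almost every `(ω, x)`, the Lyapunov
exponent of every nonzero tangent vector along the random orbit exists and is positive. -/
def IsExpandingStationary {d : ℕ} [EMetricSpace M] [ChartedSpace (EuclideanSpace ℝ (Fin d)) M]
    [RiemannianBundle (fun x : M => TangentSpace (𝓡 d) x)]
    (F : T → M → M) (θ : Measure T) (μ : Measure M) : Prop :=
  ∀ᵐ p ∂((Measure.infinitePi fun _ : ℕ => θ).prod μ),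
    ∀ v : TangentSpace (𝓡 d) p.2, v ≠ 0 →
      ∃ l : ℝ, HasLyapunovExponent (randomIterate F p.1) p.2 v l ∧ 0 < l

/-- The supports of the measures `θ ε` converge to the point `t₀` as `ε → 0⁺`. -/
def SupportsConvergeTo [TopologicalSpace T] (θ : ℝ → ProbabilityMeasure T) (t₀ : T) : Prop :=
  ∀ U ∈ 𝓝 t₀, ∀ᶠ ε in 𝓝[>] (0 : ℝ), (θ ε : Measure T).support ⊆ U

/-- `f` is stochastically stable with respect to `(F, (θ ε)_{ε > 0})`, with limit measures
`μ 1, …, μ p`: these are `f`-invariant and ergodic, and every weak* accumulation point, as `ε → 0⁺`,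
of any family of aces measures for `(F, θ ε)` is a convex combination of them. As aces measures need
not exist at every noise level, families are indexed by arbitrary sets `L` of noise levels (there
are no accumulation points as `ε → 0⁺` unless `L` accumulates at `0`). -/
structure IsStochasticallyStable (d : ℕ) [EMetricSpace M] [BorelSpace M] (f : M → M)
    (F : T → M → M) (θ : ℝ → ProbabilityMeasure T) {p : ℕ} (μ : Fin p → ProbabilityMeasure M) :
    Prop where
  ergodic : ∀ i, Ergodic f (μ i : Measure M)
  accumulation : ∀ L : Set ℝ, L ⊆ Set.Ioi 0 → ∀ m : ℝ → ProbabilityMeasure M,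
    (∀ ε ∈ L, IsAces d F (θ ε : Measure T) (m ε)) →
    ∀ ν : ProbabilityMeasure M, MapClusterPt ν (𝓝[L] (0 : ℝ)) m →
      ∃ a : Fin p → NNReal, ∑ i, a i = 1 ∧ (ν : Measure M) = ∑ i, a i • (μ i : Measure M)

end Random

end

/-! Expansion is detected by one continuous function. Let q_N(x) be the minimum of ‖Df^N(x)v‖ over
unit vectors v. Since f is a local diffeomorphism, log q_N is continuous, so a lower bound for its
mean under every μ_i passes, by stochastic stability and compactness, to every aces measure at small
noise (`IsStochasticallyStable.eventually_lt_integral`). For small noise the random N-fold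
compositions have minimal expansion at least q_N / 2 (`eventually_half_tangentConorm_le`). The
logarithmic mean of the random minimal expansion over N steps is then positive. As minus the
logarithm of the minimal expansion is subadditive, every exponent that exists is positive
(`IsBoundedCocycle.ae_exponent_pos`). The factor 2, and the square of the constant K that compares
Riemannian with Euclidean norms in a measurable frame, are overcome by taking N with mean of log q_N
above log(2K²) for all i.

Such an N exists because these means tend to infinity. Positivity of the exponent of each single
vector does not give this at once; what is needed is that the rate of the smallest singular value is
positive. If it were not, unit vectors that are slow at time i would accumulate at a vector slow at
all times, contradicting its positive exponent (`HasVolumeRates.rate_pos_of_exponents_pos`).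

The limits defining the random exponents must also exist; this is the multiplicative ergodic theorem
for the derivative cocycle over the skew product with the shift, which is ergodic by
`ergodic_skewProduct`. Both uses of singular values rest on the growth of k-volumes, measured on
alternating forms: the subadditive ergodic theorem `IsSubadditiveCocycle.exists_rate` gives its
rates, `exists_slow_part` turns them into a splitting of vectors at each time, and
`descend_splitting` shows that slowness at a late time propagates to earlier times. -/

/-! ### Subadditive cocycles over an ergodic transformation -/

/-- A measurable subadditive cocycle of linear growth over the map `S`. -/
structure IsSubadditiveCocycle {X : Type*} [MeasurableSpace X] (S : X → X) (g : ℕ → X → ℝ)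
    (C : ℝ) : Prop where
  measurable : ∀ n, Measurable (g n)
  bound : ∀ n x, |g n x| ≤ C * n
  subadd : ∀ m n x, g (m + n) x ≤ g m x + g n (S^[m] x)

namespace IsSubadditiveCocycle

variable {X : Type*} [MeasurableSpace X] {S : X → X} {g : ℕ → X → ℝ} {C : ℝ}

lemma le (h : IsSubadditiveCocycle S g C) (n : ℕ) (x : X) : g n x ≤ C * n :=
  (abs_le.1 (h.bound n x)).2

lemma ge (h : IsSubadditiveCocycle S g C) (n : ℕ) (x : X) : -(C * n) ≤ g n x :=
  (abs_le.1 (h.bound n x)).1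

lemma nonneg [Nonempty X] (h : IsSubadditiveCocycle S g C) : 0 ≤ C := by
  obtain ⟨x⟩ := ‹Nonempty X›
  simpa using (abs_nonneg _).trans (h.bound 1 x)

lemma integrable (h : IsSubadditiveCocycle S g C) (μ : Measure X) [IsFiniteMeasure μ] (n : ℕ) :
    Integrable (g n) μ :=
  Integrable.of_bound (h.measurable n).aestronglyMeasurable (C * n)
    (Eventually.of_forall fun x => by simpa [Real.norm_eq_abs] using h.bound n x)

/-- If `g` often falls below `b n` within `L` steps, then `g n` is bounded by `b n` up to the time
spent in the exceptional set. -/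
lemma le_of_exceptional (h : IsSubadditiveCocycle S g C) (hC : 0 ≤ C) (b : ℝ) (L : ℕ) (B : Set X)
    (hB : ∀ x, x ∉ B → ∃ n, 1 ≤ n ∧ n ≤ L ∧ g n x < b * n) (n : ℕ) (x : X) :
    g n x ≤ b * n + (C + |b|) * ∑ j ∈ Finset.range n, B.indicator 1 (S^[j] x) +
      (C + |b|) * L := by
  have hD : 0 ≤ C + |b| := by positivity
  induction n using Nat.strong_induction_on generalizing x with
  | _ n ih =>
  have hnn : ∀ (m : ℕ) (y : X), 0 ≤ ∑ j ∈ Finset.range m, B.indicator (1 : X → ℝ) (S^[j] y) :=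
    fun m y => Finset.sum_nonneg fun j _ => Set.indicator_nonneg (by simp) _
  -- For `n ≤ L` the trivial bound `C * n` is absorbed by the last term. Otherwise a point of `B`
  -- costs one step of at most `C`, paid for by its indicator, and at a point outside `B` a whole
  -- block of slope below `b` is split off.
  rcases le_or_gt n L with hn | hn
  · have h1 := h.le n x
    have h2 : (n : ℝ) ≤ L := by exact_mod_cast hn
    have h3 := mul_nonneg hD (hnn n x)
    have h4 := neg_abs_le b
    have h5 : (0 : ℝ) ≤ n := by positivity
    nlinarith [mul_le_mul_of_nonneg_left h2 hD, mul_le_mul_of_nonneg_right h4 h5]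
  · by_cases hx : x ∈ B
    · obtain ⟨k, rfl⟩ : ∃ k, n = 1 + k := ⟨n - 1, by omega⟩
      have h1 := h.subadd 1 k x
      have h2 := ih k (by omega) (S^[1] x)
      have h3 := h.le 1 x
      have h4 := neg_abs_le b
      rw [Finset.sum_range_add]
      simp only [Finset.range_one, Finset.sum_singleton, Function.iterate_zero, id,
        Set.indicator_of_mem hx, Pi.one_apply]
      have h5 : ∀ j, S^[1 + j] x = S^[j] (S^[1] x) := fun j => by
        rw [add_comm, Function.iterate_add_apply]
      simp only [h5]
      push_cast at h3 ⊢
      nlinarith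
    · obtain ⟨m, hm1, hmL, hm⟩ := hB x hx
      obtain ⟨k, rfl⟩ : ∃ k, n = m + k := ⟨n - m, by omega⟩
      have h1 := h.subadd m k x
      have h2 := ih k (by omega) (S^[m] x)
      rw [Finset.sum_range_add]
      have h5 : ∀ j, S^[m + j] x = S^[j] (S^[m] x) := fun j => by
        rw [add_comm, Function.iterate_add_apply]
      simp only [h5]
      have h6 := mul_nonneg hD (hnn m x)
      push_cast
      nlinarith

variable {μ : Measure X} [IsProbabilityMeasure μ]

/-- The lower half of the subadditive ergodic theorem. -/
lemma eventually_ge (h : IsSubadditiveCocycle S g C) (hS : Ergodic S μ) {a b : ℝ}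
    (ha : ∀ n : ℕ, a * n ≤ ∫ x, g n x ∂μ) (hb : b < a) :
    ∀ᵐ x ∂μ, ∀ᶠ n in atTop, b * n ≤ g n x := by
  have : Nonempty X := (μ.nonempty_of_neZero)
  have hC := h.nonneg
  -- `B` is the set where the lower limit of `g n x / n` is at most `b`.
  set B : Set X := {x | ∀ k : ℕ, ∃ᶠ n : ℕ in atTop, g n x < (b + 1 / ((k : ℝ) + 1)) * n} with hBdef
  have hBm : MeasurableSet B := by
    have : B = ⋂ k : ℕ, ⋂ N : ℕ, ⋃ n ∈ Set.Ici N,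
        {x | g n x < (b + 1 / ((k : ℝ) + 1)) * n} := by
      ext x
      simp [hBdef, frequently_atTop]
    rw [this]
    refine MeasurableSet.iInter fun k => MeasurableSet.iInter fun N =>
      MeasurableSet.biUnion (Set.to_countable _) fun n _ => measurableSet_lt (h.measurable n)
        measurable_const
  have hsub : S ⁻¹' B ⊆ B := by
    intro x hx k
    -- The index `2 * k + 1` gives exactly half of the slack `1 / (k + 1)`; the other half,
    -- multiplied by a large `n`, absorbs the cost of one extra step.
    have hx' := hx (2 * k + 1)
    obtain ⟨n₀, hn₀⟩ := exists_nat_gt ((C + |b| + 1) * (2 * (k + 1)))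
    have hev : ∀ᶠ n : ℕ in atTop, n₀ ≤ n := eventually_ge_atTop n₀
    have := hx'.and_eventually hev
    rw [frequently_atTop] at this ⊢
    intro N
    obtain ⟨n, hn, h1, h2⟩ := this N
    refine ⟨1 + n, by omega, ?_⟩
    have h3 := h.subadd 1 n x
    have h4 := h.le 1 x
    simp only [Function.iterate_one] at h3
    have h5 : (n₀ : ℝ) ≤ n := by exact_mod_cast h2
    have h6 : (1 : ℝ) / (((2 * k + 1 : ℕ) : ℝ) + 1) = 1 / (2 * (k + 1)) := by
      push_cast; congr 1; ring
    rw [h6] at h1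
    have hk : (0 : ℝ) < 2 * (k + 1) := by positivity
    have h7 : (C + |b| + 1) < n * (1 / (2 * (k + 1))) := by
      rw [mul_one_div, lt_div_iff₀ hk]; linarith
    have h8 : (1 : ℝ) / (k + 1) = 2 * (1 / (2 * (k + 1))) := by field_simp
    rw [h8]
    have h9 := neg_abs_le b
    have h10 : (0 : ℝ) < 1 / (2 * (k + 1)) := by positivity
    push_cast at h4 ⊢
    nlinarith
  rcases hS.ae_empty_or_univ_of_preimage_ae_le hBm.nullMeasurableSet
    (Eventually.of_forall hsub) with h0 | h1
  · have : ∀ᵐ x ∂μ, x ∉ B := by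
      filter_upwards [h0.mem_iff] with x hx
      simpa using hx
    filter_upwards [this] with x hx
    simp only [hBdef, Set.mem_ofPred_eq, not_forall, not_frequently, not_lt] at hx
    obtain ⟨k, hk⟩ := hx
    filter_upwards [hk] with n hn
    refine le_trans ?_ hn
    gcongr
    have : (0 : ℝ) < 1 / (k + 1) := by positivity
    linarith
  · exfalso
    -- If `B` had full measure, then for large `L` most points would fall below slope `c` within `L`
    -- steps. Integrating `le_of_exceptional`, then letting `n` and afterwards `L` tend to infinity,
    -- forces `a ≤ c`.
    obtain ⟨c, hbc, hca⟩ := exists_between hb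
    obtain ⟨k, hk⟩ := exists_nat_one_div_lt (sub_pos.2 hbc)
    let G : ℕ → Set X := fun L => {x | ∃ n, 1 ≤ n ∧ n ≤ L ∧ g n x < c * n}
    have hGm : ∀ L, MeasurableSet (G L) := by
      intro L
      have : G L = ⋃ n ∈ Set.Icc 1 L, {x | g n x < c * n} := by
        ext x; simp [G, and_assoc]
      rw [this]
      exact MeasurableSet.biUnion (Set.to_countable _) fun n _ =>
        measurableSet_lt (h.measurable n) measurable_const
    have hmono : Antitone fun L => (G L)ᶜ := by
      intro L L' hLL x hx hx'
      obtain ⟨n, h1, h2, h3⟩ := hx'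
      exact hx ⟨n, h1, h2.trans hLL, h3⟩
    have hnull : μ (⋂ L, (G L)ᶜ) = 0 := by
      have : ∀ᵐ x ∂μ, x ∈ B := by
        filter_upwards [h1.mem_iff] with x hx
        simpa using hx
      refine measure_mono_null ?_ this
      intro x hx hxB
      obtain ⟨n, hn, hlt⟩ := (frequently_atTop.1 (hxB k)) 1
      have h2 : x ∈ (G n)ᶜ := Set.mem_iInter.1 hx n
      refine h2 ⟨n, hn, le_rfl, hlt.trans_le ?_⟩
      gcongr
      linarith
    have hlim : Tendsto (fun L => μ.real ((G L)ᶜ)) atTop (𝓝 0) := by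
      have := tendsto_measure_iInter_atTop (μ := μ) (fun L => (hGm L).compl.nullMeasurableSet) hmono
        ⟨0, measure_ne_top _ _⟩
      rw [hnull] at this
      exact (ENNReal.tendsto_toReal ENNReal.zero_ne_top).comp this
    have hint : ∀ L n : ℕ, 0 < n →
        a ≤ c + (C + |c|) * μ.real ((G L)ᶜ) + (C + |c|) * L / n := by
      intro L n hn
      have hle := h.le_of_exceptional hC c L ((G L)ᶜ) (fun x hx => by simpa [G] using hx) n
      have hind : ∀ j, Integrable (fun x => (G L)ᶜ.indicator (1 : X → ℝ) (S^[j] x)) μ := fun j =>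
        ((hS.toMeasurePreserving.iterate j).integrable_comp
          (measurable_one.indicator (hGm L).compl).aestronglyMeasurable).2
          ((integrable_const (1 : ℝ)).indicator (hGm L).compl)
      have hind' : ∀ j, ∫ x, (G L)ᶜ.indicator (1 : X → ℝ) (S^[j] x) ∂μ = μ.real ((G L)ᶜ) := by
        intro j
        have hmp := hS.toMeasurePreserving.iterate j
        rw [← integral_indicator_one (hGm L).compl]
        conv_rhs => rw [← hmp.map_eq]
        rw [integral_map hmp.measurable.aemeasurable]
        rw [hmp.map_eq]
        exact (measurable_one.indicator (hGm L).compl).aestronglyMeasurable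
      have hI1 : Integrable (fun x => ∑ j ∈ Finset.range n,
          (G L)ᶜ.indicator (1 : X → ℝ) (S^[j] x)) μ := integrable_finsetSum _ fun j _ => hind j
      have := integral_mono (h.integrable μ n)
        (((integrable_const (c * n)).add (hI1.const_mul _)).add (integrable_const _)) hle
      simp only [Pi.add_apply] at this
      have hI2 : Integrable (fun x => c * n + (C + |c|) * ∑ j ∈ Finset.range n,
          (G L)ᶜ.indicator (1 : X → ℝ) (S^[j] x)) μ :=
        (integrable_const (c * n)).add (hI1.const_mul _)
      rw [integral_add hI2 (integrable_const _),
        integral_add (integrable_const (c * n)) (hI1.const_mul _), integral_const_mul (C + |c|),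
        integral_finsetSum _ fun j _ => hind j] at this
      simp only [hind', integral_const, probReal_univ, smul_eq_mul, one_mul, Finset.sum_const,
        Finset.card_range, nsmul_eq_mul] at this
      have h2 := (ha n).trans this
      have hn' : (0 : ℝ) < n := by exact_mod_cast hn
      have h3 : (c + (C + |c|) * μ.real ((G L)ᶜ) + (C + |c|) * L / n) * n =
        c * n + (C + |c|) * (n * μ.real ((G L)ᶜ)) + (C + |c|) * L := by field_simp
      refine le_of_mul_le_mul_right ?_ hn'
      rw [h3]; exact h2
    have hint2 : ∀ L, a ≤ c + (C + |c|) * μ.real ((G L)ᶜ) := by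
      intro L
      have ht : Tendsto (fun n : ℕ => c + (C + |c|) * μ.real ((G L)ᶜ) + (C + |c|) * L / n) atTop
          (𝓝 (c + (C + |c|) * μ.real ((G L)ᶜ) + 0)) :=
        tendsto_const_nhds.add (tendsto_const_div_atTop_nhds_zero_nat _)
      rw [add_zero] at ht
      exact ge_of_tendsto ht ((eventually_gt_atTop 0).mono fun n hn => hint L n hn)
    have ht : Tendsto (fun L => c + (C + |c|) * μ.real ((G L)ᶜ)) atTop (𝓝 (c + (C + |c|) * 0)) :=
      tendsto_const_nhds.add (hlim.const_mul _)
    have := ge_of_tendsto ht (Eventually.of_forall hint2)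
    linarith

/-- Averaging over the residues modulo `N`. -/
lemma mul_le_sum (h : IsSubadditiveCocycle S g C) (N m : ℕ) (x : X) :
    N * g m x ≤ ∑ j ∈ Finset.range m, g N (S^[j] x) + 3 * C * N ^ 2 := by
  have : Nonempty X := ⟨x⟩
  have hC := h.nonneg
  rcases lt_or_ge m N with hm | hm
  · have h1 : ∑ j ∈ Finset.range m, (-(C * N)) ≤ ∑ j ∈ Finset.range m, g N (S^[j] x) :=
      Finset.sum_le_sum fun j _ => h.ge N _
    simp only [Finset.sum_const, Finset.card_range, nsmul_eq_mul] at h1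
    have h2 := h.le m x
    have h3 : (m : ℝ) ≤ N := by exact_mod_cast hm.le
    have h4 : (0 : ℝ) ≤ m := by positivity
    nlinarith [mul_le_mul_of_nonneg_left h2 (Nat.cast_nonneg (α := ℝ) N),
      mul_nonneg hC h4, mul_le_mul_of_nonneg_left h3 (mul_nonneg hC (h4.trans h3))]
  · obtain ⟨k, rfl⟩ : ∃ k, m = k + N := ⟨m - N, by omega⟩
    -- `G j` is the cocycle from time `j` to the fixed end time. Telescoping in steps of `N` handles
    -- all residues at once, so ergodicity of `S^[N]` is never needed. The first `N` terms, the last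
    -- `N` terms and the `N` missing summands each cost at most `C * N ^ 2`.
    let G : ℕ → ℝ := fun j => g (k + N - j) (S^[j] x)
    have htel : ∀ k' : ℕ, ∑ j ∈ Finset.range k', (G j - G (j + N)) =
        ∑ j ∈ Finset.range N, G j - ∑ j ∈ Finset.range N, G (k' + j) := by
      intro k'
      induction k' with
      | zero => simp
      | succ k' ih =>
        rw [Finset.sum_range_succ, ih]
        have e1 := Finset.sum_range_succ (fun j => G (k' + j)) N
        have e2 := Finset.sum_range_succ' (fun j => G (k' + j)) N
        have e3 : ∀ j, G (k' + (j + 1)) = G (k' + 1 + j) := fun j => by congr 1; ring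
        simp only [e3, add_zero] at e2
        linarith
    have hstep : ∀ j ∈ Finset.range k, G j - G (j + N) ≤ g N (S^[j] x) := by
      intro j hj
      have hj' := Finset.mem_range.1 hj
      have h1 := h.subadd N (k - j) (S^[j] x)
      have e1 : G j = g (N + (k - j)) (S^[j] x) := by simp only [G]; congr 1; omega
      have e2 : G (j + N) = g (k - j) (S^[N] (S^[j] x)) := by
        simp only [G]
        rw [← Function.iterate_add_apply, add_comm N j]
        congr 1; omega
      rw [e1, e2]; linarith
    have hsum := Finset.sum_le_sum hstep
    rw [htel] at hsum
    have hlow : ∑ j ∈ Finset.range N, (g (k + N) x - C * N) ≤ ∑ j ∈ Finset.range N, G j := by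
      refine Finset.sum_le_sum fun j hj => ?_
      have hj' := Finset.mem_range.1 hj
      have h1 := h.subadd j (k + N - j) x
      rw [show j + (k + N - j) = k + N by omega] at h1
      have h2 := h.le j x
      have h3 : (j : ℝ) ≤ N := by exact_mod_cast hj'.le
      have := mul_le_mul_of_nonneg_left h3 hC
      simp only [G]
      linarith
    have hup : ∑ j ∈ Finset.range N, G (k + j) ≤ ∑ j ∈ Finset.range N, (C * N) := by
      refine Finset.sum_le_sum fun j hj => ?_
      have h2 := h.le (k + N - (k + j)) (S^[k + j] x)
      refine h2.trans ?_
      gcongr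
      omega
    have hext : ∑ j ∈ Finset.range N, (-(C * N)) ≤
        ∑ j ∈ Finset.range N, g N (S^[k + j] x) := Finset.sum_le_sum fun j _ => h.ge N _
    rw [Finset.sum_range_add]
    simp only [Finset.sum_const, Finset.card_range, nsmul_eq_mul] at hlow hup hext
    nlinarith

end IsSubadditiveCocycle

/-! ### The pointwise ergodic theorem and uniform bounds over orbit segments -/

section Birkhoff

variable {X : Type*} [MeasurableSpace X] {S : X → X} {μ : Measure X} [IsProbabilityMeasure μ]

/-- The pointwise ergodic theorem for a bounded function, as a lower bound. -/
lemma Ergodic.eventually_le_birkhoffSum (hS : Ergodic S μ) {φ : X → ℝ} (hφ : Measurable φ) {C : ℝ}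
    (hC : ∀ x, |φ x| ≤ C) {b : ℝ} (hb : b < ∫ x, φ x ∂μ) :
    ∀ᵐ x ∂μ, ∀ᶠ n : ℕ in atTop, b * n ≤ ∑ j ∈ Finset.range n, φ (S^[j] x) := by
  -- Birkhoff sums are additive, so the lower half of the subadditive theorem already covers them.
  have hco : IsSubadditiveCocycle S (fun n x => ∑ j ∈ Finset.range n, φ (S^[j] x)) C := by
    refine ⟨fun n => Finset.measurable_fun_sum _ fun j _ => hφ.comp (hS.measurable.iterate j),
      fun n x => ?_, fun m n x => ?_⟩
    · refine (Finset.abs_sum_le_sum_abs _ _).trans ?_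
      refine (Finset.sum_le_sum fun j _ => hC _).trans ?_
      simp [mul_comm]
    · rw [Finset.sum_range_add]
      simp only [← Function.iterate_add_apply, add_comm m]
      exact le_rfl
  refine hco.eventually_ge hS (fun n => ?_) hb
  have hint : Integrable φ μ := Integrable.of_bound hφ.aestronglyMeasurable C
    (Eventually.of_forall fun x => by simpa [Real.norm_eq_abs] using hC x)
  have hmp := fun j => hS.toMeasurePreserving.iterate j
  have hI : ∀ j, ∫ x, φ (S^[j] x) ∂μ = ∫ x, φ x ∂μ := by
    intro j
    conv_rhs => rw [← (hmp j).map_eq]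
    rw [integral_map (hmp j).measurable.aemeasurable]
    exact hφ.aestronglyMeasurable
  have hint' : ∀ j, Integrable (fun x => φ (S^[j] x)) μ := fun j =>
    ((hmp j).integrable_comp hint.aestronglyMeasurable).2 hint
  rw [integral_finsetSum _ fun j _ => hint' j]
  simp [hI, mul_comm]

/-- The pointwise ergodic theorem for a bounded function, as an upper bound. -/
lemma Ergodic.eventually_birkhoffSum_le (hS : Ergodic S μ) {φ : X → ℝ} (hφ : Measurable φ) {C : ℝ}
    (hC : ∀ x, |φ x| ≤ C) {b : ℝ} (hb : ∫ x, φ x ∂μ < b) :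
    ∀ᵐ x ∂μ, ∀ᶠ n : ℕ in atTop, ∑ j ∈ Finset.range n, φ (S^[j] x) ≤ b * n := by
  have := hS.eventually_le_birkhoffSum (φ := fun x => - φ x) hφ.neg (C := C) (by simpa using hC)
    (b := -b) (by rw [integral_neg]; linarith)
  filter_upwards [this] with x hx
  filter_upwards [hx] with n hn
  simp only [Finset.sum_neg_distrib] at hn
  linarith

end Birkhoff

lemma exists_bound_of_eventually_le {u v : ℕ → ℝ} (h : ∀ᶠ n in atTop, u n ≤ v n) :
    ∃ D : ℝ, 0 ≤ D ∧ ∀ n, u n ≤ v n + D := by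
  obtain ⟨N, hN⟩ := eventually_atTop.1 h
  refine ⟨∑ n ∈ Finset.range N, |u n - v n|, Finset.sum_nonneg fun _ _ => abs_nonneg _,
    fun n => ?_⟩
  rcases le_or_gt N n with hn | hn
  · have : 0 ≤ ∑ n ∈ Finset.range N, |u n - v n| := Finset.sum_nonneg fun _ _ => abs_nonneg _
    linarith [hN n hn]
  · have := Finset.single_le_sum (f := fun n => |u n - v n|) (fun _ _ => abs_nonneg _)
      (Finset.mem_range.2 hn)
    have h2 := le_abs_self (u n - v n)
    linarith

namespace IsSubadditiveCocycle

variable {X : Type*} [MeasurableSpace X] {S : X → X} {g : ℕ → X → ℝ} {C : ℝ}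
  {μ : Measure X} [IsProbabilityMeasure μ]

/-- The upper half of the subadditive ergodic theorem, uniformly over orbit segments. -/
lemma segment_le (h : IsSubadditiveCocycle S g C) (hS : Ergodic S μ) {N : ℕ} (hN : 0 < N)
    {a : ℝ} (ha : ∫ x, g N x ∂μ ≤ a * N) {ε : ℝ} (hε : 0 < ε) :
    ∀ᵐ x ∂μ, ∃ D : ℝ, ∀ n i : ℕ, n ≤ i → g (i - n) (S^[n] x) ≤ a * (i - n : ℕ) + ε * i + D := by
  have hN' : (0 : ℝ) < N := by exact_mod_cast hN
  set I := ∫ x, g N x ∂μ with hI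
  have h1 := hS.eventually_birkhoffSum_le (h.measurable N) (h.bound N) (b := I + ε * N / 2)
    (by rw [← hI]; have : 0 < ε * N := by positivity
        linarith)
  have h2 := hS.eventually_le_birkhoffSum (h.measurable N) (h.bound N) (b := I - ε * N / 2)
    (by rw [← hI]; have : 0 < ε * N := by positivity
        linarith)
  filter_upwards [h1, h2] with x hx1 hx2
  obtain ⟨D1, hD1, hx1⟩ := exists_bound_of_eventually_le hx1
  obtain ⟨D2, hD2, hx2⟩ := exists_bound_of_eventually_le hx2
  refine ⟨(D1 + D2 + 3 * C * N ^ 2) / N, fun n i hni => ?_⟩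
  obtain ⟨m, rfl⟩ := Nat.exists_eq_add_of_le hni
  rw [Nat.add_sub_cancel_left]
  have h3 := h.mul_le_sum N m (S^[n] x)
  -- The sum over the segment is a difference of two Birkhoff sums based at `x`. This is why the
  -- error is proportional to the end time and not to the length of the segment.
  have h4 := hx1 (n + m)
  have h5 := hx2 n
  rw [Finset.sum_range_add] at h4
  have h6 : ∀ j, S^[n + j] x = S^[j] (S^[n] x) := fun j => by
    rw [add_comm, Function.iterate_add_apply]
  simp only [h6] at h4
  push_cast at h4 ⊢
  have h7 : I * m ≤ a * N * m := by gcongr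
  refine le_of_mul_le_mul_left (a := (N : ℝ)) ?_ hN'
  have h8 : N * (a * m + ε * (n + m) + (D1 + D2 + 3 * C * N ^ 2) / N) =
    a * N * m + ε * N * (n + m) + (D1 + D2 + 3 * C * N ^ 2) := by field_simp
  rw [h8]
  have h9 : 0 ≤ ε * N * m := by positivity
  nlinarith

/-- The subadditive ergodic theorem: the growth rate exists, and the upper bound is uniform over
orbit segments. -/
theorem exists_rate (h : IsSubadditiveCocycle S g C) (hS : Ergodic S μ) :
    ∃ a : ℝ, ∀ᵐ x ∂μ, ∀ ε > 0, ∃ D : ℝ,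
      (∀ n i : ℕ, n ≤ i → g (i - n) (S^[n] x) ≤ a * (i - n : ℕ) + ε * i + D) ∧
      (∀ n : ℕ, a * n ≤ g n x + ε * n + D) := by
  have : Nonempty X := (μ.nonempty_of_neZero)
  have hC := h.nonneg
  -- The rate is the infimum of the mean growth per step; the shift of the index avoids division by
  -- zero.
  let u : ℕ → ℝ := fun n => (∫ x, g (n + 1) x ∂μ) / (n + 1 : ℕ)
  have hu : BddBelow (Set.range u) := by
    refine ⟨-C, ?_⟩
    rintro _ ⟨n, rfl⟩
    have hn : (0 : ℝ) < (n + 1 : ℕ) := by positivity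
    simp only [u]
    rw [le_div_iff₀ hn]
    have := integral_mono (integrable_const (-(C * (n + 1 : ℕ)))) (h.integrable μ (n + 1))
      (fun x => h.ge (n + 1) x)
    simp only [integral_const, probReal_univ, smul_eq_mul, one_mul] at this
    linarith
  refine ⟨⨅ n, u n, ?_⟩
  set a := ⨅ n, u n with hadef
  have ha : ∀ n : ℕ, a * n ≤ ∫ x, g n x ∂μ := by
    intro n
    rcases n with _ | n
    · have : ∀ x, g 0 x = 0 := fun x => by simpa using h.bound 0 x
      simp [this]
    · have hn : (0 : ℝ) < (n + 1 : ℕ) := by positivity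
      rw [← le_div_iff₀ hn]
      exact ciInf_le hu n
  have key : ∀ k : ℕ, ∀ᵐ x ∂μ, ∃ D : ℝ,
      (∀ n i : ℕ, n ≤ i → g (i - n) (S^[n] x) ≤ a * (i - n : ℕ) + (1 / (k + 1 : ℝ)) * i + D) ∧
      (∀ n : ℕ, a * n ≤ g n x + (1 / (k + 1 : ℝ)) * n + D) := by
    intro k
    set ε : ℝ := 1 / (k + 1 : ℝ) with hεdef
    have hε : 0 < ε := by positivity
    obtain ⟨n, hn⟩ := exists_lt_of_ciInf_lt (show ⨅ n, u n < a + ε / 2 by linarith)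
    have hn0 : (0 : ℝ) < (n + 1 : ℕ) := by positivity
    have hseg := h.segment_le hS (N := n + 1) (by omega) (a := a + ε / 2) (by
      rw [← div_le_iff₀ hn0]; exact hn.le) (half_pos hε)
    filter_upwards [hseg, h.eventually_ge hS ha (b := a - ε) (by linarith)] with x ⟨D1, hD1⟩ hx2
    obtain ⟨D2, hD2, hx2⟩ := exists_bound_of_eventually_le hx2
    refine ⟨max D1 D2, fun n i hni => ?_, fun n => ?_⟩
    · have := hD1 n i hni
      have h2 : ((i - n : ℕ) : ℝ) ≤ i := by exact_mod_cast Nat.sub_le i n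
      nlinarith [le_max_left D1 D2]
    · have := hx2 n
      nlinarith [le_max_right D1 D2]
  filter_upwards [ae_all_iff.2 key] with x hx ε hε
  obtain ⟨k, hk⟩ := exists_nat_one_div_lt hε
  obtain ⟨D, h1, h2⟩ := hx k
  refine ⟨D, fun n i hni => ?_, fun n => ?_⟩
  · refine (h1 n i hni).trans ?_
    gcongr
  · refine (h2 n).trans ?_
    gcongr

end IsSubadditiveCocycle

/-! ### Growth of `k`-dimensional volumes under a linear map -/

section VolumeGrowth

variable {E : Type*} [NormedAddCommGroup E] [NormedSpace ℝ E]

/-- The norm of the pullback operator of `A` on continuous alternating `k`-forms. It is comparable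
to the product of the `k` largest singular values of `A`. -/
noncomputable def volumeGrowth (k : ℕ) (A : E →L[ℝ] E) : ℝ :=
  ‖(ContinuousAlternatingMap.compContinuousLinearMapCLM A :
    (E [⋀^Fin k]→L[ℝ] ℝ) →L[ℝ] (E [⋀^Fin k]→L[ℝ] ℝ))‖

lemma volumeGrowth_nonneg (k : ℕ) (A : E →L[ℝ] E) : 0 ≤ volumeGrowth k A := by
  exact ContinuousLinearMap.opNorm_nonneg _

lemma norm_compContinuousLinearMap_le_volumeGrowth {k : ℕ} (A : E →L[ℝ] E)
    (α : E [⋀^Fin k]→L[ℝ] ℝ) :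
    ‖α.compContinuousLinearMap A‖ ≤ volumeGrowth k A * ‖α‖ :=
  (ContinuousAlternatingMap.compContinuousLinearMapCLM A :
    (E [⋀^Fin k]→L[ℝ] ℝ) →L[ℝ] (E [⋀^Fin k]→L[ℝ] ℝ)).le_opNorm α

lemma volumeGrowth_comp_le (k : ℕ) (A B : E →L[ℝ] E) :
    volumeGrowth k (A ∘L B) ≤ volumeGrowth k A * volumeGrowth k B := by
  refine ContinuousLinearMap.opNorm_le_bound _ 
    (mul_nonneg (volumeGrowth_nonneg k A) (volumeGrowth_nonneg k B)) fun α => ?_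
  have h1 := norm_compContinuousLinearMap_le_volumeGrowth B (α.compContinuousLinearMap A)
  have h2 := norm_compContinuousLinearMap_le_volumeGrowth A α
  have h3 : (ContinuousAlternatingMap.compContinuousLinearMapCLM (A ∘L B)) α =
    (α.compContinuousLinearMap A).compContinuousLinearMap B := rfl
  rw [h3]
  nlinarith [volumeGrowth_nonneg k B, mul_le_mul_of_nonneg_left h2 (volumeGrowth_nonneg k B)]

lemma volumeGrowth_le_pow (k : ℕ) (A : E →L[ℝ] E) : volumeGrowth k A ≤ ‖A‖ ^ k := by
  refine ContinuousLinearMap.opNorm_le_bound _ (by positivity) fun α => ?_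
  have := α.norm_compContinuousLinearMap_le A
  rw [Fintype.card_fin, mul_comm] at this
  exact this

lemma continuous_volumeGrowth (k : ℕ) : Continuous (volumeGrowth (E := E) k) := by
  unfold volumeGrowth
  exact (ContinuousAlternatingMap.continuous_compContinuousLinearMapCLM (𝕜 := ℝ) (E := E) (F := E)
    (G := ℝ) (ι := Fin k)).norm

lemma one_le_volumeGrowth_id (k : ℕ) [Nontrivial (E [⋀^Fin k]→L[ℝ] ℝ)] :
    1 ≤ volumeGrowth k (ContinuousLinearMap.id ℝ E) := by
  obtain ⟨α, hα⟩ := exists_ne (0 : E [⋀^Fin k]→L[ℝ] ℝ)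
  have h := norm_compContinuousLinearMap_le_volumeGrowth (ContinuousLinearMap.id ℝ E) α
  have h2 : α.compContinuousLinearMap (ContinuousLinearMap.id ℝ E) = α := by ext; rfl
  rw [h2] at h
  have := norm_pos_iff.2 hα
  by_contra! hlt
  nlinarith

lemma volumeGrowth_eq_zero_of_finrank_lt [FiniteDimensional ℝ E] {k : ℕ}
    (hk : Module.finrank ℝ E < k) (A : E →L[ℝ] E) : volumeGrowth k A = 0 := by
  have : ∀ α : E [⋀^Fin k]→L[ℝ] ℝ, α = 0 := by
    intro α
    ext v
    refine α.toAlternatingMap.map_linearDependent v fun hv => ?_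
    have := hv.fintype_card_le_finrank
    rw [Fintype.card_fin] at this
    omega
  have h0 : (ContinuousAlternatingMap.compContinuousLinearMapCLM A :
      (E [⋀^Fin k]→L[ℝ] ℝ) →L[ℝ] (E [⋀^Fin k]→L[ℝ] ℝ)) = 0 := by
    ext α : 1
    exact this _
  rw [volumeGrowth, h0]
  exact ContinuousLinearMap.opNorm_zero

lemma norm_apply_le_volumeGrowth_one (A : E →L[ℝ] E) (v : E) :
    ‖A v‖ ≤ volumeGrowth 1 A * ‖v‖ := by
  refine NormedSpace.norm_le_dual_bound ℝ _
    (mul_nonneg (volumeGrowth_nonneg _ _) (norm_nonneg _)) fun ξ => ?_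
  let α : E [⋀^Fin 1]→L[ℝ] ℝ := ContinuousAlternatingMap.ofSubsingleton ℝ E ℝ 0 ξ
  have hα : ‖α‖ = ‖ξ‖ := ContinuousAlternatingMap.norm_ofSubsingleton 0 ξ
  have h1 := (α.compContinuousLinearMap A).le_opNorm (fun _ => v)
  have h2 := norm_compContinuousLinearMap_le_volumeGrowth A α
  have h3 : (α.compContinuousLinearMap A) (fun _ => v) = ξ (A v) := rfl
  rw [h3] at h1
  rw [hα] at h2
  simp only [Finset.univ_unique, Finset.prod_const, Finset.card_singleton, pow_one] at h1
  refine h1.trans ((mul_le_mul_of_nonneg_right h2 (norm_nonneg v)).trans (le_of_eq (by ring)))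

/-- A linear map `A` with nonzero growth of `(k + 1)`-volumes splits every vector `w` into a part
`s` which grows at most at the rate of the `(k + 2)`-nd singular value, and a part `w - s` whose
growth is controlled from below, also along intermediate steps `P` of `A = B ∘ P`. -/
lemma exists_slow_part (k : ℕ) (A : E →L[ℝ] E) (hA : 0 < volumeGrowth (k + 1) A) :
    ∃ F : Submodule ℝ E, FiniteDimensional ℝ F ∧ Module.finrank ℝ F ≤ k + 1 ∧ ∀ w : E, ∃ s : E,
      w - s ∈ F ∧ ‖A s‖ ≤ 2 * (k + 2) * (volumeGrowth (k + 2) A / volumeGrowth (k + 1) A) * ‖w‖ ∧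
      ∀ P B : E →L[ℝ] E, A = B ∘L P →
        ‖P (w - s)‖ ≤ 2 * (k + 1) *
          (volumeGrowth (k + 1) P * volumeGrowth k B / volumeGrowth (k + 1) A) * ‖A w‖ := by
  -- A form `α` of norm less than one and a tuple `u` that nearly realize the volume growth, up to
  -- the factor 2 seen in the conclusion. The span of `u` plays the role of the fast directions.
  obtain ⟨α, hα1, hα⟩ := ContinuousLinearMap.exists_lt_apply_of_lt_opNorm _ (half_lt_self hA)
  obtain ⟨u, hu⟩ : ∃ u : Fin (k + 1) → E,
      volumeGrowth (k + 1) A / 2 * ∏ i, ‖u i‖ < ‖α (A ∘ u)‖ := by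
    by_contra! hcon
    exact absurd ((ContinuousAlternatingMap.opNorm_le_iff (by positivity)).2 hcon) (not_le.2 hα)
  have hu0 : ∀ i, u i ≠ 0 := by
    intro i hi
    have h1 : α (A ∘ u) = 0 := α.toAlternatingMap.map_coord_zero i (by simp [hi])
    have h2 : ∏ i, ‖u i‖ = 0 := Finset.prod_eq_zero (Finset.mem_univ i) (by simp [hi])
    rw [h1, h2] at hu
    simp at hu
  set ρ := ∏ i, ‖u i‖ with hρdef
  have hρ : 0 < ρ := Finset.prod_pos fun i _ => norm_pos_iff.2 (hu0 i)
  set V := volumeGrowth (k + 1) A with hV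
  set o := α (A ∘ u) with ho
  have ho0 : o ≠ 0 := by
    intro h0
    rw [h0, norm_zero] at hu
    have : 0 < V / 2 * ρ := by positivity
    linarith
  refine ⟨Submodule.span ℝ (Set.range u), FiniteDimensional.span_of_finite ℝ (Set.finite_range u),
    (finrank_range_le_card u).trans (by simp), fun w => ?_⟩
  -- Cramer's rule: `c l` is the quotient of the volumes `α` after and before replacing the `l`-th
  -- vector of `A ∘ u` by `A w`.
  let c : Fin (k + 1) → ℝ := fun l => (-1) ^ (l : ℕ) * α (Fin.cons (A w) (A ∘ l.removeNth u)) / o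
  have key : ∀ (x : E) (R : ℝ), 0 ≤ R → (∀ ξ : StrongDual ℝ E, ‖ξ x * o‖ ≤ R * ρ * ‖ξ‖) →
      ‖x‖ ≤ 2 * (R / V) := by
    intro x R hR hx
    refine NormedSpace.norm_le_dual_bound ℝ x (by positivity) fun ξ => ?_
    have h1 := hx ξ
    rw [norm_mul] at h1
    have h2 : ‖ξ x‖ * (V / 2 * ρ) ≤ R * ρ * ‖ξ‖ :=
      (mul_le_mul_of_nonneg_left hu.le (norm_nonneg _)).trans h1
    have h3 : 2 * (R / V) * ‖ξ‖ = R * ρ * ‖ξ‖ / (V / 2 * ρ) := by field_simp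
    rw [h3, le_div_iff₀ (by positivity)]
    exact h2
  refine ⟨w - ∑ l, c l • u l, ?_, ?_, ?_⟩
  · rw [sub_sub_cancel]
    exact Submodule.sum_mem _ fun l _ => Submodule.smul_mem _ _ (Submodule.subset_span ⟨l, rfl⟩)
  · have := key (A (w - ∑ l, c l • u l)) ((k + 2) * volumeGrowth (k + 2) A * ‖w‖)
      (mul_nonneg (mul_nonneg (by positivity) (volumeGrowth_nonneg _ _)) (norm_nonneg _)) ?_
    · refine this.trans (le_of_eq ?_)
      field_simp
    intro ξ
    -- Up to normalization this is the wedge product of `ξ` and `α`. With the Cramer coefficients,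
    -- `ξ (A s) * o` is its value on the images of `w` and `u`, hence controlled by the growth of
    -- `(k + 2)`-volumes.
    let Ξ : E [⋀^Fin (k + 2)]→L[ℝ] ℝ :=
      ContinuousAlternatingMap.alternatizeUncurryFin (ξ.smulRight α)
    have hΞ : ‖Ξ‖ ≤ (k + 2) * ‖ξ‖ := by
      refine (ContinuousAlternatingMap.norm_alternatizeUncurryFin_le _).trans ?_
      rw [ContinuousLinearMap.norm_smulRight_apply]
      push_cast
      have : ‖ξ‖ * ‖α‖ ≤ ‖ξ‖ := mul_le_of_le_one_right (norm_nonneg _) hα1.le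
      nlinarith [norm_nonneg ξ]
    have hval : ξ (A (w - ∑ l, c l • u l)) * o =
        (Ξ.compContinuousLinearMap A) (Fin.cons w u) := by
      have e1 : (Ξ.compContinuousLinearMap A) (Fin.cons w u) = Ξ (Fin.cons (A w) (A ∘ u)) := by
        rw [ContinuousAlternatingMap.compContinuousLinearMap_apply]
        congr 1
        ext i
        refine Fin.cases ?_ (fun j => ?_) i <;> simp
      have e2 : ∀ l : Fin (k + 1), l.succ.removeNth (Fin.cons (A w) (A ∘ u) : Fin (k + 2) → E) =
          Fin.cons (A w) (A ∘ l.removeNth u) := by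
        intro l
        ext i
        refine Fin.cases ?_ (fun j => ?_) i
        · simp [Fin.removeNth]
        · simp [Fin.removeNth]
      have e3 : Ξ (Fin.cons (A w) (A ∘ u)) = ξ (A w) * o + ∑ l : Fin (k + 1),
          (-1) ^ ((l : ℕ) + 1) * (ξ (A (u l)) * α (Fin.cons (A w) (A ∘ l.removeNth u))) := by
        rw [ContinuousAlternatingMap.alternatizeUncurryFin_apply, Fin.sum_univ_succ]
        simp [e2, o]
      rw [e1, e3]
      simp only [map_sub, map_sum, map_smul, smul_eq_mul, sub_mul, Finset.sum_mul, c]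
      rw [sub_eq_add_neg, ← Finset.sum_neg_distrib]
      congr 1
      refine Finset.sum_congr rfl fun l _ => ?_
      rw [pow_succ]
      field_simp
    rw [hval]
    refine (ContinuousAlternatingMap.le_opNorm _ _).trans ?_
    rw [Fin.prod_univ_succ]
    simp only [Fin.cons_zero, Fin.cons_succ]
    have h1 := norm_compContinuousLinearMap_le_volumeGrowth A Ξ
    have h2 : volumeGrowth (k + 2) A * ‖Ξ‖ ≤ volumeGrowth (k + 2) A * ((k + 2) * ‖ξ‖) :=
      mul_le_mul_of_nonneg_left hΞ (volumeGrowth_nonneg _ _)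
    calc ‖Ξ.compContinuousLinearMap A‖ * (‖w‖ * ρ)
        ≤ volumeGrowth (k + 2) A * ((k + 2) * ‖ξ‖) * (‖w‖ * ρ) := by
          gcongr; exact h1.trans h2
      _ = _ := by ring
  · intro P B hAPB
    have hAP : ∀ x, A x = B (P x) := fun x => by rw [hAPB]; rfl
    have := key (P (w - (w - ∑ l, c l • u l)))
      ((k + 1) * (volumeGrowth (k + 1) P * volumeGrowth k B) * ‖A w‖)
      (mul_nonneg (mul_nonneg (by positivity)
        (mul_nonneg (volumeGrowth_nonneg _ _) (volumeGrowth_nonneg _ _))) (norm_nonneg _)) ?_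
    · refine this.trans (le_of_eq ?_)
      field_simp
    intro ξ
    -- The numerators of the Cramer coefficients contract `α` with `A w`. Of the factorization `A =
    -- B ∘ P`, the remaining `k` slots see `B`, and the wedge of `ξ` with `η` is then pulled back by
    -- `P`; this produces the product of the two growths.
    let η : E [⋀^Fin k]→L[ℝ] ℝ := (α.curryLeft (A w)).compContinuousLinearMap B
    have hη : ‖η‖ ≤ volumeGrowth k B * ‖A w‖ := by
      refine (norm_compContinuousLinearMap_le_volumeGrowth B _).trans ?_
      refine mul_le_mul_of_nonneg_left ?_ (volumeGrowth_nonneg _ _)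
      refine (α.curryLeft.le_opNorm _).trans ?_
      rw [ContinuousAlternatingMap.norm_curryLeft]
      exact mul_le_of_le_one_left (norm_nonneg _) hα1.le
    let Ξ : E [⋀^Fin (k + 1)]→L[ℝ] ℝ :=
      ContinuousAlternatingMap.alternatizeUncurryFin (ξ.smulRight η)
    have hΞ : ‖Ξ‖ ≤ (k + 1) * (‖ξ‖ * (volumeGrowth k B * ‖A w‖)) := by
      refine (ContinuousAlternatingMap.norm_alternatizeUncurryFin_le _).trans ?_
      rw [ContinuousLinearMap.norm_smulRight_apply]
      gcongr
    have hval : ξ (P (w - (w - ∑ l, c l • u l))) * o = (Ξ.compContinuousLinearMap P) u := by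
      rw [ContinuousAlternatingMap.compContinuousLinearMap_apply,
        ContinuousAlternatingMap.alternatizeUncurryFin_apply, sub_sub_cancel]
      simp only [map_sum, map_smul, smul_eq_mul, Finset.sum_mul, c]
      refine Finset.sum_congr rfl fun l _ => ?_
      have e2 : (Fin.cons (A w) (A ∘ l.removeNth u) : Fin (k + 1) → E) =
          Matrix.vecCons (A w) (B ∘ (l.removeNth (P ∘ u))) := by
        rw [Matrix.vecCons]
        congr 1
        ext i
        simp [Fin.removeNth, hAP]
      simp only [ContinuousLinearMap.smulRight_apply, ContinuousAlternatingMap.smul_apply,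
        smul_eq_mul, zsmul_eq_mul, η, ContinuousAlternatingMap.compContinuousLinearMap_apply,
        ContinuousAlternatingMap.curryLeft_apply_apply, e2, Function.comp_apply]
      push_cast
      field_simp
    rw [hval]
    refine (ContinuousAlternatingMap.le_opNorm _ _).trans ?_
    have h1 := norm_compContinuousLinearMap_le_volumeGrowth P Ξ
    have h2 := mul_le_mul_of_nonneg_left hΞ (volumeGrowth_nonneg (k + 1) P)
    calc ‖Ξ.compContinuousLinearMap P‖ * ρ
        ≤ volumeGrowth (k + 1) P * ((k + 1) * (‖ξ‖ * (volumeGrowth k B * ‖A w‖))) * ρ := by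
          gcongr; exact h1.trans h2
      _ = _ := by ring

end VolumeGrowth

/-- The determinant of the first `k` coordinates is a nonzero form. -/
lemma nontrivial_alternatingForms {d k : ℕ} (hk : k ≤ d) :
    Nontrivial (EuclideanSpace ℝ (Fin d) [⋀^Fin k]→L[ℝ] ℝ) := by
  let L : EuclideanSpace ℝ (Fin d) →ₗ[ℝ] (Fin k → ℝ) :=
    { toFun := fun v j => v (Fin.castLE hk j)
      map_add' := fun _ _ => rfl
      map_smul' := fun _ _ => rfl }
  let D : EuclideanSpace ℝ (Fin d) [⋀^Fin k]→ₗ[ℝ] ℝ :=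
    (Matrix.detRowAlternating (R := ℝ) (n := Fin k)).compLinearMap L
  have hD : Continuous D := by
    change Continuous fun v : Fin k → EuclideanSpace ℝ (Fin d) =>
      Matrix.det (Matrix.of fun i j => v i (Fin.castLE hk j))
    fun_prop
  let D' : EuclideanSpace ℝ (Fin d) [⋀^Fin k]→L[ℝ] ℝ :=
    { D with cont := hD }
  refine ⟨D', 0, fun h => ?_⟩
  have h1 : D' (fun i => EuclideanSpace.single (Fin.castLE hk i) 1) = 0 := by rw [h]; rfl
  have h2 : D' (fun i => EuclideanSpace.single (Fin.castLE hk i) 1) =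
      Matrix.det (1 : Matrix (Fin k) (Fin k) ℝ) := by
    change Matrix.det _ = _
    congr 1
    ext i j
    change (EuclideanSpace.single (Fin.castLE hk i) (1 : ℝ) : EuclideanSpace ℝ (Fin d))
      (Fin.castLE hk j) = _
    simp [Matrix.one_apply, eq_comm]
  rw [h2] at h1
  simp at h1

/-! ### Lyapunov exponents of a sequence of linear maps -/

section SlowVectors

variable {E : Type*} [NormedAddCommGroup E] [NormedSpace ℝ E]

/-- `P i` splits every vector `w` into a part `s` growing at rate at most `χ'` and a part `w - s`
which has been growing at rate at least `χ`, up to subexponential errors. -/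
def HasSplitting (P : ℕ → E →L[ℝ] E) (χ χ' : ℝ) : Prop :=
  ∀ ε > 0, ∃ D : ℝ, ∀ (i : ℕ) (w : E), ∃ s : E,
    ‖P i s‖ ≤ Real.exp ((χ' + ε) * i + D) * ‖w‖ ∧
    ∀ n ≤ i, ‖P n (w - s)‖ ≤ Real.exp (-χ * ((i : ℝ) - n) + ε * i + D) * ‖P i w‖

/-- The vector `v` grows at rate at most `χ` under `P`. -/
def HasUpperRate (P : ℕ → E →L[ℝ] E) (v : E) (χ : ℝ) : Prop :=
  ∀ ε > 0, ∃ D : ℝ, ∀ n : ℕ, ‖P n v‖ ≤ Real.exp ((χ + ε) * n + D)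

/-- A vector slow at time `m` is corrected backwards in time: at each `i` the current vector is
replaced by its slow part. The first correction is small because `z` is slow at time `m`; it gives
the term with `η - ε`. The correction at a later stage `i` has size at most a constant times `exp
((χ' + 2 * ε) * n) * r ^ (i - n)` at time `n`, since the fast part decays backwards at rate `χ`
while the vector itself grows at most at rate `χ' + ε`. The normalization of `G` turns the geometric
sum of these errors into a telescoping difference, and `n₀` keeps the accumulated error at time `0`
small enough that the norm of the corrected vector never exceeds `2 * R`. -/
lemma descend_splitting {P : ℕ → E →L[ℝ] E} (hP0 : ∀ v, P 0 v = v) {χ χ' ε η B D G R : ℝ}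
    (hB : ∀ i v, ‖P i v‖ ≤ Real.exp B * ‖P (i + 1) v‖)
    (hsplit : ∀ (i : ℕ) (w : E), ∃ s : E,
      ‖P i s‖ ≤ Real.exp ((χ' + ε) * i + D) * ‖w‖ ∧
      ∀ n ≤ i, ‖P n (w - s)‖ ≤ Real.exp (-χ * ((i : ℝ) - n) + ε * i + D) * ‖P i w‖)
    (hε : ε ≤ η) {r : ℝ} (hr : r = Real.exp (-(χ - χ' - 2 * ε))) (hr1 : r < 1)
    (hG : G * (1 - r) = Real.exp (2 * D + B + χ' + ε)) {n₀ : ℕ} (hn₀ : G * r ^ n₀ ≤ 1 / 2)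
    {m : ℕ} {z : E} (hz : ‖P m z‖ ≤ Real.exp ((χ - η) * m)) (hzR : ‖z‖ + Real.exp D ≤ R) (j : ℕ) :
    ∀ i, i + j = m → n₀ ≤ i → ∃ t : E,
      ‖P i t‖ ≤ Real.exp ((χ' + ε) * i + D) * (2 * R) ∧
      ∀ n ≤ i, ‖P n (z - t)‖ ≤ Real.exp (χ * n + D - (η - ε) * m) +
        2 * R * G * Real.exp ((χ' + 2 * ε) * n) * (r ^ (i - n) - r ^ (m - n)) := by
  have hr0 : 0 < r := hr ▸ Real.exp_pos _
  have hGpos : 0 < G := by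
    have : 0 < G * (1 - r) := hG ▸ Real.exp_pos _
    exact pos_of_mul_pos_left this (by linarith)
  have hRpos : 0 < R := lt_of_lt_of_le (by positivity) hzR
  induction j with
  | zero =>
    rintro i rfl -
    rw [add_zero] at hz ⊢
    obtain ⟨s, hs1, hs2⟩ := hsplit i z
    refine ⟨s, hs1.trans ?_, fun n hn => (hs2 n hn).trans ?_⟩
    · gcongr
      have := Real.exp_pos D
      linarith
    · rw [sub_self, mul_zero, add_zero]
      refine (mul_le_mul_of_nonneg_left hz (Real.exp_pos _).le).trans (le_of_eq ?_)
      rw [← Real.exp_add]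
      congr 1
      ring
  | succ j ih =>
    intro i him hi
    obtain ⟨t, ht1, ht2⟩ := ih (i + 1) (by omega) (by omega)
    have htR : ‖t‖ ≤ 2 * R := by
      have h1 := ht2 0 (by omega)
      rw [hP0] at h1
      simp only [Nat.cast_zero, mul_zero, zero_add, Real.exp_zero, mul_one, Nat.sub_zero] at h1
      have h2 : Real.exp (D - (η - ε) * m) ≤ Real.exp D := by
        rw [Real.exp_le_exp]
        have : 0 ≤ (η - ε) * m := mul_nonneg (by linarith) (by positivity)
        linarith
      have h3 : r ^ (i + 1) - r ^ m ≤ r ^ n₀ := by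
        have : r ^ (i + 1) ≤ r ^ n₀ := pow_le_pow_of_le_one hr0.le hr1.le (by omega)
        have : 0 < r ^ m := by positivity
        linarith
      have h4 : 2 * R * G * (r ^ (i + 1) - r ^ m) ≤ R := by
        calc 2 * R * G * (r ^ (i + 1) - r ^ m) ≤ 2 * R * G * r ^ n₀ := by gcongr
          _ = 2 * R * (G * r ^ n₀) := by ring
          _ ≤ 2 * R * (1 / 2) := by gcongr
          _ = R := by ring
      have h5 : ‖t‖ ≤ ‖z‖ + ‖z - t‖ := by
        have := norm_sub_le z (z - t)
        rwa [sub_sub_cancel] at this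
      linarith
    obtain ⟨s, hs1, hs2⟩ := hsplit i t
    refine ⟨s, hs1.trans (by gcongr), fun n hn => ?_⟩
    have h1 := ht2 n (by omega)
    have h2 := hs2 n hn
    have h3 : ‖P i t‖ ≤ Real.exp B * (Real.exp ((χ' + ε) * (i + 1 : ℕ) + D) * (2 * R)) :=
      (hB i t).trans (by gcongr)
    have h4 : Real.exp (-χ * ((i : ℝ) - n) + ε * i + D) * ‖P i t‖ ≤
        2 * R * G * Real.exp ((χ' + 2 * ε) * n) * (r ^ (i - n) - r ^ (i + 1 - n)) := by
      refine (mul_le_mul_of_nonneg_left h3 (Real.exp_pos _).le).trans (le_of_eq ?_)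
      have e1 : r ^ (i - n) - r ^ (i + 1 - n) = r ^ (i - n) * (1 - r) := by
        rw [show i + 1 - n = i - n + 1 by omega, pow_succ]; ring
      have e2 : r ^ (i - n) = Real.exp (-(χ - χ' - 2 * ε) * ((i : ℝ) - n)) := by
        rw [hr, ← Real.exp_nat_mul, Nat.cast_sub hn]
        congr 1
        ring
      rw [e1]
      calc _ = 2 * R * (Real.exp (-χ * ((i : ℝ) - n) + ε * i + D) * (Real.exp B *
              Real.exp ((χ' + ε) * (i + 1 : ℕ) + D))) := by ring
        _ = 2 * R * (Real.exp (2 * D + B + χ' + ε) * Real.exp ((χ' + 2 * ε) * n) *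
              Real.exp (-(χ - χ' - 2 * ε) * ((i : ℝ) - n))) := by
            rw [← Real.exp_add, ← Real.exp_add, ← Real.exp_add, ← Real.exp_add]
            congr 2
            push_cast
            ring
        _ = _ := by rw [← hG, e2]; ring
    have h5 : z - s = (z - t) + (t - s) := by abel
    rw [h5, map_add]
    refine (norm_add_le _ _).trans ((add_le_add h1 (h2.trans h4)).trans (le_of_eq ?_))
    ring

/-- A limit of vectors which are slow at late times is slow at all times. -/
lemma hasUpperRate_of_tendsto {P : ℕ → E →L[ℝ] E} (hP0 : ∀ v, P 0 v = v) {χ χ' B : ℝ}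
    (hB : ∀ i v, ‖P i v‖ ≤ Real.exp B * ‖P (i + 1) v‖) (hsplit : HasSplitting P χ χ')
    (hχ : χ' < χ) {η : ℝ} (hη : 0 < η) {m : ℕ → ℕ} (hm : Tendsto m atTop atTop) {z : ℕ → E}
    {y : E} (hz : Tendsto z atTop (𝓝 y))
    (hslow : ∀ j, ‖P (m j) (z j)‖ ≤ Real.exp ((χ - η) * m j)) : HasUpperRate P y χ' := by
  intro ε₀ hε₀
  obtain ⟨ε, hε, hε1, hε2, hε3⟩ : ∃ ε > 0, 2 * ε < ε₀ ∧ ε < η ∧ 2 * ε < χ - χ' := by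
    refine ⟨min (ε₀ / 3) (min (η / 2) ((χ - χ') / 3)), ?_, ?_, ?_, ?_⟩
    · refine lt_min (by linarith) (lt_min (by linarith) (by linarith))
    · have := min_le_left (ε₀ / 3) (min (η / 2) ((χ - χ') / 3)); linarith
    · have := (min_le_right (ε₀ / 3) (min (η / 2) ((χ - χ') / 3))).trans (min_le_left _ _)
      linarith
    · have := (min_le_right (ε₀ / 3) (min (η / 2) ((χ - χ') / 3))).trans (min_le_right _ _)
      linarith
  obtain ⟨D, hD⟩ := hsplit ε hε
  set r := Real.exp (-(χ - χ' - 2 * ε)) with hr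
  have hr0 : 0 < r := Real.exp_pos _
  have hr1 : r < 1 := by rw [hr, Real.exp_lt_one_iff]; linarith
  set G := Real.exp (2 * D + B + χ' + ε) / (1 - r) with hGdef
  have hG : G * (1 - r) = Real.exp (2 * D + B + χ' + ε) := by
    rw [hGdef, div_mul_cancel₀]; linarith
  have hGpos : 0 < G := div_pos (Real.exp_pos _) (by linarith)
  obtain ⟨n₀, hn₀⟩ : ∃ n₀ : ℕ, G * r ^ n₀ ≤ 1 / 2 := by
    obtain ⟨n₀, h⟩ := exists_pow_lt_of_lt_one (show 0 < 1 / 2 / G by positivity) hr1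
    refine ⟨n₀, ?_⟩
    rw [lt_div_iff₀ hGpos] at h
    linarith
  set R := ‖y‖ + 1 + Real.exp D with hR
  have hRpos : 0 < R := by positivity
  have hbound : ∀ n ≥ n₀, ‖P n y‖ ≤ (2 * R * Real.exp D + 2 * R * G) *
      Real.exp ((χ' + 2 * ε) * n) := by
    intro n hn
    -- For fixed `n`, descend from time `m j` to time `n`. The last term is the trace of the fast
    -- part at time `m j` and vanishes as `j` tends to infinity.
    have hev : ∀ᶠ j in atTop, ‖P n (z j)‖ ≤ (2 * R * Real.exp D + 2 * R * G) *
        Real.exp ((χ' + 2 * ε) * n) + Real.exp (χ * n + D - (η - ε) * m j) := by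
      have hzn : ∀ᶠ j in atTop, ‖z j‖ < ‖y‖ + 1 :=
        hz.norm.eventually (gt_mem_nhds (lt_add_one _))
      filter_upwards [hzn, hm.eventually_ge_atTop n] with j hj1 hj2
      obtain ⟨t, ht1, ht2⟩ := descend_splitting hP0 hB hD hε2.le hr hr1 hG hn₀ (hslow j)
        (R := R) (by linarith) (m j - n) n (by omega) hn
      have h1 := ht2 n le_rfl
      rw [Nat.sub_self, pow_zero] at h1
      have h2 : ‖P n (z j)‖ ≤ ‖P n t‖ + ‖P n (z j - t)‖ := by
        have := norm_add_le (P n t) (P n (z j - t))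
        rwa [← map_add, add_sub_cancel] at this
      have h3 : Real.exp ((χ' + ε) * n + D) ≤ Real.exp D * Real.exp ((χ' + 2 * ε) * n) := by
        rw [← Real.exp_add, Real.exp_le_exp]
        have : 0 ≤ ε * n := by positivity
        linarith
      have h4 : 2 * R * G * Real.exp ((χ' + 2 * ε) * n) * (1 - r ^ (m j - n)) ≤
          2 * R * G * Real.exp ((χ' + 2 * ε) * n) := by
        refine mul_le_of_le_one_right (by positivity) ?_
        have : 0 < r ^ (m j - n) := by positivity
        linarith
      have h5 := mul_le_mul_of_nonneg_right h3 (show 0 ≤ 2 * R by positivity)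
      linarith
    have hlim : Tendsto (fun j => (2 * R * Real.exp D + 2 * R * G) *
        Real.exp ((χ' + 2 * ε) * n) + Real.exp (χ * n + D - (η - ε) * m j)) atTop
        (𝓝 ((2 * R * Real.exp D + 2 * R * G) * Real.exp ((χ' + 2 * ε) * n) + 0)) := by
      refine tendsto_const_nhds.add (Real.tendsto_exp_atBot.comp ?_)
      refine tendsto_atBot_add_const_left _ _ (tendsto_neg_atTop_atBot.comp ?_)
      exact (tendsto_natCast_atTop_atTop.comp hm).const_mul_atTop (by linarith)
    rw [add_zero] at hlim
    exact le_of_tendsto_of_tendsto ((P n).continuous.norm.continuousAt.tendsto.comp hz) hlim hev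
  set K := 2 * R * Real.exp D + 2 * R * G with hK
  have hKpos : 0 < K := by positivity
  obtain ⟨D', hD'0, hD'⟩ := exists_bound_of_eventually_le
    (u := fun n => ‖P n y‖ * Real.exp (-((χ' + ε₀) * n))) (v := fun _ => K) (by
      filter_upwards [eventually_ge_atTop n₀] with n hn
      have h1 := hbound n hn
      calc _ ≤ K * Real.exp ((χ' + 2 * ε) * n) * Real.exp (-((χ' + ε₀) * n)) := by gcongr
        _ = K * Real.exp (-((ε₀ - 2 * ε) * n)) := by
          rw [mul_assoc, ← Real.exp_add]; congr 2; ring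
        _ ≤ K * 1 := by
          gcongr
          rw [Real.exp_le_one_iff]
          have : 0 ≤ (ε₀ - 2 * ε) * n := mul_nonneg (by linarith) (by positivity)
          linarith
        _ = K := mul_one K)
  refine ⟨Real.log (K + D'), fun n => ?_⟩
  have h1 := hD' n
  rw [Real.exp_add, Real.exp_log (by positivity)]
  have h2 : ‖P n y‖ = ‖P n y‖ * Real.exp (-((χ' + ε₀) * n)) * Real.exp ((χ' + ε₀) * n) := by
    rw [mul_assoc, ← Real.exp_add]; simp
  rw [h2, mul_comm]
  gcongr

end SlowVectors

/-! ### Lyapunov exponents from the rates of volume growth -/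

section VolumeRates

variable {E : Type*} [NormedAddCommGroup E] [NormedSpace ℝ E]

/-- The composition `A (n + m - 1) ∘ ⋯ ∘ A n` of `m` successive maps of a sequence. -/
noncomputable def segmentProd (A : ℕ → E →L[ℝ] E) (n : ℕ) : ℕ → E →L[ℝ] E
  | 0 => ContinuousLinearMap.id ℝ E
  | m + 1 => A (n + m) ∘L segmentProd A n m

lemma segmentProd_add (A : ℕ → E →L[ℝ] E) (n m l : ℕ) :
    segmentProd A n (m + l) = segmentProd A (n + m) l ∘L segmentProd A n m := by
  induction l with
  | zero => rfl
  | succ l ih =>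
    rw [← add_assoc, segmentProd, ih, segmentProd, ContinuousLinearMap.comp_assoc, add_assoc]

/-- The volume growth of the products of the sequence `A` has exponential rates `Λ k` for `k ≤ d`,
where `d` is the dimension, with the upper bound uniform over segments. -/
structure HasVolumeRates (A : ℕ → E →L[ℝ] E) (d : ℕ) (Λ : ℕ → ℝ) : Prop where
  upper : ∀ k ≤ d, ∀ ε > 0, ∃ D : ℝ, ∀ n m : ℕ,
    volumeGrowth k (segmentProd A n m) ≤ Real.exp (Λ k * m + ε * (n + m) + D)
  lower : ∀ k ≤ d, ∀ ε > 0, ∃ D : ℝ, ∀ m : ℕ,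
    Real.exp (Λ k * m - ε * m - D) ≤ volumeGrowth k (segmentProd A 0 m)
  vanish : ∀ m, volumeGrowth (d + 1) (segmentProd A 0 m) = 0
  expand : ∃ B : ℝ, ∀ n v, ‖v‖ ≤ Real.exp B * ‖A n v‖

namespace HasVolumeRates

variable {A : ℕ → E →L[ℝ] E} {d : ℕ} {Λ : ℕ → ℝ}

lemma exists_backward_bound (h : HasVolumeRates A d Λ) :
    ∃ B : ℝ, ∀ i v, ‖segmentProd A 0 i v‖ ≤ Real.exp B * ‖segmentProd A 0 (i + 1) v‖ := by
  obtain ⟨B, hB⟩ := h.expand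
  refine ⟨B, fun i v => ?_⟩
  have := hB (0 + i) (segmentProd A 0 i v)
  exact this

lemma norm_le_exp_mul (h : HasVolumeRates A d Λ) :
    ∃ B : ℝ, ∀ (i : ℕ) v, ‖v‖ ≤ Real.exp (B * i) * ‖segmentProd A 0 i v‖ := by
  obtain ⟨B, hB⟩ := h.exists_backward_bound
  refine ⟨B, fun i v => ?_⟩
  induction i with
  | zero => simp [segmentProd]
  | succ i ih =>
    refine ih.trans ((mul_le_mul_of_nonneg_left (hB i v) (Real.exp_pos _).le).trans (le_of_eq ?_))
    rw [← mul_assoc, ← Real.exp_add]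
    congr 2
    push_cast
    ring

lemma volumeGrowth_pos (h : HasVolumeRates A d Λ) {k : ℕ} (hk : k ≤ d) (m : ℕ) :
    0 < volumeGrowth k (segmentProd A 0 m) := by
  obtain ⟨D, hD⟩ := h.lower k hk 1 one_pos
  exact (Real.exp_pos _).trans_le (hD m)

/-- The splitting at the gap between the rates of the `(k + 1)`-st and of the `(k + 2)`-nd singular
values. -/
lemma splitting_bounds (h : HasVolumeRates A d Λ) {k : ℕ} (hk : k + 1 ≤ d) {χ' : ℝ}
    (hχ' : ∀ ε > 0, ∃ D : ℝ, ∀ m : ℕ, volumeGrowth (k + 2) (segmentProd A 0 m) ≤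
      Real.exp ((Λ (k + 1) + χ') * m + ε * m + D)) {ε : ℝ} (hε : 0 < ε) :
    ∃ D : ℝ, ∀ i : ℕ, ∃ F : Submodule ℝ E, FiniteDimensional ℝ F ∧ Module.finrank ℝ F ≤ k + 1 ∧
      ∀ w : E, ∃ s : E, w - s ∈ F ∧
        (volumeGrowth (k + 2) (segmentProd A 0 i) = 0 → segmentProd A 0 i s = 0) ∧
        ‖segmentProd A 0 i s‖ ≤ Real.exp ((χ' + ε) * i + D) * ‖w‖ ∧
        ∀ n ≤ i, ‖segmentProd A 0 n (w - s)‖ ≤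
          Real.exp (-(Λ (k + 1) - Λ k) * ((i : ℝ) - n) + ε * i + D) * ‖segmentProd A 0 i w‖ := by
  -- At most three volume factors enter each quotient below; `K` takes care of the numerical
  -- constants.
  have hε3 : 0 < ε / 3 := by positivity
  obtain ⟨D1, hD1⟩ := h.upper (k + 1) hk (ε / 3) hε3
  obtain ⟨D2, hD2⟩ := h.upper k (by omega) (ε / 3) hε3
  obtain ⟨D3, hD3⟩ := h.lower (k + 1) hk (ε / 3) hε3
  obtain ⟨D4, hD4⟩ := hχ' (ε / 3) hε3
  set K : ℝ := Real.log (2 * (k + 2)) with hK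
  have hKe : Real.exp K = 2 * (k + 2) := Real.exp_log (by positivity)
  set D := K + |D1| + |D2| + |D3| + |D4| with hDdef
  refine ⟨D, fun i => ?_⟩
  obtain ⟨F, hF1, hF2, hF⟩ := exists_slow_part k (segmentProd A 0 i) (h.volumeGrowth_pos hk i)
  refine ⟨F, hF1, hF2, fun w => ?_⟩
  obtain ⟨s, hsF, hs1, hs2⟩ := hF w
  have hVinv : (volumeGrowth (k + 1) (segmentProd A 0 i))⁻¹ ≤
      Real.exp (-(Λ (k + 1) * i - ε / 3 * i - D3)) := by
    rw [Real.exp_neg]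
    exact inv_anti₀ (Real.exp_pos _) (hD3 i)
  have hinv0 : 0 ≤ (volumeGrowth (k + 1) (segmentProd A 0 i))⁻¹ :=
    inv_nonneg.2 (volumeGrowth_nonneg _ _)
  have a1 := le_abs_self D1
  have a2 := le_abs_self D2
  have a3 := le_abs_self D3
  have a4 := le_abs_self D4
  have n1 := abs_nonneg D1
  have n2 := abs_nonneg D2
  have n4 := abs_nonneg D4
  have hεi : 0 ≤ ε * i := by positivity
  refine ⟨s, hsF, fun h0 => ?_, hs1.trans ?_, fun n hn => ?_⟩
  · simpa [h0] using hs1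
  · gcongr
    rw [div_eq_mul_inv, ← hKe]
    calc _ ≤ Real.exp K * (Real.exp ((Λ (k + 1) + χ') * i + ε / 3 * i + D4) *
            Real.exp (-(Λ (k + 1) * i - ε / 3 * i - D3))) := by
          gcongr
          exact hD4 i
      _ ≤ _ := by
        rw [← Real.exp_add, ← Real.exp_add, Real.exp_le_exp]
        linarith
  · have hni : segmentProd A 0 i = segmentProd A n (i - n) ∘L segmentProd A 0 n := by
      have := segmentProd_add A 0 n (i - n)
      rwa [Nat.add_sub_cancel' hn, zero_add] at this
    refine (hs2 _ _ hni).trans ?_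
    gcongr
    have hkK : (2 : ℝ) * (k + 1) ≤ Real.exp K := by rw [hKe]; linarith
    have h1 := hD1 0 n
    -- Here the upper rate is needed on a segment that does not start at time `0`.
    have h2 := hD2 n (i - n)
    rw [Nat.cast_sub hn] at h2
    rw [div_eq_mul_inv]
    have hni' : (n : ℝ) ≤ i := by exact_mod_cast hn
    calc _ ≤ Real.exp K * (Real.exp (Λ (k + 1) * n + ε / 3 * ((0 : ℕ) + n) + D1) *
            Real.exp (Λ k * ((i : ℝ) - n) + ε / 3 * (n + ((i : ℝ) - n)) + D2) *
            Real.exp (-(Λ (k + 1) * i - ε / 3 * i - D3))) := by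
          have hnn := volumeGrowth_nonneg k (segmentProd A n (i - n))
          have hnn' := volumeGrowth_nonneg (k + 1) (segmentProd A 0 n)
          gcongr
      _ ≤ _ := by
        rw [← Real.exp_add, ← Real.exp_add, ← Real.exp_add, Real.exp_le_exp]
        push_cast
        nlinarith

lemma hasSplitting (h : HasVolumeRates A d Λ) {k : ℕ} (hk : k + 1 ≤ d) {χ' : ℝ}
    (hχ' : ∀ ε > 0, ∃ D : ℝ, ∀ m : ℕ, volumeGrowth (k + 2) (segmentProd A 0 m) ≤
      Real.exp ((Λ (k + 1) + χ') * m + ε * m + D)) :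
    HasSplitting (segmentProd A 0) (Λ (k + 1) - Λ k) χ' := by
  intro ε hε
  obtain ⟨D, hD⟩ := h.splitting_bounds hk hχ' hε
  refine ⟨D, fun i w => ?_⟩
  obtain ⟨F, -, -, hF⟩ := hD i
  obtain ⟨s, -, -, h1, h2⟩ := hF w
  exact ⟨s, h1, h2⟩

lemma rate_bound (h : HasVolumeRates A d Λ) {k : ℕ} (hk : k + 2 ≤ d) :
    ∀ ε > 0, ∃ D : ℝ, ∀ m : ℕ, volumeGrowth (k + 2) (segmentProd A 0 m) ≤
      Real.exp ((Λ (k + 1) + (Λ (k + 2) - Λ (k + 1))) * m + ε * m + D) := by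
  intro ε hε
  obtain ⟨D, hD⟩ := h.upper (k + 2) hk ε hε
  refine ⟨D, fun m => ?_⟩
  have := hD 0 m
  simpa using this

/-- Beyond the top degree there is no volume, so the splitting at the last level holds with `χ'` as
negative as desired. -/
lemma vanish_bound (h : HasVolumeRates A (k + 1) Λ) (χ' : ℝ) :
    ∀ ε > 0, ∃ D : ℝ, ∀ m : ℕ, volumeGrowth (k + 2) (segmentProd A 0 m) ≤
      Real.exp ((Λ (k + 1) + χ') * m + ε * m + D) := by
  intro ε hε
  exact ⟨0, fun m => by rw [h.vanish m]; positivity⟩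

lemma rate_zero_nonpos (h : HasVolumeRates A d Λ) : Λ 0 ≤ 0 := by
  by_contra! hpos
  obtain ⟨D, hD⟩ := h.lower 0 (by omega) (Λ 0 / 2) (by linarith)
  obtain ⟨m, hm⟩ := exists_nat_gt (D / (Λ 0 / 2))
  rw [div_lt_iff₀ (by linarith)] at hm
  have h1 := (hD m).trans (volumeGrowth_le_pow 0 _)
  rw [pow_zero, Real.exp_le_one_iff] at h1
  linarith

lemma hasUpperRate_one (h : HasVolumeRates A d Λ) (hd : 1 ≤ d) (v : E) :
    HasUpperRate (segmentProd A 0) v (Λ 1 - Λ 0) := by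
  intro ε hε
  obtain ⟨D, hD⟩ := h.upper 1 hd ε hε
  refine ⟨D + Real.log (‖v‖ + 1), fun n => ?_⟩
  refine (norm_apply_le_volumeGrowth_one _ _).trans ?_
  rw [← add_assoc, Real.exp_add, Real.exp_log (by positivity)]
  have h0 := h.rate_zero_nonpos
  have h1 := hD 0 n
  gcongr
  · refine h1.trans (Real.exp_le_exp.2 ?_)
    have : 0 ≤ -Λ 0 * n := mul_nonneg (by linarith) (by positivity)
    push_cast
    linarith
  · linarith

/-- If the upper rate of `v` is `χ`, then either `χ` is the exact exponential rate, or `v` is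
exponentially slower along a subsequence. -/
lemma _root_.HasUpperRate.tendsto_or_slow {P : ℕ → E →L[ℝ] E} {v : E} {χ : ℝ}
    (h : HasUpperRate P v χ) (hpos : ∀ n, 0 < ‖P n v‖) :
    Tendsto (fun n : ℕ => (1 / (n : ℝ)) * Real.log ‖P n v‖) atTop (𝓝 χ) ∨
      ∃ η > 0, ∃ᶠ n : ℕ in atTop, ‖P n v‖ ≤ Real.exp ((χ - η) * n) := by
  rw [or_iff_not_imp_right]
  intro hcon
  push Not at hcon
  rw [tendsto_order]
  refine ⟨fun a ha => ?_, fun a ha => ?_⟩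
  · have := hcon ((χ - a) / 2) (by linarith)
    filter_upwards [this, eventually_gt_atTop 0] with n hn hn0
    have hn0' : (0 : ℝ) < n := by exact_mod_cast hn0
    rw [← Real.lt_log_iff_exp_lt (hpos n)] at hn
    rw [one_div, inv_mul_eq_div, lt_div_iff₀ hn0']
    nlinarith
  · obtain ⟨D, hD⟩ := h ((a - χ) / 2) (by linarith)
    obtain ⟨N, hN⟩ := exists_nat_gt (D / ((a - χ) / 2))
    rw [div_lt_iff₀ (by linarith)] at hN
    filter_upwards [eventually_gt_atTop 0, eventually_ge_atTop N] with n hn0 hnN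
    have hn0' : (0 : ℝ) < n := by exact_mod_cast hn0
    have hnN' : (N : ℝ) ≤ n := by exact_mod_cast hnN
    have h1 := hD n
    rw [← Real.log_le_iff_le_exp (hpos n)] at h1
    rw [one_div, inv_mul_eq_div, div_lt_iff₀ hn0']
    nlinarith

lemma norm_pos (h : HasVolumeRates A d Λ) {v : E} (hv : v ≠ 0) (n : ℕ) :
    0 < ‖segmentProd A 0 n v‖ := by
  obtain ⟨B, hB⟩ := h.norm_le_exp_mul
  have h1 := hB n v
  have h2 := norm_pos_iff.2 hv
  by_contra! hle
  have : ‖segmentProd A 0 n v‖ = 0 := le_antisymm hle (norm_nonneg _)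
  rw [this, mul_zero] at h1
  linarith

/-- An upper rate is not too negative. -/
lemma neg_le_of_hasUpperRate (h : HasVolumeRates A d Λ) :
    ∃ B : ℝ, ∀ v : E, v ≠ 0 → ∀ χ, HasUpperRate (segmentProd A 0) v χ → -B ≤ χ := by
  obtain ⟨B, hB⟩ := h.norm_le_exp_mul
  refine ⟨B, fun v hv χ hχ => ?_⟩
  by_contra! hlt
  obtain ⟨D, hD⟩ := hχ ((-B - χ) / 2) (by linarith)
  obtain ⟨n, hn⟩ := exists_nat_gt ((D - Real.log ‖v‖) / ((-B - χ) / 2))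
  rw [div_lt_iff₀ (by linarith)] at hn
  have h1 := (hB n v).trans (mul_le_mul_of_nonneg_left (hD n) (Real.exp_pos _).le)
  rw [← Real.exp_add, ← Real.log_le_iff_le_exp (norm_pos_iff.2 hv)] at h1
  nlinarith

/-- One step down the list of rates, obtained from `hasUpperRate_of_tendsto` with a constant
sequence of vectors. -/
lemma hasUpperRate_of_slow (h : HasVolumeRates A d Λ) {k : ℕ} (hk : k + 1 ≤ d) {χ' : ℝ}
    (hχ' : ∀ ε > 0, ∃ D : ℝ, ∀ m : ℕ, volumeGrowth (k + 2) (segmentProd A 0 m) ≤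
      Real.exp ((Λ (k + 1) + χ') * m + ε * m + D)) (hlt : χ' < Λ (k + 1) - Λ k) {v : E} {η : ℝ}
    (hη : 0 < η) (hfreq : ∃ᶠ n : ℕ in atTop,
      ‖segmentProd A 0 n v‖ ≤ Real.exp ((Λ (k + 1) - Λ k - η) * n)) :
    HasUpperRate (segmentProd A 0) v χ' := by
  obtain ⟨B, hB⟩ := h.exists_backward_bound
  obtain ⟨m, hm, hm'⟩ := extraction_of_frequently_atTop hfreq
  exact hasUpperRate_of_tendsto (fun v => rfl) hB (h.hasSplitting hk hχ') hlt hη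
    hm.tendsto_atTop (z := fun _ => v) tendsto_const_nhds hm'

/-- If the volume growth has exponential rates in all dimensions, then every nonzero vector has a
Lyapunov exponent. -/
theorem exists_exponent (h : HasVolumeRates A d Λ) (hd : 1 ≤ d) {v : E} (hv : v ≠ 0) :
    ∃ l : ℝ, Tendsto (fun n : ℕ => (1 / (n : ℝ)) * Real.log ‖segmentProd A 0 n v‖) atTop (𝓝 l) := by
  by_contra hno
  push Not at hno
  -- At each level either the rate is attained, which is excluded here, or the vector is slower
  -- along a subsequence and drops to the next level.
  have hupper : ∀ k, k + 1 ≤ d → HasUpperRate (segmentProd A 0) v (Λ (k + 1) - Λ k) := by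
    intro k
    induction k with
    | zero => exact fun _ => h.hasUpperRate_one hd v
    | succ k ih =>
      intro hk
      have h1 := ih (by omega)
      rcases h1.tendsto_or_slow (h.norm_pos hv) with ht | ⟨η, hη, hfreq⟩
      · exact absurd ht (hno _)
      · rcases lt_or_ge (Λ (k + 2) - Λ (k + 1)) (Λ (k + 1) - Λ k) with hlt | hge
        · exact h.hasUpperRate_of_slow (by omega) (h.rate_bound hk) hlt hη hfreq
        -- Without a gap between two consecutive rates the upper bound is simply inherited.
        · intro ε hε
          obtain ⟨D, hD⟩ := h1 ε hε
          refine ⟨D, fun n => (hD n).trans (Real.exp_le_exp.2 ?_)⟩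
          gcongr
  obtain ⟨k, rfl⟩ : ∃ k, d = k + 1 := ⟨d - 1, by omega⟩
  have h1 := hupper k le_rfl
  rcases h1.tendsto_or_slow (h.norm_pos hv) with ht | ⟨η, hη, hfreq⟩
  · exact hno _ ht
  · obtain ⟨B, hB⟩ := h.neg_le_of_hasUpperRate
    -- At the last level the new rate can be chosen below `-B`, contradicting the bounded
    -- contraction.
    have h2 := h.hasUpperRate_of_slow le_rfl
      (h.vanish_bound (min (-B - 1) (Λ (k + 1) - Λ k - 1)))
      ((min_le_right _ _).trans_lt (by linarith)) hη hfreq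
    have h3 := hB v hv _ h2
    have h4 := min_le_left (-B - 1) (Λ (k + 1) - Λ k - 1)
    linarith

lemma _root_.HasUpperRate.le_of_tendsto {P : ℕ → E →L[ℝ] E} {v : E} {χ l : ℝ}
    (h : HasUpperRate P v χ) (hpos : ∀ n, 0 < ‖P n v‖)
    (hl : Tendsto (fun n : ℕ => (1 / (n : ℝ)) * Real.log ‖P n v‖) atTop (𝓝 l)) : l ≤ χ := by
  refine le_of_forall_pos_le_add fun ε hε => ?_
  obtain ⟨D, hD⟩ := h ε hε
  have hlim : Tendsto (fun n : ℕ => (χ + ε) + D / n) atTop (𝓝 (χ + ε + 0)) :=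
    tendsto_const_nhds.add (tendsto_const_div_atTop_nhds_zero_nat D)
  rw [add_zero] at hlim
  refine le_of_tendsto_of_tendsto hl hlim ?_
  filter_upwards [eventually_gt_atTop 0] with n hn0
  have hn0' : (0 : ℝ) < n := by exact_mod_cast hn0
  have h1 := hD n
  rw [← Real.log_le_iff_le_exp (hpos n)] at h1
  rw [one_div, inv_mul_eq_div, div_le_iff₀ hn0', add_mul, div_mul_cancel₀ _ hn0'.ne']
  exact h1

/-- If all Lyapunov exponents are positive, then so is the rate of the last singular value. -/
lemma rate_pos_of_exponents_pos [FiniteDimensional ℝ E] (h : HasVolumeRates A d Λ) (hd : 1 ≤ d)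
    (hdim : Module.finrank ℝ E = d)
    (hpos : ∀ v : E, v ≠ 0 → ∃ l : ℝ, Tendsto (fun n : ℕ => (1 / (n : ℝ)) *
      Real.log ‖segmentProd A 0 n v‖) atTop (𝓝 l) ∧ 0 < l) {k : ℕ} (hk : k + 1 ≤ d) :
    0 < Λ (k + 1) - Λ k := by
  have hnt : Nontrivial E := Module.nontrivial_of_finrank_pos (R := ℝ) (by omega)
  induction k with
  | zero =>
    obtain ⟨v, hv⟩ := exists_ne (0 : E)
    obtain ⟨l, hl, hl0⟩ := hpos v hv
    exact hl0.trans_le ((h.hasUpperRate_one hd v).le_of_tendsto (h.norm_pos hv) hl)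
  | succ k ih =>
    have ih := ih (by omega)
    by_contra! hle
    set χ := Λ (k + 1) - Λ k with hχ
    set χ' := Λ (k + 1 + 1) - Λ (k + 1) with hχ'
    obtain ⟨D, hD⟩ := h.splitting_bounds (k := k) (by omega) (h.rate_bound hk)
      (show 0 < χ / 4 by linarith)
    -- The space `F` has dimension less than `d`, so by Riesz's lemma some `w` has distance at least
    -- `‖w‖ / 2` from it. Its slow part then has norm at least `‖w‖ / 2` and can be normalized at
    -- the cost of a factor 2. A limit of these unit vectors is slow at all times.
    have hslow : ∀ i : ℕ, ∃ y : E, ‖y‖ = 1 ∧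
        ‖segmentProd A 0 i y‖ ≤ Real.exp ((χ' + χ / 4) * i + D) * 2 := by
      intro i
      obtain ⟨F, hF1, hF2, hF⟩ := hD i
      have hFlt : F ≠ ⊤ := by
        rintro rfl
        rw [finrank_top] at hF2
        omega
      obtain ⟨x, hx⟩ : ∃ x, x ∉ F := by
        by_contra! hall
        exact hFlt (Submodule.eq_top_iff'.2 hall)
      obtain ⟨w, hwF, hw⟩ := riesz_lemma (Submodule.closed_of_finiteDimensional F) ⟨x, hx⟩
        (show (1 / 2 : ℝ) < 1 by norm_num)
      obtain ⟨s, hs, -, hs1, -⟩ := hF w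
      have h1 := hw _ hs
      rw [sub_sub_cancel] at h1
      have hw0 : 0 < ‖w‖ := norm_pos_iff.2 fun h0 => hwF (h0 ▸ F.zero_mem)
      have hs0 : 0 < ‖s‖ := by linarith
      refine ⟨‖s‖⁻¹ • s, by rw [norm_smul, norm_inv, norm_norm, inv_mul_cancel₀ hs0.ne'], ?_⟩
      rw [map_smul, norm_smul, norm_inv, norm_norm, inv_mul_le_iff₀ hs0]
      refine hs1.trans ?_
      have := Real.exp_pos ((χ' + χ / 4) * i + D)
      nlinarith
    choose y hy1 hy2 using hslow
    obtain ⟨z, hz, φ, hφ, hlim⟩ := (isCompact_sphere (0 : E) 1).tendsto_subseq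
      (x := y) (fun i => by simp [hy1 i])
    have hz1 : ‖z‖ = 1 := by simpa using hz
    -- Discarding the first `N` times lets a quarter of `χ` absorb the constants, so that the
    -- vectors stay `χ / 2` below the rate `χ`.
    obtain ⟨N, hN⟩ := exists_nat_gt ((D + Real.log 2) / (χ / 4))
    rw [div_lt_iff₀ (by linarith)] at hN
    obtain ⟨B, hB⟩ := h.exists_backward_bound
    have hup : HasUpperRate (segmentProd A 0) z χ' := by
      refine hasUpperRate_of_tendsto (fun v => rfl) hB
        (h.hasSplitting (k := k) (by omega) (h.rate_bound hk)) (by linarith)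
        (show 0 < χ / 2 by linarith) (m := fun j => φ (j + N)) (z := fun j => y (φ (j + N)))
        (hφ.tendsto_atTop.comp (tendsto_add_atTop_nat N))
        (hlim.comp (tendsto_add_atTop_nat N)) fun j => ?_
      refine (hy2 _).trans ?_
      have h2 : (2 : ℝ) = Real.exp (Real.log 2) := (Real.exp_log two_pos).symm
      conv_lhs => rw [h2]
      rw [← Real.exp_add, Real.exp_le_exp]
      have h3 : (N : ℝ) ≤ φ (j + N) := by
        exact_mod_cast (Nat.le_add_left N j).trans (hφ.le_apply)
      have h4 : χ' * φ (j + N) ≤ 0 := mul_nonpos_of_nonpos_of_nonneg hle (by positivity)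
      nlinarith
    obtain ⟨l, hl, hl0⟩ := hpos z (norm_pos_iff.1 (by rw [hz1]; exact one_pos))
    have := hup.le_of_tendsto (h.norm_pos (norm_pos_iff.1 (by rw [hz1]; exact one_pos))) hl
    linarith

/-- Uniform expansion at (almost) the rate of the last singular value. -/
lemma exists_norm_le (h : HasVolumeRates A (k + 1) Λ) {ε : ℝ} (hε : 0 < ε) :
    ∃ D : ℝ, ∀ (i : ℕ) (v : E), ‖v‖ ≤
      Real.exp (-(Λ (k + 1) - Λ k) * i + ε * i + D) * ‖segmentProd A 0 i v‖ := by
  obtain ⟨B, hB⟩ := h.norm_le_exp_mul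
  obtain ⟨D, hD⟩ := h.splitting_bounds (k := k) le_rfl (h.vanish_bound 0) hε
  refine ⟨D, fun i v => ?_⟩
  obtain ⟨F, -, -, hF⟩ := hD i
  obtain ⟨s, -, hs0, -, hs⟩ := hF v
  have h0 := hB i s
  -- In top degree the slow part is sent to zero by an injective map, so every vector is its own
  -- fast part.
  rw [hs0 (h.vanish i), norm_zero, mul_zero] at h0
  have hs0 : s = 0 := norm_le_zero_iff.1 h0
  have h1 := hs 0 (Nat.zero_le _)
  rw [hs0, sub_zero] at h1
  simpa [segmentProd] using h1

end HasVolumeRates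

end VolumeRates

/-! ### Linear cocycles over an ergodic transformation -/

section Conorm

variable {E : Type*} [NormedAddCommGroup E] [NormedSpace ℝ E]

/-- The minimal expansion of unit vectors under a linear map. -/
noncomputable def conorm (A : E →L[ℝ] E) : ℝ :=
  sInf ((fun v => ‖A v‖) '' Metric.sphere (0 : E) 1)

lemma conorm_mul_norm_le (A : E →L[ℝ] E) (v : E) : conorm A * ‖v‖ ≤ ‖A v‖ := by
  rcases eq_or_ne v 0 with rfl | hv
  · simp
  have hv' := norm_pos_iff.2 hv
  have h1 : conorm A ≤ ‖A (‖v‖⁻¹ • v)‖ := by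
    refine csInf_le ⟨0, ?_⟩ ⟨_, ?_, rfl⟩
    · rintro _ ⟨w, -, rfl⟩; exact norm_nonneg _
    · simp [norm_smul, hv'.ne']
  rw [map_smul, norm_smul, norm_inv, norm_norm] at h1
  rw [← le_div_iff₀ hv', div_eq_inv_mul]
  exact h1

lemma le_conorm [Nontrivial E] {A : E →L[ℝ] E} {c : ℝ} (h : ∀ v, c * ‖v‖ ≤ ‖A v‖) :
    c ≤ conorm A := by
  refine le_csInf ((NormedSpace.sphere_nonempty.2 zero_le_one).image _) ?_
  rintro _ ⟨v, hv, rfl⟩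
  have := h v
  rwa [mem_sphere_zero_iff_norm.1 hv, mul_one] at this

lemma continuous_conorm [FiniteDimensional ℝ E] : Continuous (conorm (E := E)) := by
  have : ProperSpace E := FiniteDimensional.proper_real E
  refine (isCompact_sphere (0 : E) 1).continuous_sInf ?_
  exact (isBoundedBilinearMap_apply (𝕜 := ℝ) (E := E) (F := E)).continuous.norm

/-- Submultiplicativity applied to the product of `A` with its inverse, whose norm is at most `c`.
-/
lemma one_le_pow_mul_volumeGrowth [FiniteDimensional ℝ E] {k : ℕ}
    [Nontrivial (E [⋀^Fin k]→L[ℝ] ℝ)] {A : E →L[ℝ] E} {c : ℝ} (hc : 0 ≤ c)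
    (h : ∀ v, ‖v‖ ≤ c * ‖A v‖) : 1 ≤ c ^ k * volumeGrowth k A := by
  have hinj : Function.Injective (A : E →ₗ[ℝ] E) := by
    refine (injective_iff_map_eq_zero (A : E →ₗ[ℝ] E)).2 fun v hv => ?_
    have := h v
    rw [show A v = 0 from hv, norm_zero, mul_zero] at this
    exact norm_le_zero_iff.1 this
  let e : E ≃ₗ[ℝ] E := LinearEquiv.ofInjectiveEndo _ hinj
  let B : E →L[ℝ] E := (e.symm : E →ₗ[ℝ] E).toContinuousLinearMap
  have hBA : B ∘L A = ContinuousLinearMap.id ℝ E := by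
    ext v
    exact e.symm_apply_apply v
  have hAB : ∀ v, A (B v) = v := fun v => e.apply_symm_apply v
  have hB : ‖B‖ ≤ c := ContinuousLinearMap.opNorm_le_bound _ hc fun v => by
    have := h (B v)
    rwa [hAB] at this
  calc (1 : ℝ) ≤ volumeGrowth k (B ∘L A) := hBA ▸ one_le_volumeGrowth_id k
    _ ≤ volumeGrowth k B * volumeGrowth k A := volumeGrowth_comp_le k B A
    _ ≤ c ^ k * volumeGrowth k A := by
      gcongr
      · exact volumeGrowth_nonneg _ _
      · exact (volumeGrowth_le_pow k B).trans (pow_le_pow_left₀ (norm_nonneg _) hB k)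

end Conorm

section Iterate

variable {X E : Type*} [NormedAddCommGroup E] [NormedSpace ℝ E]

/-- The `n`-th iterate of a linear cocycle over the map `S`. -/
noncomputable def cocycleIterate (S : X → X) (A : X → E →L[ℝ] E) (x : X) (n : ℕ) : E →L[ℝ] E :=
  segmentProd (fun j => A (S^[j] x)) 0 n

lemma segmentProd_orbit (S : X → X) (A : X → E →L[ℝ] E) (x : X) (n m : ℕ) :
    segmentProd (fun j => A (S^[j] x)) n m = cocycleIterate S A (S^[n] x) m := by
  induction m with
  | zero => rfl
  | succ m ih =>
    rw [cocycleIterate, segmentProd, segmentProd, ih, zero_add, add_comm n m,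
      Function.iterate_add_apply]
    rfl

lemma cocycleIterate_add (S : X → X) (A : X → E →L[ℝ] E) (x : X) (m n : ℕ) :
    cocycleIterate S A x (m + n) = cocycleIterate S A (S^[m] x) n ∘L cocycleIterate S A x m := by
  rw [cocycleIterate, segmentProd_add, zero_add, segmentProd_orbit]
  rfl

lemma cocycleIterate_succ (S : X → X) (A : X → E →L[ℝ] E) (x : X) (n : ℕ) :
    cocycleIterate S A x (n + 1) = A (S^[n] x) ∘L cocycleIterate S A x n := by
  simp only [cocycleIterate, segmentProd, zero_add]

end Iterate

section Cocycle

variable {X : Type*} [MeasurableSpace X] {S : X → X} {d : ℕ}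

/-- A measurable linear cocycle with uniformly bounded expansion and contraction. -/
structure IsBoundedCocycle (A : X → EuclideanSpace ℝ (Fin d) →L[ℝ] EuclideanSpace ℝ (Fin d))
    (b : ℝ) : Prop where
  measurable : Measurable A
  one_le : 1 ≤ b
  norm_le : ∀ x v, ‖A x v‖ ≤ b * ‖v‖
  le_norm : ∀ x v, ‖v‖ ≤ b * ‖A x v‖

namespace IsBoundedCocycle

variable {A : X → EuclideanSpace ℝ (Fin d) →L[ℝ] EuclideanSpace ℝ (Fin d)} {b : ℝ}

lemma measurable_iterate (h : IsBoundedCocycle A b) (hS : Measurable S) (n : ℕ) :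
    Measurable fun x => cocycleIterate S A x n := by
  have : ProperSpace (EuclideanSpace ℝ (Fin d) →L[ℝ] EuclideanSpace ℝ (Fin d)) :=
    FiniteDimensional.proper_real _
  induction n with
  | zero => exact measurable_const
  | succ n ih =>
    simp only [cocycleIterate_succ]
    exact (ContinuousLinearMap.compL ℝ (EuclideanSpace ℝ (Fin d)) (EuclideanSpace ℝ (Fin d))
      (EuclideanSpace ℝ (Fin d))).isBoundedBilinearMap.continuous.measurable2
      (h.measurable.comp (hS.iterate n)) ih

lemma norm_iterate_le (h : IsBoundedCocycle A b) (x : X) (n : ℕ) (v : EuclideanSpace ℝ (Fin d)) :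
    ‖cocycleIterate S A x n v‖ ≤ b ^ n * ‖v‖ := by
  have hb := h.one_le
  induction n with
  | zero => simp [cocycleIterate, segmentProd]
  | succ n ih =>
    rw [cocycleIterate_succ, pow_succ']
    refine (h.norm_le _ _).trans ?_
    rw [mul_assoc]
    exact mul_le_mul_of_nonneg_left ih (by linarith)

lemma le_norm_iterate (h : IsBoundedCocycle A b) (x : X) (n : ℕ) (v : EuclideanSpace ℝ (Fin d)) :
    ‖v‖ ≤ b ^ n * ‖cocycleIterate S A x n v‖ := by
  have hb := h.one_le
  induction n with
  | zero => simp [cocycleIterate, segmentProd]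
  | succ n ih =>
    rw [cocycleIterate_succ, pow_succ, mul_assoc]
    exact ih.trans (mul_le_mul_of_nonneg_left (h.le_norm _ _) (by positivity))

lemma isSubadditiveCocycle_volumeGrowth (h : IsBoundedCocycle A b) (hS : Measurable S) {k : ℕ}
    (hk : k ≤ d) : IsSubadditiveCocycle S
      (fun n x => Real.log (volumeGrowth k (cocycleIterate S A x n))) (k * Real.log b) := by
  have hb := h.one_le
  have hnt := nontrivial_alternatingForms hk
  have hup : ∀ n x, volumeGrowth k (cocycleIterate S A x n) ≤ b ^ (n * k) := fun n x => by
    refine (volumeGrowth_le_pow k _).trans ?_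
    rw [pow_mul]
    exact pow_le_pow_left₀ (norm_nonneg _)
      (ContinuousLinearMap.opNorm_le_bound _ (by positivity) (h.norm_iterate_le x n)) k
  have hlow : ∀ n x, 1 ≤ b ^ (n * k) * volumeGrowth k (cocycleIterate S A x n) := fun n x => by
    rw [pow_mul]
    exact one_le_pow_mul_volumeGrowth (by positivity) (h.le_norm_iterate x n)
  have hpos : ∀ n x, 0 < volumeGrowth k (cocycleIterate S A x n) := fun n x =>
    pos_of_mul_pos_right (one_pos.trans_le (hlow n x)) (by positivity)
  refine ⟨fun n => Real.measurable_log.comp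
      ((continuous_volumeGrowth k).measurable.comp (h.measurable_iterate hS n)), fun n x => ?_,
    fun m n x => ?_⟩
  · have h1 := Real.log_le_log (hpos n x) (hup n x)
    have h2 := Real.log_le_log one_pos (hlow n x)
    rw [Real.log_mul (by positivity) (hpos n x).ne', Real.log_one, Real.log_pow] at h2
    rw [Real.log_pow] at h1
    push_cast at h1 h2
    rw [abs_le]
    constructor <;> nlinarith
  · rw [← Real.log_mul (hpos _ _).ne' (hpos _ _).ne', cocycleIterate_add, mul_comm]
    refine Real.log_le_log ?_ (volumeGrowth_comp_le _ _ _)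
    rw [← cocycleIterate_add]
    exact hpos _ _

/-- Minimal expansion is supermultiplicative under composition. -/
lemma isSubadditiveCocycle_neg_log_conorm (h : IsBoundedCocycle A b) (hS : Measurable S)
    (hd : 1 ≤ d) : IsSubadditiveCocycle S
      (fun n x => -Real.log (conorm (cocycleIterate S A x n))) (Real.log b) := by
  have hb := h.one_le
  have hnt : Nontrivial (EuclideanSpace ℝ (Fin d)) :=
    Module.nontrivial_of_finrank_pos (R := ℝ) (by rw [finrank_euclideanSpace_fin]; exact hd)
  have hlow : ∀ n x, (b ^ n)⁻¹ ≤ conorm (cocycleIterate S A x n) := fun n x => by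
    refine le_conorm fun v => ?_
    rw [inv_mul_le_iff₀ (by positivity)]
    exact h.le_norm_iterate x n v
  have hpos : ∀ n x, 0 < conorm (cocycleIterate S A x n) := fun n x =>
    lt_of_lt_of_le (by positivity) (hlow n x)
  have hup : ∀ n x, conorm (cocycleIterate S A x n) ≤ b ^ n := fun n x => by
    obtain ⟨v, hv⟩ := exists_ne (0 : EuclideanSpace ℝ (Fin d))
    exact le_of_mul_le_mul_right ((conorm_mul_norm_le _ v).trans (h.norm_iterate_le x n v))
      (norm_pos_iff.2 hv)
  refine ⟨fun n => (Real.measurable_log.comp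
      (continuous_conorm.measurable.comp (h.measurable_iterate hS n))).neg, fun n x => ?_,
    fun m n x => ?_⟩
  · have h1 := Real.log_le_log (hpos n x) (hup n x)
    have h2 := Real.log_le_log (by positivity) (hlow n x)
    rw [Real.log_inv, Real.log_pow] at h2
    rw [Real.log_pow] at h1
    rw [abs_neg, abs_le]
    constructor <;> nlinarith
  · rw [← neg_add, ← Real.log_mul (hpos _ _).ne' (hpos _ _).ne', neg_le_neg_iff]
    refine Real.log_le_log (mul_pos (hpos _ _) (hpos _ _)) ?_
    refine le_conorm fun v => ?_
    rw [cocycleIterate_add]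
    have h1 := conorm_mul_norm_le (cocycleIterate S A x m) v
    have h2 := conorm_mul_norm_le (cocycleIterate S A (S^[m] x) n) (cocycleIterate S A x m v)
    refine le_trans ?_ h2
    rw [mul_comm (conorm _) (conorm _), mul_assoc]
    exact mul_le_mul_of_nonneg_left h1 (hpos _ _).le

variable {μ : Measure X} [IsProbabilityMeasure μ]

theorem exists_hasVolumeRates (h : IsBoundedCocycle A b) (hS : Ergodic S μ) :
    ∃ Λ : ℕ → ℝ, ∀ᵐ x ∂μ, HasVolumeRates (fun j => A (S^[j] x)) d Λ := by
  have hb := h.one_le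
  have hex : ∀ k : ℕ, ∃ a : ℝ, k ≤ d → ∀ᵐ x ∂μ, ∀ ε > 0, ∃ D : ℝ,
      (∀ n i : ℕ, n ≤ i → Real.log (volumeGrowth k (cocycleIterate S A (S^[n] x) (i - n))) ≤
        a * (i - n : ℕ) + ε * i + D) ∧
      (∀ n : ℕ, a * n ≤ Real.log (volumeGrowth k (cocycleIterate S A x n)) + ε * n + D) := by
    intro k
    by_cases hk : k ≤ d
    · obtain ⟨a, ha⟩ := (h.isSubadditiveCocycle_volumeGrowth hS.measurable hk).exists_rate hS
      exact ⟨a, fun _ => ha⟩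
    · exact ⟨0, fun hk' => absurd hk' hk⟩
  choose Λ hΛ using hex
  refine ⟨Λ, ?_⟩
  have hall : ∀ᵐ x ∂μ, ∀ k : ℕ, k ≤ d → ∀ ε > 0, ∃ D : ℝ,
      (∀ n i : ℕ, n ≤ i → Real.log (volumeGrowth k (cocycleIterate S A (S^[n] x) (i - n))) ≤
        Λ k * (i - n : ℕ) + ε * i + D) ∧
      (∀ n : ℕ, Λ k * n ≤ Real.log (volumeGrowth k (cocycleIterate S A x n)) + ε * n + D) := by
    rw [ae_all_iff]
    intro k
    by_cases hk : k ≤ d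
    · filter_upwards [hΛ k hk] with x hx _
      exact hx
    · exact Eventually.of_forall fun x hk' => absurd hk' hk
  filter_upwards [hall] with x hx
  have hpos : ∀ k ≤ d, ∀ n y, 0 < volumeGrowth k (cocycleIterate S A y n) := by
    intro k hk n y
    have := nontrivial_alternatingForms hk
    refine pos_of_mul_pos_right (one_pos.trans_le (one_le_pow_mul_volumeGrowth
      (by positivity) (h.le_norm_iterate y n))) (by positivity)
  refine ⟨fun k hk ε hε => ?_, fun k hk ε hε => ?_, fun m => ?_, ⟨Real.log b, fun n v => ?_⟩⟩
  · obtain ⟨D, hD, -⟩ := hx k hk ε hε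
    refine ⟨D, fun n m => ?_⟩
    have := hD n (n + m) (by omega)
    rw [Nat.add_sub_cancel_left, Real.log_le_iff_le_exp (hpos k hk _ _)] at this
    rw [segmentProd_orbit]
    push_cast at this
    exact this
  · obtain ⟨D, -, hD⟩ := hx k hk ε hε
    refine ⟨D, fun m => ?_⟩
    have := hD m
    rw [segmentProd_orbit, ← Real.le_log_iff_exp_le (hpos k hk _ _)]
    simp only [Function.iterate_zero, id]
    linarith
  · exact volumeGrowth_eq_zero_of_finrank_lt (by simp) _
  · rw [Real.exp_log (by linarith)]
    exact h.le_norm _ v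

/-- The multiplicative ergodic theorem: almost surely, every nonzero vector has a Lyapunov
exponent. -/
theorem ae_exists_exponent (h : IsBoundedCocycle A b) (hS : Ergodic S μ) (hd : 1 ≤ d) :
    ∀ᵐ x ∂μ, ∀ v, v ≠ 0 → ∃ l : ℝ, Tendsto
      (fun n : ℕ => (1 / (n : ℝ)) * Real.log ‖cocycleIterate S A x n v‖) atTop (𝓝 l) := by
  obtain ⟨Λ, hΛ⟩ := h.exists_hasVolumeRates hS
  filter_upwards [hΛ] with x hx v hv
  exact hx.exists_exponent hd hv

/-- If almost surely all Lyapunov exponents are positive, then the expansion is uniform in the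
vector, at a rate independent of the point. -/
theorem exists_uniform_expansion (h : IsBoundedCocycle A b) (hS : Ergodic S μ) (hd : 1 ≤ d)
    (hpos : ∀ᵐ x ∂μ, ∀ v, v ≠ 0 → ∃ l : ℝ, Tendsto
      (fun n : ℕ => (1 / (n : ℝ)) * Real.log ‖cocycleIterate S A x n v‖) atTop (𝓝 l) ∧ 0 < l) :
    ∃ χ > 0, ∀ᵐ x ∂μ, ∃ D : ℝ, ∀ (n : ℕ) v,
      ‖v‖ ≤ Real.exp (-χ * n + D) * ‖cocycleIterate S A x n v‖ := by
  obtain ⟨Λ, hΛ⟩ := h.exists_hasVolumeRates hS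
  obtain ⟨k, rfl⟩ : ∃ k, d = k + 1 := ⟨d - 1, by omega⟩
  have hΛpos : 0 < Λ (k + 1) - Λ k := by
    obtain ⟨x, hx1, hx2⟩ := (hΛ.and hpos).exists
    exact hx1.rate_pos_of_exponents_pos hd (by simp) hx2 le_rfl
  refine ⟨(Λ (k + 1) - Λ k) / 2, by linarith, ?_⟩
  filter_upwards [hΛ] with x hx
  obtain ⟨D, hD⟩ := hx.exists_norm_le (half_pos hΛpos)
  refine ⟨D, fun n v => (hD n v).trans (le_of_eq ?_)⟩
  rw [show -(Λ (k + 1) - Λ k) * (n : ℝ) + (Λ (k + 1) - Λ k) / 2 * n + D =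
    -((Λ (k + 1) - Λ k) / 2) * n + D by ring]
  rfl

/-- If the logarithm of the minimal expansion of some iterate has positive mean, then almost surely
all existing Lyapunov exponents are positive. -/
theorem ae_exponent_pos (h : IsBoundedCocycle A b) (hS : Ergodic S μ) (hd : 1 ≤ d) {N : ℕ}
    (hN : 0 < N) (hint : 0 < ∫ x, Real.log (conorm (cocycleIterate S A x N)) ∂μ) :
    ∀ᵐ x ∂μ, ∀ v, v ≠ 0 → ∀ l : ℝ, Tendsto
      (fun n : ℕ => (1 / (n : ℝ)) * Real.log ‖cocycleIterate S A x n v‖) atTop (𝓝 l) → 0 < l := by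
  have hb := h.one_le
  have hnt : Nontrivial (EuclideanSpace ℝ (Fin d)) :=
    Module.nontrivial_of_finrank_pos (R := ℝ) (by rw [finrank_euclideanSpace_fin]; exact hd)
  set I := ∫ x, Real.log (conorm (cocycleIterate S A x N)) ∂μ with hI
  have hN' : (0 : ℝ) < N := by exact_mod_cast hN
  -- Half of the rate `I / N` is given up as error; only segments starting at time `0` are used
  -- afterwards.
  have hseg := (h.isSubadditiveCocycle_neg_log_conorm hS.measurable hd).segment_le hS hN
    (a := -(I / N)) (by rw [integral_neg, ← hI]; apply le_of_eq; field_simp)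
    (ε := I / N / 2) (by positivity)
  filter_upwards [hseg] with x ⟨D, hD⟩ v hv l hl
  have hIN : 0 < I / N := by positivity
  refine lt_of_lt_of_le (half_pos hIN) ?_
  have hlim : Tendsto (fun n : ℕ => I / N / 2 + (Real.log ‖v‖ - D) / n) atTop
      (𝓝 (I / N / 2 + 0)) :=
    tendsto_const_nhds.add (tendsto_const_div_atTop_nhds_zero_nat _)
  rw [add_zero] at hlim
  refine le_of_tendsto_of_tendsto hlim hl ?_
  filter_upwards [eventually_gt_atTop 0] with n hn
  have hn' : (0 : ℝ) < n := by exact_mod_cast hn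
  have h1 := hD 0 n (Nat.zero_le _)
  simp only [Nat.sub_zero, Function.iterate_zero, id] at h1
  have hv' := norm_pos_iff.2 hv
  have hcpos : 0 < conorm (cocycleIterate S A x n) := by
    refine lt_of_lt_of_le (inv_pos.2 (show 0 < b ^ n by positivity)) (le_conorm fun v => ?_)
    rw [inv_mul_le_iff₀ (by positivity)]
    exact h.le_norm_iterate x n v
  have h2 := Real.log_le_log (by positivity) (conorm_mul_norm_le (cocycleIterate S A x n) v)
  rw [Real.log_mul hcpos.ne' hv'.ne'] at h2
  rw [one_div, inv_mul_eq_div, le_div_iff₀ hn', add_mul, div_mul_cancel₀ _ hn'.ne']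
  nlinarith

end IsBoundedCocycle

end Cocycle

/-- If `ψ N` is almost surely at least `χ N` up to a constant, with a uniform linear lower bound,
then its mean grows linearly. -/
lemma eventually_mean_ge {X : Type*} [MeasurableSpace X] {μ : Measure X} [IsProbabilityMeasure μ]
    {ψ : ℕ → X → ℝ} (hψ : ∀ n, Integrable (ψ n) μ) {χ C : ℝ} (hχ : 0 < χ)
    (hC : ∀ (n : ℕ) x, -(C * (n + 1)) ≤ ψ n x)
    (hlow : ∀ᵐ x ∂μ, ∃ D : ℝ, ∀ n : ℕ, χ * n - D ≤ ψ n x) :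
    ∀ᶠ n : ℕ in atTop, χ / 2 * n ≤ ∫ x, ψ n x ∂μ := by
  have hC0 : 0 ≤ |C| := abs_nonneg _
  have hC1 := le_abs_self C
  -- Truncation at `χ` provides the upper bound needed for dominated convergence and can only lower
  -- the mean.
  let u : ℕ → X → ℝ := fun n x => min (ψ n x / n) χ
  have hum : ∀ n, AEStronglyMeasurable (u n) μ := fun n =>
    (((hψ n).aestronglyMeasurable.aemeasurable.div_const _).min aemeasurable_const).aestronglyMeasurable
  have hubound : ∀ n : ℕ, 1 ≤ n → ∀ x, ‖u n x‖ ≤ 2 * |C| + χ := by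
    intro n hn x
    have hn' : (1 : ℝ) ≤ n := by exact_mod_cast hn
    rw [Real.norm_eq_abs, abs_le]
    constructor
    · refine le_min ?_ (by linarith)
      rw [le_div_iff₀ (by linarith)]
      have h1 := hC n x
      have h2 : C * (n + 1) ≤ |C| * (2 * n) :=
        (mul_le_mul_of_nonneg_right hC1 (by linarith)).trans (by gcongr; linarith)
      nlinarith
    · exact (min_le_right _ _).trans (by linarith)
  have hulim : ∀ᵐ x ∂μ, Tendsto (fun n => u n x) atTop (𝓝 χ) := by
    filter_upwards [hlow] with x ⟨D, hD⟩
    have hlim : Tendsto (fun n : ℕ => χ - |D| / n) atTop (𝓝 (χ - 0)) :=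
      tendsto_const_nhds.sub (tendsto_const_div_atTop_nhds_zero_nat _)
    rw [sub_zero] at hlim
    refine tendsto_of_tendsto_of_tendsto_of_le_of_le' hlim tendsto_const_nhds ?_
      (Eventually.of_forall fun n => min_le_right _ _)
    filter_upwards [eventually_gt_atTop 0] with n hn
    have hn' : (0 : ℝ) < n := by exact_mod_cast hn
    refine le_min ?_ ?_
    · rw [le_div_iff₀ hn', sub_mul, div_mul_cancel₀ _ hn'.ne']
      linarith [hD n, le_abs_self D]
    · have : 0 ≤ |D| / n := by positivity
      linarith
  have hconv : Tendsto (fun n => ∫ x, u (n + 1) x ∂μ) atTop (𝓝 (∫ _, χ ∂μ)) := by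
    refine tendsto_integral_of_dominated_convergence (fun _ => 2 * |C| + χ) (fun n => hum _)
      (integrable_const _) (fun n => Eventually.of_forall fun x => hubound (n + 1) (by omega) x) ?_
    filter_upwards [hulim] with x hx
    exact hx.comp (tendsto_add_atTop_nat 1)
  rw [integral_const, probReal_univ, one_smul] at hconv
  have hconv' := (tendsto_add_atTop_iff_nat (f := fun n => ∫ x, u n x ∂μ) 1).1 hconv
  filter_upwards [hconv'.eventually (lt_mem_nhds (show χ / 2 < χ by linarith)),
    eventually_ge_atTop 1] with n hn hn1
  have hn' : (0 : ℝ) < n := by exact_mod_cast hn1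
  have h1 : ∫ x, u n x ∂μ ≤ ∫ x, ψ n x / n ∂μ :=
    integral_mono (Integrable.of_bound (hum n) _ (Eventually.of_forall (hubound n hn1)))
      ((hψ n).div_const _) fun x => min_le_left _ _
  rw [integral_div] at h1
  have h2 := hn.le.trans h1
  rwa [le_div_iff₀ hn'] at h2

/-! ### The skew product of an i.i.d. random dynamical system -/

section SkewProduct

variable {T M : Type*}

/-- The skew product of the shift on realizations with the random maps. -/
def skewProduct (F : T → M → M) (p : (ℕ → T) × M) : (ℕ → T) × M :=
  (fun n => p.1 (n + 1), F (p.1 0) p.2)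

lemma skewProduct_iterate (F : T → M → M) (n : ℕ) (p : (ℕ → T) × M) :
    (skewProduct F)^[n] p = (fun k => p.1 (k + n), randomIterate F p.1 n p.2) := by
  induction n with
  | zero => rfl
  | succ n ih =>
    rw [Function.iterate_succ_apply', ih]
    simp only [skewProduct, randomIterate, Function.comp_apply, zero_add]
    congr 1
    ext k
    rw [add_assoc, add_comm 1 n]

/-- Padding a cylinder to an initial segment of times allows induction on the number of coordinates.
-/
lemma finset_pi_eq_range_pi (s : Finset ℕ) (t : ℕ → Set T) :
    ∃ n : ℕ, (s : Set ℕ).pi t =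
      ((Finset.range (n + 1) : Finset ℕ) : Set ℕ).pi (fun i => if i ∈ s then t i else Set.univ) := by
  refine ⟨s.sup id, ?_⟩
  ext w
  simp only [Set.mem_pi, Finset.mem_coe, Finset.mem_range]
  constructor
  · intro h i _
    split_ifs with hi
    · exact h i hi
    · trivial
  · intro h i hi
    have := h i (Nat.lt_succ_of_le (Finset.le_sup (f := id) hi))
    rwa [if_pos hi] at this

lemma range_pi_succ (n : ℕ) (t : ℕ → Set T) :
    ((Finset.range (n + 1) : Finset ℕ) : Set ℕ).pi t =
      (fun w : ℕ → T => (w 0, fun k => w (k + 1))) ⁻¹'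
        (t 0 ×ˢ ((Finset.range n : Finset ℕ) : Set ℕ).pi (fun i => t (i + 1))) := by
  ext w
  simp only [Set.mem_pi, Finset.mem_coe, Finset.mem_range, Set.mem_preimage, Set.mem_prod]
  constructor
  · exact fun h => ⟨h 0 (by omega), fun i hi => h (i + 1) (by omega)⟩
  · rintro ⟨h0, h1⟩ (_ | i) hi
    · exact h0
    · exact h1 i (by omega)

variable [MeasurableSpace T] [MeasurableSpace M]

lemma measurable_skewProduct {F : T → M → M} (hF : Measurable (Function.uncurry F)) :
    Measurable (skewProduct F) := by
  refine Measurable.prodMk ?_ ?_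
  · exact measurable_pi_iff.2 fun n => (measurable_pi_apply (n + 1)).comp measurable_fst
  · have h0 : Measurable fun p : (ℕ → T) × M => p.1 0 :=
      (measurable_pi_apply 0).comp measurable_fst
    exact hF.comp (h0.prodMk measurable_snd)

variable (θ : Measure T) [IsProbabilityMeasure θ]

/-- The inverse map `cons` sends the product law to a measure with the correct values on boxes, and
these determine the i.i.d. law. -/
lemma measurePreserving_head_tail :
    MeasurePreserving (fun w : ℕ → T => (w 0, fun k => w (k + 1)))
      (Measure.infinitePi fun _ : ℕ => θ) (θ.prod (Measure.infinitePi fun _ : ℕ => θ)) := by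
  have hmeas : Measurable (fun w : ℕ → T => (w 0, fun k => w (k + 1))) :=
    (measurable_pi_apply 0).prodMk (measurable_pi_iff.2 fun n => measurable_pi_apply (n + 1))
  refine ⟨hmeas, ?_⟩
  let cons : T × (ℕ → T) → ℕ → T := fun p n => Nat.casesOn n p.1 p.2
  have hcons : Measurable cons := by
    refine measurable_pi_iff.2 fun n => ?_
    cases n with
    | zero => exact measurable_fst
    | succ n => exact (measurable_pi_apply n).comp measurable_snd
  have key : (θ.prod (Measure.infinitePi fun _ : ℕ => θ)).map cons =
      Measure.infinitePi fun _ : ℕ => θ := by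
    refine Measure.eq_infinitePi _ fun s t ht => ?_
    rw [← Measure.infinitePi_pi (fun _ : ℕ => θ) fun i _ => ht i]
    obtain ⟨n, hn⟩ := finset_pi_eq_range_pi s t
    rw [hn]
    set t' : ℕ → Set T := fun i => if i ∈ s then t i else Set.univ
    have ht' : ∀ i, MeasurableSet (t' i) := fun i => by
      simp only [t']; split_ifs
      exacts [ht i, MeasurableSet.univ]
    rw [Measure.infinitePi_pi _ fun i _ => ht' i, Finset.prod_range_succ',
      Measure.map_apply hcons (MeasurableSet.pi (Finset.countable_toSet _) fun i _ => ht' i),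
      range_pi_succ, ← Set.preimage_comp]
    have hid : (fun w : ℕ → T => (w 0, fun k => w (k + 1))) ∘ cons = id := by
      ext p <;> rfl
    rw [hid, Set.preimage_id, Measure.prod_prod,
      Measure.infinitePi_pi _ fun i _ => ht' (i + 1), mul_comm]
  conv_lhs => rw [← key]
  rw [Measure.map_map hmeas hcons]
  exact Measure.map_id

variable {θ} {F : T → M → M} {m : Measure M} [IsProbabilityMeasure m]

/-- The random fibre measure of an invariant set satisfies a mean value property. -/
lemma infinitePi_fiber_eq_lintegral {B : Set ((ℕ → T) × M)} (hF : Measurable (Function.uncurry F))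
    (hB : MeasurableSet B) {C : Set (ℕ → T)} (hC : MeasurableSet C) {t : Set T}
    (ht : MeasurableSet t) (x : M) :
    (Measure.infinitePi fun _ : ℕ => θ) ({w | w 0 ∈ t ∧ (fun k => w (k + 1)) ∈ C} ∩
      (fun w => (w, x)) ⁻¹' (skewProduct F ⁻¹' B)) =
    ∫⁻ s in t, (Measure.infinitePi fun _ : ℕ => θ) (C ∩ (fun w => (w, F s x)) ⁻¹' B) ∂θ := by
  have hmp := measurePreserving_head_tail θ
  let G : Set (T × (ℕ → T)) := (t ×ˢ C) ∩ (fun p => (p.2, F p.1 x)) ⁻¹' B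
  have hG : MeasurableSet G := (ht.prod hC).inter
    ((measurable_snd.prodMk (hF.comp (measurable_fst.prodMk measurable_const))) hB)
  have e1 : {w : ℕ → T | w 0 ∈ t ∧ (fun k => w (k + 1)) ∈ C} ∩
      (fun w => (w, x)) ⁻¹' (skewProduct F ⁻¹' B) =
      (fun w : ℕ → T => (w 0, fun k => w (k + 1))) ⁻¹' G := by
    ext w; rfl
  rw [e1, hmp.measure_preimage hG.nullMeasurableSet, Measure.prod_apply hG,
    ← lintegral_indicator ht]
  refine lintegral_congr fun s => ?_
  by_cases hs : s ∈ t
  · rw [Set.indicator_of_mem hs]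
    congr 1
    ext w
    simp [G, hs]
  · rw [Set.indicator_of_notMem hs]
    have : Prod.mk s ⁻¹' G = ∅ := by
      ext w
      simp [G, hs]
    rw [this, measure_empty]

/-- The skew product preserves the product of the law of the noise with a stationary measure. -/
lemma measurePreserving_skewProduct (hF : Measurable (Function.uncurry F))
    (hst : (θ.prod m).map (Function.uncurry F) = m) :
    MeasurePreserving (skewProduct F) ((Measure.infinitePi fun _ : ℕ => θ).prod m)
      ((Measure.infinitePi fun _ : ℕ => θ).prod m) := by
  refine ⟨measurable_skewProduct hF, (Measure.prod_eq fun C D hC hD => ?_).symm⟩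
  rw [Measure.map_apply (measurable_skewProduct hF) (hC.prod hD),
    Measure.prod_apply_symm (measurable_skewProduct hF (hC.prod hD))]
  have h1 : ∀ x, (Measure.infinitePi fun _ : ℕ => θ)
      ((fun w => (w, x)) ⁻¹' (skewProduct F ⁻¹' (C ×ˢ D))) =
      (Measure.infinitePi fun _ : ℕ => θ) C * θ ((fun s => F s x) ⁻¹' D) := by
    intro x
    have := infinitePi_fiber_eq_lintegral (θ := θ) hF (hC.prod hD) MeasurableSet.univ
      MeasurableSet.univ x
    simp only [Set.mem_univ, and_self, Set.ofPred_true, Set.univ_inter, Measure.restrict_univ] at this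
    rw [this]
    have hDx : MeasurableSet ((fun s => F s x) ⁻¹' D) :=
      (hF.comp (measurable_id.prodMk measurable_const)) hD
    rw [← lintegral_indicator_const hDx]
    refine lintegral_congr fun s => ?_
    by_cases hs : F s x ∈ D
    · rw [Set.indicator_of_mem (show s ∈ (fun s => F s x) ⁻¹' D from hs)]
      congr 1
      ext w
      simp [hs]
    · rw [Set.indicator_of_notMem (show s ∉ (fun s => F s x) ⁻¹' D from hs)]
      have : (fun w : ℕ → T => (w, F s x)) ⁻¹' (C ×ˢ D) = ∅ := by
        ext w
        simp [hs]
      rw [this, measure_empty]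
  simp only [h1]
  rw [lintegral_const_mul]
  · congr 1
    conv_rhs => rw [← hst]
    rw [Measure.map_apply hF hD, Measure.prod_apply_symm (hF hD)]
    rfl
  · exact measurable_measure_prodMk_right (hF hD)

/-- The skew product is ergodic if the stationary measure is. -/
theorem ergodic_skewProduct (hF : Measurable (Function.uncurry F))
    (hst : (θ.prod m).map (Function.uncurry F) = m) (herg : IsRandomErgodic F θ m) :
    Ergodic (skewProduct F) ((Measure.infinitePi fun _ : ℕ => θ).prod m) := by
  refine { toMeasurePreserving := measurePreserving_skewProduct hF hst, aeconst_set := ?_ }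
  intro B hB hinv
  set P := (Measure.infinitePi fun _ : ℕ => θ) with hP
  let h : M → ENNReal := fun x => P ((fun w => (w, x)) ⁻¹' B)
  have hh : Measurable h := measurable_measure_prodMk_right hB
  have hh1 : ∀ x, h x ≤ 1 := fun x => prob_le_one
  have hmean : ∀ x, h x = ∫⁻ s, h (F s x) ∂θ := by
    intro x
    have := infinitePi_fiber_eq_lintegral (θ := θ) hF hB MeasurableSet.univ MeasurableSet.univ x
    simpa [hinv] using this
  have hmp : MeasurePreserving (Function.uncurry F) (θ.prod m) m := ⟨hF, hst⟩
  -- the fibre measure is constant along random orbits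
  have hconst : ∀ᵐ p ∂(θ.prod m), h (F p.1 p.2) = h p.2 := by
    let k : M → ℝ := fun x => (h x).toReal
    have hk : Measurable k := hh.ennreal_toReal
    have hkb : ∀ x, ‖k x‖ ≤ 1 := fun x => by
      rw [Real.norm_of_nonneg ENNReal.toReal_nonneg]
      exact ENNReal.toReal_le_of_le_ofReal zero_le_one (by simpa using hh1 x)
    have hkmean : ∀ x, ∫ s, k (F s x) ∂θ = k x := by
      intro x
      have hm : Measurable fun s => h (F s x) :=
        hh.comp (hF.comp (measurable_id.prodMk measurable_const))
      rw [integral_toReal hm.aemeasurable (Eventually.of_forall fun s => (hh1 _).trans_lt ENNReal.one_lt_top), ← hmean x]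
    have hkF : Measurable fun p : T × M => k (F p.1 p.2) := hk.comp hF
    have hk2 : Measurable fun p : T × M => k p.2 := hk.comp measurable_snd
    have hbd : ∀ (u v : T × M → ℝ), Measurable u → Measurable v → (∀ p, ‖u p‖ ≤ 1) →
        (∀ p, ‖v p‖ ≤ 1) → Integrable (fun p => u p * v p) (θ.prod m) := by
      intro u v hu hv hu1 hv1
      refine Integrable.of_bound (hu.mul hv).aestronglyMeasurable 1 (Eventually.of_forall fun p => ?_)
      rw [norm_mul]
      exact mul_le_one₀ (hu1 p) (norm_nonneg _) (hv1 p)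
    have i1 := hbd _ _ hkF hkF (fun p => hkb _) (fun p => hkb _)
    have i2 := hbd _ _ hkF hk2 (fun p => hkb _) (fun p => hkb _)
    have i3 := hbd _ _ hk2 hk2 (fun p => hkb _) (fun p => hkb _)
    have e1 : ∫ p, k (F p.1 p.2) * k (F p.1 p.2) ∂(θ.prod m) = ∫ x, k x * k x ∂m := by
      conv_rhs => rw [← hst]
      have hkk : Measurable fun x => k x * k x := hk.mul hk
      rw [integral_map hF.aemeasurable hkk.aestronglyMeasurable]
      rfl
    have e2 : ∫ p, k (F p.1 p.2) * k p.2 ∂(θ.prod m) = ∫ x, k x * k x ∂m := by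
      rw [integral_prod_symm _ i2]
      simp only [integral_mul_const, hkmean]
    have e3 : ∫ p, k p.2 * k p.2 ∂(θ.prod m) = ∫ x, k x * k x ∂m := by
      rw [integral_prod_symm _ i3]
      simp
    -- Expanding the square, stationarity evaluates the first term and the mean value property the
    -- mixed term; all three integrals equal that of `k * k`.
    have hzero : ∫ p, (k (F p.1 p.2) - k p.2) ^ 2 ∂(θ.prod m) = 0 := by
      have : ∀ p : T × M, (k (F p.1 p.2) - k p.2) ^ 2 =
          k (F p.1 p.2) * k (F p.1 p.2) - 2 * (k (F p.1 p.2) * k p.2) + k p.2 * k p.2 :=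
        fun p => by ring
      simp only [this]
      have i4 : Integrable (fun p : T × M => k (F p.1 p.2) * k (F p.1 p.2) -
          2 * (k (F p.1 p.2) * k p.2)) (θ.prod m) := i1.sub (i2.const_mul 2)
      rw [integral_add i4 i3, integral_sub i1 (i2.const_mul 2), integral_const_mul, e1, e2, e3]
      ring
    have hint : Integrable (fun p : T × M => (k (F p.1 p.2) - k p.2) ^ 2) (θ.prod m) := by
      refine Integrable.of_bound ((hkF.sub hk2).pow_const 2).aestronglyMeasurable 4
        (Eventually.of_forall fun p => ?_)
      rw [norm_pow]
      have := (norm_sub_le (k (F p.1 p.2)) (k p.2)).trans (add_le_add (hkb _) (hkb _))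
      nlinarith [norm_nonneg (k (F p.1 p.2) - k p.2)]
    have := (integral_eq_zero_iff_of_nonneg (fun p => sq_nonneg _) hint).1 hzero
    filter_upwards [this] with p hp
    have hp' : k (F p.1 p.2) = k p.2 := by
      have : k (F p.1 p.2) - k p.2 = 0 := by simpa using hp
      linarith
    exact (ENNReal.toReal_eq_toReal_iff' ((hh1 _).trans_lt ENNReal.one_lt_top).ne
      ((hh1 _).trans_lt ENNReal.one_lt_top).ne).1 hp'
  have hconst' : ∀ᵐ x ∂m, ∀ᵐ s ∂θ, h (F s x) = h x := by
    rw [← Measure.ae_ae_comm]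
    · exact Measure.ae_ae_of_ae_prod hconst
    · exact measurableSet_eq_fun (hh.comp hF) (hh.comp measurable_snd)
  -- an invariant set is independent of the noise, given the initial point
  have hbox : ∀ (n : ℕ) (t : ℕ → Set T), (∀ i, MeasurableSet (t i)) → ∀ᵐ x ∂m,
      P (((Finset.range n : Finset ℕ) : Set ℕ).pi t ∩ (fun w => (w, x)) ⁻¹' B) =
        P (((Finset.range n : Finset ℕ) : Set ℕ).pi t) * h x := by
    intro n
    induction n with
    | zero =>
      intro t _
      refine Eventually.of_forall fun x => ?_
      simp [h]
    | succ n ih =>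
      intro t ht
      have h1 := ih (fun i => t (i + 1)) fun i => ht (i + 1)
      set C := ((Finset.range n : Finset ℕ) : Set ℕ).pi fun i => t (i + 1) with hC
      have hCm : MeasurableSet C :=
        MeasurableSet.pi (Finset.countable_toSet _) fun i _ => ht (i + 1)
      have h2 : ∀ᵐ p ∂(θ.prod m), P (C ∩ (fun w => (w, F p.1 p.2)) ⁻¹' B) =
          P C * h (F p.1 p.2) := hmp.quasiMeasurePreserving.ae h1
      have h3 : ∀ᵐ x ∂m, ∀ᵐ s ∂θ, P (C ∩ (fun w => (w, F s x)) ⁻¹' B) = P C * h (F s x) := by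
        rw [← Measure.ae_ae_comm]
        · exact Measure.ae_ae_of_ae_prod h2
        · refine measurableSet_eq_fun ?_ ((hh.comp hF).const_mul _)
          have : Measurable fun y => P ((fun w => (w, y)) ⁻¹' ((Prod.fst ⁻¹' C) ∩ B)) :=
            measurable_measure_prodMk_right ((measurable_fst hCm).inter hB)
          exact this.comp hF
      filter_upwards [h3, hconst'] with x hx1 hx2
      have e1 := infinitePi_fiber_eq_lintegral (θ := θ) hF hB hCm (ht 0) x
      have e2 : ((Finset.range (n + 1) : Finset ℕ) : Set ℕ).pi t =
          {w | w 0 ∈ t 0 ∧ (fun k => w (k + 1)) ∈ C} := range_pi_succ n t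
      have e3 : P (((Finset.range (n + 1) : Finset ℕ) : Set ℕ).pi t) = θ (t 0) * P C := by
        rw [range_pi_succ, (measurePreserving_head_tail θ).measure_preimage
          ((ht 0).prod hCm).nullMeasurableSet, Measure.prod_prod]
      -- By invariance of `B`, its fibre over `x` decomposes, according to the first symbol, into
      -- its fibres over the points `F s x`, to which the induction hypothesis applies.
      rw [hinv] at e1
      rw [e3, e2, e1]
      have e4 : ∫⁻ s in t 0, P (C ∩ (fun w => (w, F s x)) ⁻¹' B) ∂θ =
          ∫⁻ _ in t 0, P C * h x ∂θ := by
        refine lintegral_congr_ae (ae_restrict_of_ae ?_)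
        filter_upwards [hx1, hx2] with s hs1 hs2
        rw [hs1, hs2]
      rw [e4, setLIntegral_const]
      ring
  -- The independence on boxes identifies two finite measures; evaluating both on `B` gives that `h`
  -- and `h * h` have the same integral, so `h` takes only the values 0 and 1.
  have hprod : P.prod (m.withDensity h) = (P.prod m).restrict B := by
    have : IsFiniteMeasure (m.withDensity h) := isFiniteMeasure_withDensity
      ((lintegral_mono hh1).trans_lt (by simp)).ne
    refine Measure.prod_eq_generateFrom (C := squareCylinders fun _ : ℕ => {s : Set T | MeasurableSet s})
      (D := {s | MeasurableSet s}) generateFrom_squareCylinders MeasurableSpace.generateFrom_measurableSet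
      (isPiSystem_squareCylinders (fun _ => MeasurableSpace.isPiSystem_measurableSet) fun _ => MeasurableSet.univ)
      MeasurableSpace.isPiSystem_measurableSet ⟨fun _ => Set.univ, fun _ => ?_, fun _ => measure_lt_top _ _,
        Set.iUnion_const _⟩ (Measure.toFiniteSpanningSetsIn _) ?_
    · exact ⟨∅, fun _ => Set.univ, fun _ => by simp, by simp⟩
    · rintro _ ⟨s, t, ht, rfl⟩ D hD
      obtain ⟨n, hn⟩ := finset_pi_eq_range_pi s t
      rw [hn]
      set t' : ℕ → Set T := fun i => if i ∈ s then t i else Set.univ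
      have ht' : ∀ i, MeasurableSet (t' i) := fun i => by
        simp only [t']; split_ifs
        exacts [ht i trivial, MeasurableSet.univ]
      set C := ((Finset.range (n + 1) : Finset ℕ) : Set ℕ).pi t' with hC
      have hCm : MeasurableSet C := MeasurableSet.pi (Finset.countable_toSet _) fun i _ => ht' i
      have hD' : MeasurableSet D := hD
      rw [Measure.restrict_apply (hCm.prod hD'), Measure.prod_apply_symm ((hCm.prod hD').inter hB),
        withDensity_apply _ hD', ← lintegral_const_mul _ hh, ← lintegral_indicator hD']
      refine lintegral_congr_ae ?_
      filter_upwards [hbox (n + 1) t' ht'] with x hx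
      by_cases hxD : x ∈ D
      · rw [Set.indicator_of_mem hxD, ← hx]
        congr 1
        ext w
        simp [hxD, hC]
      · rw [Set.indicator_of_notMem hxD]
        have : (fun w : ℕ → T => (w, x)) ⁻¹' (C ×ˢ D ∩ B) = ∅ := by
          ext w
          simp [hxD]
        rw [this, measure_empty]
  have hB2 : ∫⁻ x, h x ∂m = ∫⁻ x, h x * h x ∂m := by
    have e1 := congrArg (fun ν => ν B) hprod
    simp only [Measure.restrict_apply_self] at e1
    rw [Measure.prod_apply_symm hB, Measure.prod_apply_symm hB,
      lintegral_withDensity_eq_lintegral_mul _ hh hh] at e1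
    exact e1.symm
  have h01 : ∀ᵐ x ∂m, h x = 0 ∨ h x = 1 := by
    have hle : ∀ x, h x * h x ≤ h x := fun x => mul_le_of_le_one_right' (hh1 x)
    have hfin : ∫⁻ x, h x * h x ∂m ≠ ⊤ := by
      rw [← hB2]
      exact ((lintegral_mono hh1).trans_lt (by simp)).ne
    filter_upwards [ae_eq_of_ae_le_of_lintegral_le (Eventually.of_forall hle) hfin
      hh.aemeasurable hB2.le] with x hx
    by_cases h0 : h x = 0
    · exact Or.inl h0
    · refine Or.inr ?_
      have hne : h x ≠ ⊤ := ((hh1 x).trans_lt ENNReal.one_lt_top).ne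
      have hx' : h x * h x = h x * 1 := by rw [mul_one]; exact hx
      exact (ENNReal.mul_right_inj h0 hne).1 hx'
  have hA : MeasurableSet {x | h x = 1} := hh (measurableSet_singleton 1)
  have hmeasB : (P.prod m) B = ∫⁻ x, h x ∂m := Measure.prod_apply_symm hB
  -- As `h` is constant along random orbits, this set is random invariant, and ergodicity of `m`
  -- decides the measure of `B`.
  rcases herg {x | h x = 1} hA (by
    filter_upwards [hconst'] with x hx
    refine ⟨fun h1 => ?_, fun h1 => ?_⟩
    · filter_upwards [hx] with s hs
      exact hs.trans h1
    · filter_upwards [hx] with s hs h2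
      exact h1 (hs.symm.trans h2)) with h0 | h1
  · have hB0 : (P.prod m) B = 0 := by
      rw [hmeasB, lintegral_eq_zero_iff hh]
      have : ∀ᵐ x ∂m, x ∉ {x | h x = 1} := measure_eq_zero_iff_ae_notMem.1 h0
      filter_upwards [h01, this] with x hx1 hx2
      exact hx1.resolve_right hx2
    rw [eventuallyConst_set']
    exact Or.inl (ae_eq_empty.2 hB0)
  · have hB1 : (P.prod m) B = 1 := by
      have : ∀ᵐ x ∂m, x ∈ {x | h x = 1} := (mem_ae_iff_prob_eq_one hA).2 h1
      rw [hmeasB, lintegral_congr_ae (g := fun _ => 1) this]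
      simp
    rw [eventuallyConst_set']
    exact Or.inr (ae_eq_univ.2 ((prob_compl_eq_zero_iff hB).2 hB1))

end SkewProduct

/-! ### Continuity on the tangent bundle and bounded measurable frames -/

section RiemannianTangent

variable {d : ℕ} {M : Type*} [EMetricSpace M] [ChartedSpace (EuclideanSpace ℝ (Fin d)) M]
  [IsManifold (𝓡 d) ∞ M]

/-- Local compactness makes evaluation jointly continuous for the compact-open topology. -/
lemma locallyCompactSpace_secondTangentBundle :
    LocallyCompactSpace (TangentBundle (𝓡 d).tangent (TangentBundle (𝓡 d) M)) := by
  have h1 : LocallyCompactSpace (ModelProd (EuclideanSpace ℝ (Fin d)) (EuclideanSpace ℝ (Fin d))) :=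
    inferInstanceAs (LocallyCompactSpace (EuclideanSpace ℝ (Fin d) × EuclideanSpace ℝ (Fin d)))
  have h2 : LocallyCompactSpace (ModelProd (ModelProd (EuclideanSpace ℝ (Fin d))
      (EuclideanSpace ℝ (Fin d))) (EuclideanSpace ℝ (Fin d) × EuclideanSpace ℝ (Fin d))) :=
    inferInstanceAs (LocallyCompactSpace ((ModelProd (EuclideanSpace ℝ (Fin d))
      (EuclideanSpace ℝ (Fin d))) × (EuclideanSpace ℝ (Fin d) × EuclideanSpace ℝ (Fin d))))
  exact ChartedSpace.locallyCompactSpace (ModelProd (ModelProd (EuclideanSpace ℝ (Fin d))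
      (EuclideanSpace ℝ (Fin d))) (EuclideanSpace ℝ (Fin d) × EuclideanSpace ℝ (Fin d))) _

/-- The tangent maps of a family of maps which is continuous for the `C²` topology are jointly
continuous. -/
lemma continuous_tangentMap_family {T : Type*} [TopologicalSpace T]
    {Φ : T → C^2⟮𝓡 d, M; 𝓡 d, M⟯} (hΦ : Continuous[inferInstance, c2Topology d M] Φ) :
    Continuous fun p : T × TangentBundle (𝓡 d) M => tangentMap (𝓡 d) (𝓡 d) (Φ p.1) p.2 := by
  have := locallyCompactSpace_secondTangentBundle (d := d) (M := M)
  have h1 : Continuous fun t => secondTangentMap (Φ t) := continuous_induced_rng.1 hΦ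
  have h2 : Continuous fun p : T × TangentBundle (𝓡 d).tangent (TangentBundle (𝓡 d) M) =>
    secondTangentMap (Φ p.1) p.2 := (h1.comp continuous_fst).eval continuous_snd
  -- Entering through the zero section and leaving through the projection recovers the first tangent
  -- map from the second.
  have hz : Continuous fun w : TangentBundle (𝓡 d) M =>
      (zeroSection (EuclideanSpace ℝ (Fin d) × EuclideanSpace ℝ (Fin d))
        (TangentSpace (𝓡 d).tangent : TangentBundle (𝓡 d) M → Type _) w) :=
    (Bundle.contMDiff_zeroSection (IB := (𝓡 d).tangent) (n := 0) ℝ _).continuous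
  have hp : Continuous (TotalSpace.proj : TangentBundle (𝓡 d).tangent (TangentBundle (𝓡 d) M) →
      TangentBundle (𝓡 d) M) := FiberBundle.continuous_proj _ _
  exact hp.comp (h2.comp (continuous_fst.prodMk (hz.comp continuous_snd)))

lemma continuous_family {T : Type*} [TopologicalSpace T]
    {Φ : T → C^2⟮𝓡 d, M; 𝓡 d, M⟯} (hΦ : Continuous[inferInstance, c2Topology d M] Φ) :
    Continuous fun p : T × M => Φ p.1 p.2 := by
  have h1 := continuous_tangentMap_family hΦ
  have hz : Continuous fun x : M => zeroSection (EuclideanSpace ℝ (Fin d))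
      (TangentSpace (𝓡 d) : M → Type _) x :=
    (Bundle.contMDiff_zeroSection (IB := 𝓡 d) (n := 0) ℝ _).continuous
  have hp : Continuous (TotalSpace.proj : TangentBundle (𝓡 d) M → M) := FiberBundle.continuous_proj _ _
  exact hp.comp (h1.comp (continuous_fst.prodMk (hz.comp continuous_snd)))

variable [RiemannianBundle (fun x : M => TangentSpace (𝓡 d) x)]
    [IsContMDiffRiemannianBundle (𝓡 d) ∞ (EuclideanSpace ℝ (Fin d))
      (fun x : M => TangentSpace (𝓡 d) x)]

instance (priority := 50) isContinuousRiemannianBundle_tangent :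
    IsContinuousRiemannianBundle (EuclideanSpace ℝ (Fin d)) (fun x : M => TangentSpace (𝓡 d) x) := by
  obtain ⟨g, hg, h⟩ := IsContMDiffRiemannianBundle.exists_contMDiff (IB := 𝓡 d) (n := ∞)
    (F := EuclideanSpace ℝ (Fin d)) (E := fun x : M => TangentSpace (𝓡 d) x)
  exact ⟨g, hg.continuous, h⟩

lemma continuous_norm_tangent :
    Continuous fun w : TangentBundle (𝓡 d) M => ‖w.2‖ := by
  have h : Continuous fun w : TangentBundle (𝓡 d) M => inner ℝ w.2 w.2 :=
    Continuous.inner_bundle (F := EuclideanSpace ℝ (Fin d))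
      (E := fun x : M => TangentSpace (𝓡 d) x) (b := fun w : TangentBundle (𝓡 d) M => w.1)
      (v := fun w => w.2) (w := fun w => w.2) continuous_id continuous_id
  simp only [norm_eq_sqrt_real_inner]
  exact h.sqrt

/-- A measurable choice, at each point, of one of countably many trivializations of the tangent
bundle, which are uniformly bounded for the Riemannian norm. -/
structure BoundedFrame (d : ℕ) (M : Type*) [EMetricSpace M] [MeasurableSpace M]
    [ChartedSpace (EuclideanSpace ℝ (Fin d)) M] [IsManifold (𝓡 d) ∞ M]
    [RiemannianBundle (fun x : M => TangentSpace (𝓡 d) x)] where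
  center : ℕ → M
  index : M → ℕ
  bound : ℝ
  measurable_index : Measurable index
  mem_baseSet : ∀ x, x ∈ (trivializationAt (EuclideanSpace ℝ (Fin d))
    (TangentSpace (𝓡 d) : M → Type _) (center (index x))).baseSet
  one_le_bound : 1 ≤ bound
  norm_symmL_le : ∀ x v, ‖(trivializationAt (EuclideanSpace ℝ (Fin d))
    (TangentSpace (𝓡 d) : M → Type _) (center (index x))).symmL ℝ x v‖ ≤ bound * ‖v‖
  norm_continuousLinearMapAt_le : ∀ x v, ‖(trivializationAt (EuclideanSpace ℝ (Fin d))
    (TangentSpace (𝓡 d) : M → Type _) (center (index x))).continuousLinearMapAt ℝ x v‖ ≤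
      bound * ‖v‖

/-- Each trivialization distorts norms boundedly near its centre, and finitely many suffice by
compactness. Choosing the first admissible index is measurable because the domains are open. -/
lemma exists_boundedFrame [CompactSpace M] [MeasurableSpace M] [BorelSpace M] [Nonempty M] :
    Nonempty (BoundedFrame d M) := by
  set τ := fun x : M => trivializationAt (EuclideanSpace ℝ (Fin d))
    (TangentSpace (𝓡 d) : M → Type _) x with hτ
  have hloc : ∀ x : M, ∃ C : ℝ, ∀ᶠ y in 𝓝 x, y ∈ (τ x).baseSet ∧
      ‖(τ x).symmL ℝ y‖ < C ∧ ‖(τ x).continuousLinearMapAt ℝ y‖ < C := by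
    intro x
    obtain ⟨C₁, h₁, h₁'⟩ := eventually_norm_symmL_trivializationAt_lt
      (F := EuclideanSpace ℝ (Fin d)) (E := (TangentSpace (𝓡 d) : M → Type _)) x
    obtain ⟨C₂, h₂, h₂'⟩ := eventually_norm_trivializationAt_lt
      (F := EuclideanSpace ℝ (Fin d)) (E := (TangentSpace (𝓡 d) : M → Type _)) x
    refine ⟨max C₁ C₂, ?_⟩
    filter_upwards [h₁', h₂', (τ x).open_baseSet.mem_nhds
      (FiberBundle.mem_baseSet_trivializationAt' x)] with y h1 h2 h3
    exact ⟨h3, h1.trans_le (le_max_left _ _), h2.trans_le (le_max_right _ _)⟩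
  choose C hC using hloc
  choose U hU hUo hUx using fun x => eventually_nhds_iff.1 (hC x)
  obtain ⟨t, ht⟩ := isCompact_univ.elim_finite_subcover U hUo
    (fun x _ => Set.mem_iUnion.2 ⟨x, hUx x⟩)
  have htne : t.Nonempty := by
    obtain ⟨x⟩ := ‹Nonempty M›
    obtain ⟨y, hy, -⟩ := Set.mem_iUnion₂.1 (ht (Set.mem_univ x))
    exact ⟨y, hy⟩
  obtain ⟨a, ha⟩ := t.countable_toSet.exists_eq_range htne
  have hcov : ∀ x, ∃ n, x ∈ U (a n) := by
    intro x
    obtain ⟨y, hy, hxy⟩ := Set.mem_iUnion₂.1 (ht (Set.mem_univ x))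
    have : y ∈ Set.range a := by rw [← ha]; exact hy
    obtain ⟨n, rfl⟩ := this
    exact ⟨n, hxy⟩
  obtain ⟨B, hB⟩ := (t.finite_toSet.image C).bddAbove
  have hCB : ∀ n, C (a n) ≤ B := fun n => hB ⟨a n, by rw [ha]; exact ⟨n, rfl⟩, rfl⟩
  classical
  refine ⟨⟨a, fun x => Nat.find (hcov x), max 1 B, ?_, fun x => ?_, le_max_left _ _,
    fun x v => ?_, fun x v => ?_⟩⟩
  · exact measurable_find _ fun n => (hUo (a n)).measurableSet
  · exact (hU _ x (Nat.find_spec (hcov x))).1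
  · have := (hU _ x (Nat.find_spec (hcov x))).2.1
    refine (ContinuousLinearMap.le_opNorm _ _).trans ?_
    gcongr
    exact (this.le.trans (hCB _)).trans (le_max_right _ _)
  · have := (hU _ x (Nat.find_spec (hcov x))).2.2
    refine (ContinuousLinearMap.le_opNorm _ _).trans ?_
    gcongr
    exact (this.le.trans (hCB _)).trans (le_max_right _ _)

end RiemannianTangent

/-! ### The derivative as a measurable cocycle on Euclidean space -/

section DerivCocycle

variable {d : ℕ} {M : Type*} [EMetricSpace M] [MeasurableSpace M]
  [ChartedSpace (EuclideanSpace ℝ (Fin d)) M] [IsManifold (𝓡 d) ∞ M]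
  [RiemannianBundle (fun x : M => TangentSpace (𝓡 d) x)]

namespace BoundedFrame

/-- Coordinates of a tangent vector in the frame. -/
noncomputable def toModel (B : BoundedFrame d M) (x : M) :
    TangentSpace (𝓡 d) x →L[ℝ] EuclideanSpace ℝ (Fin d) :=
  (trivializationAt (EuclideanSpace ℝ (Fin d)) (TangentSpace (𝓡 d) : M → Type _)
    (B.center (B.index x))).continuousLinearMapAt ℝ x

/-- The tangent vector with given coordinates in the frame. -/
noncomputable def ofModel (B : BoundedFrame d M) (x : M) :
    EuclideanSpace ℝ (Fin d) →L[ℝ] TangentSpace (𝓡 d) x :=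
  (trivializationAt (EuclideanSpace ℝ (Fin d)) (TangentSpace (𝓡 d) : M → Type _)
    (B.center (B.index x))).symmL ℝ x

lemma ofModel_toModel (B : BoundedFrame d M) (x : M) (v : TangentSpace (𝓡 d) x) :
    B.ofModel x (B.toModel x v) = v :=
  Trivialization.symmL_continuousLinearMapAt _ (B.mem_baseSet x) v

lemma toModel_ofModel (B : BoundedFrame d M) (x : M) (v : EuclideanSpace ℝ (Fin d)) :
    B.toModel x (B.ofModel x v) = v :=
  Trivialization.continuousLinearMapAt_symmL _ (B.mem_baseSet x) v

lemma norm_ofModel_le (B : BoundedFrame d M) (x : M) (v : EuclideanSpace ℝ (Fin d)) :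
    ‖B.ofModel x v‖ ≤ B.bound * ‖v‖ := B.norm_symmL_le x v

lemma norm_toModel_le (B : BoundedFrame d M) (x : M) (v : TangentSpace (𝓡 d) x) :
    ‖B.toModel x v‖ ≤ B.bound * ‖v‖ := B.norm_continuousLinearMapAt_le x v

lemma le_norm_ofModel (B : BoundedFrame d M) (x : M) (v : EuclideanSpace ℝ (Fin d)) :
    ‖v‖ ≤ B.bound * ‖B.ofModel x v‖ := by
  simpa only [toModel_ofModel] using B.norm_toModel_le x (B.ofModel x v)

lemma le_norm_toModel (B : BoundedFrame d M) (x : M) (v : TangentSpace (𝓡 d) x) :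
    ‖v‖ ≤ B.bound * ‖B.toModel x v‖ := by
  simpa only [ofModel_toModel] using B.norm_ofModel_le x (B.toModel x v)

/-- The derivative of `g` at `x`, read in the frame. -/
noncomputable def deriv (B : BoundedFrame d M) (g : M → M) (x : M) :
    EuclideanSpace ℝ (Fin d) →L[ℝ] EuclideanSpace ℝ (Fin d) :=
  (B.toModel (g x)).comp ((mfderiv (𝓡 d) (𝓡 d) g x).comp (B.ofModel x))

lemma deriv_apply (B : BoundedFrame d M) (g : M → M) (x : M) (v : EuclideanSpace ℝ (Fin d)) :
    B.deriv g x v = B.toModel (g x) (mfderiv (𝓡 d) (𝓡 d) g x (B.ofModel x v)) := rfl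

lemma deriv_id (B : BoundedFrame d M) (x : M) :
    B.deriv id x = ContinuousLinearMap.id ℝ (EuclideanSpace ℝ (Fin d)) := by
  ext1 v
  rw [deriv_apply, mfderiv_id]
  exact B.toModel_ofModel x v

lemma deriv_comp (B : BoundedFrame d M) {g h : M → M} (hg : MDifferentiable (𝓡 d) (𝓡 d) g)
    (hh : MDifferentiable (𝓡 d) (𝓡 d) h) (x : M) :
    B.deriv (g ∘ h) x = (B.deriv g (h x)).comp (B.deriv h x) := by
  ext1 v
  rw [ContinuousLinearMap.comp_apply, deriv_apply, deriv_apply, deriv_apply, ofModel_toModel,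
    mfderiv_comp x (hg _) (hh _)]
  rfl

lemma segmentProd_deriv {T : Type*} (B : BoundedFrame d M) {F : T → M → M}
    (hF : ∀ t, MDifferentiable (𝓡 d) (𝓡 d) (F t)) (w : ℕ → T) (x : M) (n : ℕ) :
    MDifferentiable (𝓡 d) (𝓡 d) (randomIterate F w n) ∧
    segmentProd (fun j => B.deriv (F (w j)) (randomIterate F w j x)) 0 n =
      B.deriv (randomIterate F w n) x := by
  induction n with
  | zero => exact ⟨mdifferentiable_id, (B.deriv_id x).symm⟩
  | succ n ih =>
    refine ⟨(hF _).comp ih.1, ?_⟩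
    rw [segmentProd, ih.2, zero_add]
    exact (B.deriv_comp (hF _) ih.1 x).symm

/-- For each of the countably many pairs of source and target trivializations the coordinate
expression is continuous on an open set; the pair in use depends measurably on the point. -/
lemma measurable_deriv [CompactSpace M] [BorelSpace M] {T : Type*} [TopologicalSpace T]
    [MeasurableSpace T] [OpensMeasurableSpace T] (B : BoundedFrame d M) {F : T → M → M}
    (hF : Continuous (Function.uncurry F))
    (hTF : Continuous fun p : T × TangentBundle (𝓡 d) M => tangentMap (𝓡 d) (𝓡 d) (F p.1) p.2) :
    Measurable fun p : T × M => B.deriv (F p.1) p.2 := by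
  classical
  set τ := fun i : ℕ => trivializationAt (EuclideanSpace ℝ (Fin d))
    (TangentSpace (𝓡 d) : M → Type _) (B.center i) with hτ
  have hv : ∀ v, Measurable fun p : T × M => B.deriv (F p.1) p.2 v := by
    intro v
    set O : ℕ × ℕ → Set (T × M) := fun i =>
      {p | p.2 ∈ (τ i.1).baseSet ∧ F p.1 p.2 ∈ (τ i.2).baseSet} with hO
    have hOo : ∀ i, IsOpen (O i) := fun i =>
      ((τ i.1).open_baseSet.preimage continuous_snd).inter ((τ i.2).open_baseSet.preimage hF)
    set G : ℕ × ℕ → T × M → EuclideanSpace ℝ (Fin d) := fun i p =>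
      (τ i.2 (tangentMap (𝓡 d) (𝓡 d) (F p.1) ⟨p.2, (τ i.1).symm p.2 v⟩)).2 with hG
    have hGc : ∀ i, ContinuousOn (G i) (O i) := by
      intro i
      have h1 : ContinuousOn (fun p : T × M =>
          (⟨p.2, (τ i.1).symm p.2 v⟩ : TangentBundle (𝓡 d) M)) (O i) := by
        have h := (τ i.1).continuousOn_symm
        refine (h.comp (f := fun p : T × M => (p.2, v)) (by fun_prop) fun p hp =>
          ⟨hp.1, Set.mem_univ _⟩)
      have h2 : ContinuousOn (fun p : T × M => tangentMap (𝓡 d) (𝓡 d) (F p.1)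
          ⟨p.2, (τ i.1).symm p.2 v⟩) (O i) :=
        hTF.comp_continuousOn (continuousOn_fst.prodMk h1)
      refine continuous_snd.comp_continuousOn ((τ i.2).continuousOn.comp h2 fun p hp => ?_)
      rw [(τ i.2).mem_source]
      exact hp.2
    have hGm : ∀ i, Measurable ((O i).piecewise (G i) 0) := fun i =>
      (hGc i).measurable_piecewise continuousOn_const (hOo i).measurableSet
    have hidx : Measurable fun p : T × M => ((B.index p.2, B.index (F p.1 p.2)), p) :=
      ((B.measurable_index.comp measurable_snd).prodMk
        (B.measurable_index.comp hF.measurable)).prodMk measurable_id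
    have hall : Measurable fun q : (ℕ × ℕ) × (T × M) => (O q.1).piecewise (G q.1) 0 q.2 :=
      measurable_from_prod_countable_right hGm
    convert! hall.comp hidx using 1
    ext1 p
    have hp : p ∈ O (B.index p.2, B.index (F p.1 p.2)) := ⟨B.mem_baseSet _, B.mem_baseSet _⟩
    simp only [Function.comp_apply, Set.piecewise_eq_of_mem _ _ _ hp]
    rw [deriv_apply]
    have h1 : B.ofModel p.2 v = (τ (B.index p.2)).symm p.2 v :=
      Trivialization.symmL_apply _ (B.mem_baseSet _) v
    rw [h1]
    exact Trivialization.continuousLinearMapAt_apply_of_mem ℝ _ (B.mem_baseSet _) _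
  have hsum : ∀ L : EuclideanSpace ℝ (Fin d) →L[ℝ] EuclideanSpace ℝ (Fin d),
      L = ∑ i, (EuclideanSpace.proj i : EuclideanSpace ℝ (Fin d) →L[ℝ] ℝ).smulRight
        (L (EuclideanSpace.single i 1)) := by
    intro L
    ext1 v
    conv_lhs => rw [← (EuclideanSpace.basisFun (Fin d) ℝ).sum_repr v]
    simp
  have : (fun p : T × M => B.deriv (F p.1) p.2) = fun p =>
      ∑ i, (EuclideanSpace.proj i : EuclideanSpace ℝ (Fin d) →L[ℝ] ℝ).smulRight
        (B.deriv (F p.1) p.2 (EuclideanSpace.single i 1)) := funext fun p => hsum _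
  rw [this]
  refine Finset.measurable_sum _ fun i _ => ?_
  exact (ContinuousLinearMap.smulRightL ℝ (EuclideanSpace ℝ (Fin d)) (EuclideanSpace ℝ (Fin d))
    (EuclideanSpace.proj i)).continuous.measurable.comp (hv _)

end BoundedFrame

end DerivCocycle

/-! ### Minimal expansion of unit tangent vectors -/

section TangentConorm

variable {d : ℕ} {M : Type*} [EMetricSpace M]
  [ChartedSpace (EuclideanSpace ℝ (Fin d)) M] [IsManifold (𝓡 d) ∞ M]
  [RiemannianBundle (fun x : M => TangentSpace (𝓡 d) x)]

/-- The infimum of `Ψ` on the unit sphere of the tangent space at `x`. -/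
noncomputable def fiberInf (Ψ : TangentBundle (𝓡 d) M → ℝ) (x : M) : ℝ :=
  sInf ((fun v : TangentSpace (𝓡 d) x => Ψ ⟨x, v⟩) '' {v | ‖v‖ = 1})

variable [IsContMDiffRiemannianBundle (𝓡 d) ∞ (EuclideanSpace ℝ (Fin d))
      (fun x : M => TangentSpace (𝓡 d) x)]

/-- In a local trivialization, normalizing the vectors of the Euclidean unit sphere parametrizes all
Riemannian unit spheres by one compact set, over which an infimum depends continuously on
parameters. -/
lemma continuous_fiberInf {Y : Type*} [TopologicalSpace Y] {Ψ : Y → TangentBundle (𝓡 d) M → ℝ}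
    (hΨ : Continuous (Function.uncurry Ψ)) :
    Continuous fun p : Y × M => fiberInf (Ψ p.1) p.2 := by
  rw [continuous_iff_continuousAt]
  rintro ⟨y₀, x₀⟩
  set τ := trivializationAt (EuclideanSpace ℝ (Fin d))
    (TangentSpace (𝓡 d) : M → Type _) x₀ with hτ
  set s := τ.baseSet with hs
  have hso : IsOpen s := τ.open_baseSet
  have hx₀ : x₀ ∈ s := FiberBundle.mem_baseSet_trivializationAt' x₀
  have hsym : Continuous fun q : s × EuclideanSpace ℝ (Fin d) =>
      (⟨q.1, τ.symm q.1 q.2⟩ : TangentBundle (𝓡 d) M) :=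
    τ.continuousOn_symm.comp_continuous (f := fun q : s × EuclideanSpace ℝ (Fin d) =>
      ((q.1 : M), q.2)) (by fun_prop) fun q => ⟨q.1.2, Set.mem_univ _⟩
  have hsymL : ∀ q : s, ∀ v, τ.symm q v = τ.symmL ℝ q v := fun q v =>
    (τ.symmL_apply (R := ℝ) q.2 v).symm
  have hpos : ∀ q : s, ∀ v ≠ 0, 0 < ‖τ.symm (q : M) v‖ := by
    intro q v hv
    rw [norm_pos_iff, hsymL]
    intro h
    apply hv
    have := τ.continuousLinearMapAt_symmL (R := ℝ) q.2 v
    rw [h, map_zero] at this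
    exact this.symm
  have hN : Continuous fun q : s × EuclideanSpace ℝ (Fin d) => ‖τ.symm (q.1 : M) q.2‖ :=
    continuous_norm_tangent.comp hsym
  set K : Set (EuclideanSpace ℝ (Fin d)) := Metric.sphere 0 1 with hK
  have hK0 : ∀ v : K, (v : EuclideanSpace ℝ (Fin d)) ≠ 0 := fun v => ne_zero_of_mem_unit_sphere v
  set nv : s × K → TangentBundle (𝓡 d) M := fun q =>
    ⟨q.1, τ.symm q.1 (‖τ.symm (q.1 : M) q.2‖⁻¹ • (q.2 : EuclideanSpace ℝ (Fin d)))⟩ with hnv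
  have hnvc : Continuous nv := by
    refine hsym.comp (f := fun q : s × K => (q.1, ‖τ.symm (q.1 : M) q.2‖⁻¹ •
      (q.2 : EuclideanSpace ℝ (Fin d)))) ?_
    have hinv : Continuous fun q : s × K => ‖τ.symm (q.1 : M) (q.2 : EuclideanSpace ℝ (Fin d))‖⁻¹ :=
      (hN.comp (f := fun q : s × K => (q.1, (q.2 : EuclideanSpace ℝ (Fin d))))
        (by fun_prop)).inv₀ fun q => (hpos q.1 _ (hK0 q.2)).ne'
    have hval : Continuous fun q : s × K => (q.2 : EuclideanSpace ℝ (Fin d)) := by fun_prop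
    exact continuous_fst.prodMk (hinv.smul hval)
  have hcont : Continuous fun p : Y × s =>
      sInf ((fun v : K => Ψ p.1 (nv (p.2, v))) '' Set.univ) := by
    refine IsCompact.continuous_sInf (K := (Set.univ : Set K)) isCompact_univ ?_
    exact hΨ.comp (f := fun q : (Y × s) × K => (q.1.1, nv (q.1.2, q.2))) (by fun_prop)
  have heq : ∀ p : Y × s, sInf ((fun v : K => Ψ p.1 (nv (p.2, v))) '' Set.univ) =
      fiberInf (Ψ p.1) p.2 := by
    rintro ⟨y, x⟩
    unfold fiberInf
    congr 1
    ext r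
    simp only [Set.image_univ, Set.mem_range, Set.mem_image]
    constructor
    · rintro ⟨v, rfl⟩
      refine ⟨_, ?_, rfl⟩
      have h1 := hpos x _ (hK0 v)
      simp only [Set.mem_ofPred_eq]
      rw [hsymL, map_smul, norm_smul, ← hsymL, norm_inv, norm_norm, inv_mul_cancel₀ h1.ne']
    · rintro ⟨v, hv, rfl⟩
      set u := τ.continuousLinearMapAt ℝ (x : M) v with hu
      have hvu : τ.symmL ℝ (x : M) u = v := τ.symmL_continuousLinearMapAt x.2 v
      have hv1 : ‖v‖ = 1 := hv
      have hu0 : u ≠ 0 := by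
        rintro h
        rw [h, map_zero] at hvu
        rw [← hvu, norm_zero] at hv1
        exact zero_ne_one hv1
      have hun : 0 < ‖u‖ := norm_pos_iff.2 hu0
      refine ⟨⟨‖u‖⁻¹ • u, ?_⟩, ?_⟩
      · rw [hK, mem_sphere_zero_iff_norm, norm_smul, norm_inv, norm_norm, inv_mul_cancel₀ hun.ne']
      · simp only [hnv]
        rw [hsymL, hsymL, map_smul, map_smul, hvu, norm_smul, hv1, norm_inv, norm_norm, mul_one,
          inv_inv, smul_smul, mul_inv_cancel₀ hun.ne', one_smul]
  have hcont' : Continuous fun p : Y × s => fiberInf (Ψ p.1) p.2 := by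
    simpa only [heq] using hcont
  have hemb : IsOpenEmbedding (Prod.map id Subtype.val : Y × s → Y × M) :=
    IsOpenEmbedding.id.prodMap hso.isOpenEmbedding_subtypeVal
  exact (hemb.continuousAt_iff (x := (y₀, ⟨x₀, hx₀⟩))).1 hcont'.continuousAt

end TangentConorm

lemma randomIterate_const {T M : Type*} (F : T → M → M) (t : T) (n : ℕ) :
    randomIterate F (fun _ => t) n = (F t)^[n] := by
  induction n with
  | zero => rfl
  | succ n ih => rw [randomIterate, ih, Function.iterate_succ']

lemma mdifferentiable_randomIterate {d : ℕ} {T M : Type*} [EMetricSpace M]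
    [ChartedSpace (EuclideanSpace ℝ (Fin d)) M] {F : T → M → M}
    (hF : ∀ t, MDifferentiable (𝓡 d) (𝓡 d) (F t)) (w : ℕ → T)
    (n : ℕ) : MDifferentiable (𝓡 d) (𝓡 d) (randomIterate F w n) := by
  induction n with
  | zero => exact mdifferentiable_id
  | succ n ih => exact (hF _).comp ih

lemma exists_norm_tangent_eq_one {d : ℕ} {M : Type*} [EMetricSpace M]
    [ChartedSpace (EuclideanSpace ℝ (Fin d)) M]
    [RiemannianBundle (fun x : M => TangentSpace (𝓡 d) x)] (hd : 1 ≤ d) (x : M) : ∃ v : TangentSpace (𝓡 d) x, ‖v‖ = 1 := by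
  have : Nonempty (Fin d) := ⟨⟨0, hd⟩⟩
  have h1 : Nontrivial (TangentSpace (𝓡 d) x) :=
    inferInstanceAs (Nontrivial (EuclideanSpace ℝ (Fin d)))
  obtain ⟨u, hu⟩ := exists_ne (0 : TangentSpace (𝓡 d) x)
  exact ⟨‖u‖⁻¹ • u, by rw [norm_smul, norm_inv, norm_norm, inv_mul_cancel₀ (norm_ne_zero_iff.2 hu)]⟩

lemma continuous_tangentMap_randomIterate {d : ℕ} {T M : Type*} [EMetricSpace M]
    [ChartedSpace (EuclideanSpace ℝ (Fin d)) M] [IsManifold (𝓡 d) ∞ M]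
    [TopologicalSpace T] {F : T → M → M}
    (hF : ∀ t, MDifferentiable (𝓡 d) (𝓡 d) (F t))
    (hTF : Continuous fun p : T × TangentBundle (𝓡 d) M => tangentMap (𝓡 d) (𝓡 d) (F p.1) p.2)
    (n : ℕ) : Continuous fun p : (ℕ → T) × TangentBundle (𝓡 d) M =>
      tangentMap (𝓡 d) (𝓡 d) (randomIterate F p.1 n) p.2 := by
  induction n with
  | zero =>
    have h : ∀ p : (ℕ → T) × TangentBundle (𝓡 d) M,
        tangentMap (𝓡 d) (𝓡 d) (randomIterate F p.1 0) p.2 = p.2 := fun p =>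
      congrFun (tangentMap_id (I := 𝓡 d) (M := M)) p.2
    simpa only [h] using continuous_snd
  | succ n ih =>
    have h : ∀ p : (ℕ → T) × TangentBundle (𝓡 d) M,
        tangentMap (𝓡 d) (𝓡 d) (randomIterate F p.1 (n + 1)) p.2 =
          tangentMap (𝓡 d) (𝓡 d) (F (p.1 n))
            (tangentMap (𝓡 d) (𝓡 d) (randomIterate F p.1 n) p.2) := fun p =>
      tangentMap_comp_at p.2 (hF _ _) (mdifferentiable_randomIterate hF _ _ _)
    simp only [h]
    exact hTF.comp (((continuous_apply n).comp continuous_fst).prodMk ih)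

lemma le_fiberInf {d : ℕ} {M : Type*} [EMetricSpace M]
    [ChartedSpace (EuclideanSpace ℝ (Fin d)) M]
    [RiemannianBundle (fun x : M => TangentSpace (𝓡 d) x)] (hd : 1 ≤ d) {Ψ : TangentBundle (𝓡 d) M → ℝ} {x : M} {c : ℝ}
    (h : ∀ v : TangentSpace (𝓡 d) x, ‖v‖ = 1 → c ≤ Ψ ⟨x, v⟩) : c ≤ fiberInf Ψ x := by
  obtain ⟨v, hv⟩ := exists_norm_tangent_eq_one hd x
  refine le_csInf ⟨_, v, hv, rfl⟩ ?_
  rintro _ ⟨u, hu, rfl⟩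
  exact h u hu

section TangentConormBounds

variable {d : ℕ} {M : Type*} [EMetricSpace M]
  [ChartedSpace (EuclideanSpace ℝ (Fin d)) M] [IsManifold (𝓡 d) ∞ M]
  [RiemannianBundle (fun x : M => TangentSpace (𝓡 d) x)]

/-- The minimal expansion of unit tangent vectors at `x` by the derivative of `g`. -/
noncomputable def tangentConorm (d : ℕ) {M : Type*} [EMetricSpace M]
    [ChartedSpace (EuclideanSpace ℝ (Fin d)) M] [IsManifold (𝓡 d) ∞ M]
    [RiemannianBundle (fun x : M => TangentSpace (𝓡 d) x)] (g : M → M) (x : M) : ℝ :=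
  fiberInf (fun u : TangentBundle (𝓡 d) M => ‖(tangentMap (𝓡 d) (𝓡 d) g u).2‖) x

lemma tangentConorm_mul_le (g : M → M) (x : M) (v : TangentSpace (𝓡 d) x) :
    tangentConorm d g x * ‖v‖ ≤ ‖mfderiv (𝓡 d) (𝓡 d) g x v‖ := by
  rcases eq_or_ne v 0 with rfl | hv
  · simp
  have hv' : 0 < ‖v‖ := norm_pos_iff.2 hv
  have h : tangentConorm d g x ≤ ‖mfderiv (𝓡 d) (𝓡 d) g x (‖v‖⁻¹ • v)‖ := by
    refine csInf_le ⟨0, ?_⟩ ⟨‖v‖⁻¹ • v, ?_, rfl⟩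
    · rintro _ ⟨u, -, rfl⟩
      exact norm_nonneg _
    · rw [Set.mem_ofPred_eq, norm_smul, norm_inv, norm_norm, inv_mul_cancel₀ hv'.ne']
  rwa [map_smul, norm_smul, norm_inv, norm_norm, ← div_eq_inv_mul, le_div_iff₀ hv'] at h

lemma le_tangentConorm (hd : 1 ≤ d) {g : M → M} {x : M} {c : ℝ}
    (h : ∀ v : TangentSpace (𝓡 d) x, c * ‖v‖ ≤ ‖mfderiv (𝓡 d) (𝓡 d) g x v‖) :
    c ≤ tangentConorm d g x := by
  refine le_fiberInf hd fun v hv => ?_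
  have := h v
  rw [hv, mul_one] at this
  exact this

lemma tangentConorm_pos (hd : 1 ≤ d) {g : M → M} {x : M}
    (h : Function.Injective (mfderiv (𝓡 d) (𝓡 d) g x)) : 0 < tangentConorm d g x := by
  have : FiniteDimensional ℝ (TangentSpace (𝓡 d) x) :=
    inferInstanceAs (FiniteDimensional ℝ (EuclideanSpace ℝ (Fin d)))
  obtain ⟨K, hK, hA⟩ := LinearMap.exists_antilipschitzWith
    (mfderiv (𝓡 d) (𝓡 d) g x).toLinearMap (LinearMap.ker_eq_bot.2 h)
  have hK' : (0 : ℝ) < K := hK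
  refine (inv_pos.2 hK').trans_le (le_tangentConorm hd fun v => ?_)
  rw [inv_mul_le_iff₀ hK']
  simpa using hA.le_mul_dist v 0

variable {T : Type*} [TopologicalSpace T] {F : T → M → M}

variable [IsContMDiffRiemannianBundle (𝓡 d) ∞ (EuclideanSpace ℝ (Fin d))
      (fun x : M => TangentSpace (𝓡 d) x)]

lemma continuous_tangentConorm {Y : Type*} [TopologicalSpace Y] {G : Y → M → M}
    (hG : Continuous fun p : Y × TangentBundle (𝓡 d) M => tangentMap (𝓡 d) (𝓡 d) (G p.1) p.2) :
    Continuous fun p : Y × M => tangentConorm d (G p.1) p.2 :=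
  continuous_fiberInf (Ψ := fun y u => ‖(tangentMap (𝓡 d) (𝓡 d) (G y) u).2‖)
    (continuous_norm_tangent.comp hG)

lemma continuous_tangentConorm_iterate (hF : ∀ t, MDifferentiable (𝓡 d) (𝓡 d) (F t))
    (hTF : Continuous fun p : T × TangentBundle (𝓡 d) M => tangentMap (𝓡 d) (𝓡 d) (F p.1) p.2)
    (t : T) (n : ℕ) : Continuous (tangentConorm d (F t)^[n]) := by
  have h : Continuous fun p : (ℕ → T) × M => tangentConorm d (randomIterate F p.1 n) p.2 :=
    continuous_tangentConorm (G := fun w : ℕ → T => randomIterate F w n)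
      (continuous_tangentMap_randomIterate hF hTF n)
  have h2 := Continuous.uncurry_left
    (f := fun (w : ℕ → T) (x : M) => tangentConorm d (randomIterate F w n) x) (fun _ => t) h
  simp only [randomIterate_const] at h2
  exact h2

/-- Uniform control of the derivatives of the maps close to a map with injective derivatives. -/
lemma exists_eventually_mfderiv_bounds [CompactSpace M] [Nonempty M] (hd : 1 ≤ d)
    (hTF : Continuous fun p : T × TangentBundle (𝓡 d) M => tangentMap (𝓡 d) (𝓡 d) (F p.1) p.2)
    {t₀ : T} (hinj : ∀ x, Function.Injective (mfderiv (𝓡 d) (𝓡 d) (F t₀) x)) :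
    ∃ b : ℝ, 1 ≤ b ∧ ∀ᶠ t in 𝓝 t₀, ∀ x (v : TangentSpace (𝓡 d) x),
      ‖mfderiv (𝓡 d) (𝓡 d) (F t) x v‖ ≤ b * ‖v‖ ∧ ‖v‖ ≤ b * ‖mfderiv (𝓡 d) (𝓡 d) (F t) x v‖ := by
  have hP := continuous_tangentConorm hTF
  have hQ : Continuous fun p : T × M => fiberInf (fun u : TangentBundle (𝓡 d) M =>
      -‖(tangentMap (𝓡 d) (𝓡 d) (F p.1) u).2‖) p.2 :=
    continuous_fiberInf (Ψ := fun t u => -‖(tangentMap (𝓡 d) (𝓡 d) (F t) u).2‖)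
      (continuous_norm_tangent.comp hTF).neg
  obtain ⟨x₁, -, hx₁⟩ := isCompact_univ.exists_isMinOn (Set.univ_nonempty (α := M))
    (hP.comp (Continuous.prodMk_right t₀)).continuousOn
  obtain ⟨x₂, -, hx₂⟩ := isCompact_univ.exists_isMinOn (Set.univ_nonempty (α := M))
    (hQ.comp (Continuous.prodMk_right t₀)).continuousOn
  set c := tangentConorm d (F t₀) x₁ with hc
  -- `-C` is the largest operator norm of the derivative of `F t₀`; the sign turns the supremum into
  -- an infimum.
  set C := fiberInf (fun u : TangentBundle (𝓡 d) M =>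
      -‖(tangentMap (𝓡 d) (𝓡 d) (F t₀) u).2‖) x₂ with hC
  have hcpos : 0 < c := tangentConorm_pos hd (hinj x₁)
  have h1 : ∀ᶠ t in 𝓝 t₀, ∀ x ∈ (Set.univ : Set M), c / 2 < tangentConorm d (F t) x := by
    refine isCompact_univ.eventually_forall_of_forall_eventually fun x _ => ?_
    refine hP.continuousAt.eventually (lt_mem_nhds ?_)
    exact (half_lt_self hcpos).trans_le (hx₁ (Set.mem_univ x))
  have h2 : ∀ᶠ t in 𝓝 t₀, ∀ x ∈ (Set.univ : Set M), C - 1 < fiberInf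
      (fun u : TangentBundle (𝓡 d) M => -‖(tangentMap (𝓡 d) (𝓡 d) (F t) u).2‖) x := by
    refine isCompact_univ.eventually_forall_of_forall_eventually fun x _ => ?_
    refine hQ.continuousAt.eventually (lt_mem_nhds ?_)
    exact (sub_one_lt C).trans_le (hx₂ (Set.mem_univ x))
  refine ⟨max 1 (max (2 / c) (1 - C)), le_max_left _ _, ?_⟩
  filter_upwards [h1, h2] with t ht1 ht2 x v
  constructor
  · rcases eq_or_ne v 0 with rfl | hv
    · simp
    have hv' : 0 < ‖v‖ := norm_pos_iff.2 hv
    have hbd : ‖mfderiv (𝓡 d) (𝓡 d) (F t) x (‖v‖⁻¹ • v)‖ ≤ 1 - C := by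
      have h3 : fiberInf (fun u : TangentBundle (𝓡 d) M =>
          -‖(tangentMap (𝓡 d) (𝓡 d) (F t) u).2‖) x ≤
          -‖mfderiv (𝓡 d) (𝓡 d) (F t) x (‖v‖⁻¹ • v)‖ := by
        refine csInf_le ⟨-‖mfderiv (𝓡 d) (𝓡 d) (F t) x‖, ?_⟩ ⟨‖v‖⁻¹ • v, ?_, rfl⟩
        · rintro _ ⟨u, hu, rfl⟩
          refine neg_le_neg (((mfderiv (𝓡 d) (𝓡 d) (F t) x).le_opNorm u).trans_eq ?_)
          rw [show ‖u‖ = 1 from hu, mul_one]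
        · rw [Set.mem_ofPred_eq, norm_smul, norm_inv, norm_norm, inv_mul_cancel₀ hv'.ne']
      linarith [ht2 x (Set.mem_univ x)]
    rw [map_smul, norm_smul, norm_inv, norm_norm, ← div_eq_inv_mul, div_le_iff₀ hv'] at hbd
    refine hbd.trans ?_
    gcongr
    exact (le_max_right _ _).trans (le_max_right _ _)
  · have h3 := tangentConorm_mul_le (F t) x v
    have h4 := mul_le_mul_of_nonneg_right (ht1 x (Set.mem_univ x)).le (norm_nonneg v)
    have h5 : ‖v‖ ≤ 2 / c * ‖mfderiv (𝓡 d) (𝓡 d) (F t) x v‖ := by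
      rw [div_mul_eq_mul_div, le_div_iff₀ hcpos]
      linarith
    refine h5.trans ?_
    gcongr
    exact (le_max_left _ _).trans (le_max_right _ _)

/-- The minimal expansion is continuous on noise sequences times `M`, and by compactness of `M` the
inequality holds near the constant sequence uniformly in the point. A neighbourhood in the product
topology restricts finitely many coordinates only, so one neighbourhood `U` of `t₀` serves for all.
-/
lemma eventually_half_tangentConorm_le [CompactSpace M]
    (hF : ∀ t, MDifferentiable (𝓡 d) (𝓡 d) (F t))
    (hTF : Continuous fun p : T × TangentBundle (𝓡 d) M => tangentMap (𝓡 d) (𝓡 d) (F p.1) p.2)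
    {t₀ : T} {n : ℕ} (hpos : ∀ x, 0 < tangentConorm d (F t₀)^[n] x) :
    ∃ U ∈ 𝓝 t₀, ∀ w : ℕ → T, (∀ i, w i ∈ U) → ∀ x,
      tangentConorm d (F t₀)^[n] x / 2 ≤ tangentConorm d (randomIterate F w n) x := by
  have hP := continuous_tangentConorm (G := fun w : ℕ → T => randomIterate F w n)
    (continuous_tangentMap_randomIterate hF hTF n)
  have hQ : Continuous fun p : (ℕ → T) × M =>
      tangentConorm d (randomIterate F p.1 n) p.2 - tangentConorm d (F t₀)^[n] p.2 / 2 := by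
    have : Continuous fun p : (ℕ → T) × M => tangentConorm d (F t₀)^[n] p.2 :=
      (continuous_tangentConorm_iterate hF hTF t₀ n).comp continuous_snd
    exact hP.sub (this.div_const 2)
  have h1 : ∀ᶠ w in 𝓝 (fun _ : ℕ => t₀), ∀ x ∈ (Set.univ : Set M), 0 <
      tangentConorm d (randomIterate F w n) x - tangentConorm d (F t₀)^[n] x / 2 := by
    refine isCompact_univ.eventually_forall_of_forall_eventually fun x _ => ?_
    refine hQ.continuousAt.eventually (lt_mem_nhds ?_)
    simp only [randomIterate_const]
    linarith [hpos x]
  rw [nhds_pi, Filter.Eventually, Filter.mem_pi] at h1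
  obtain ⟨I, hI, t, ht, hsub⟩ := h1
  refine ⟨⋂ i ∈ I, t i, (Filter.biInter_mem hI).2 fun i _ => ht i, fun w hw x => ?_⟩
  have hw' : w ∈ I.pi t := fun i hi => Set.mem_iInter₂.1 (hw i) i hi
  have := hsub hw' x (Set.mem_univ x)
  linarith

end TangentConormBounds

/-! ### Comparison of Riemannian and frame quantities -/

section FrameComparison

variable {d : ℕ} {M : Type*} [EMetricSpace M] [MeasurableSpace M]
  [ChartedSpace (EuclideanSpace ℝ (Fin d)) M] [IsManifold (𝓡 d) ∞ M]
  [RiemannianBundle (fun x : M => TangentSpace (𝓡 d) x)]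

namespace BoundedFrame

lemma bound_pos (B : BoundedFrame d M) : 0 < B.bound := one_pos.trans_le B.one_le_bound

lemma abs_log_norm_toModel_sub_le (B : BoundedFrame d M) (x : M) (v : TangentSpace (𝓡 d) x) :
    |Real.log ‖v‖ - Real.log ‖B.toModel x v‖| ≤ Real.log B.bound := by
  have hK := B.bound_pos
  rcases eq_or_ne v 0 with rfl | hv
  · simpa using Real.log_nonneg B.one_le_bound
  have h0 : 0 < ‖v‖ := norm_pos_iff.2 hv
  have h1 := B.norm_toModel_le x v
  have h2 := B.le_norm_toModel x v
  have h3 : 0 < ‖B.toModel x v‖ := pos_of_mul_pos_right (h0.trans_le h2) hK.le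
  have h4 := Real.log_le_log h3 h1
  have h5 := Real.log_le_log h0 h2
  rw [Real.log_mul hK.ne' h0.ne'] at h4
  rw [Real.log_mul hK.ne' h3.ne'] at h5
  exact abs_le.2 ⟨by linarith, by linarith⟩

/-- The frame changes the logarithm of the norm by a bounded amount, which disappears after division
by `n`. -/
lemma hasLyapunovExponent_iff (B : BoundedFrame d M) (g : ℕ → M → M) (x : M)
    (v : TangentSpace (𝓡 d) x) (l : ℝ) :
    HasLyapunovExponent g x v l ↔
      Tendsto (fun n : ℕ => (1 / (n : ℝ)) * Real.log ‖B.deriv (g n) x (B.toModel x v)‖)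
        atTop (𝓝 l) := by
  have hlim : Tendsto (fun n : ℕ => (1 / (n : ℝ)) * Real.log ‖mfderiv (𝓡 d) (𝓡 d) (g n) x v‖ -
      (1 / (n : ℝ)) * Real.log ‖B.deriv (g n) x (B.toModel x v)‖) atTop (𝓝 0) := by
    refine squeeze_zero_norm (fun n => ?_) (tendsto_const_div_atTop_nhds_zero_nat (Real.log B.bound))
    rw [← mul_sub, deriv_apply, ofModel_toModel, norm_mul, Real.norm_eq_abs, Real.norm_eq_abs,
      abs_of_nonneg (by positivity), one_div, inv_mul_eq_div]
    gcongr
    exact B.abs_log_norm_toModel_sub_le _ _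
  unfold HasLyapunovExponent
  constructor
  · intro h
    simpa using h.sub hlim
  · intro h
    simpa using h.add hlim

/-- One factor `B.bound` comes from the change of norm at `x`, the other from the change at `g x`.
-/
lemma tangentConorm_le_conorm_deriv (B : BoundedFrame d M) (hd : 1 ≤ d) (g : M → M) (x : M)
    (hpos : 0 ≤ tangentConorm d g x) :
    tangentConorm d g x ≤ B.bound ^ 2 * conorm (B.deriv g x) := by
  have hnt : Nontrivial (EuclideanSpace ℝ (Fin d)) :=
    Module.nontrivial_of_finrank_pos (R := ℝ) (by rw [finrank_euclideanSpace_fin]; exact hd)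
  have hK := B.bound_pos
  rw [← inv_mul_le_iff₀ (by positivity)]
  refine le_conorm fun v => ?_
  rw [mul_assoc, inv_mul_le_iff₀ (by positivity)]
  calc tangentConorm d g x * ‖v‖ ≤ tangentConorm d g x * (B.bound * ‖B.ofModel x v‖) := by
        gcongr; exact B.le_norm_ofModel x v
    _ = B.bound * (tangentConorm d g x * ‖B.ofModel x v‖) := by ring
    _ ≤ B.bound * ‖mfderiv (𝓡 d) (𝓡 d) g x (B.ofModel x v)‖ := by
        gcongr; exact tangentConorm_mul_le g x _
    _ ≤ B.bound * (B.bound * ‖B.deriv g x v‖) := by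
        gcongr; exact B.le_norm_toModel _ _
    _ = B.bound ^ 2 * ‖B.deriv g x v‖ := by ring

lemma le_tangentConorm_of_deriv (B : BoundedFrame d M) (hd : 1 ≤ d) {g : M → M} {x : M} {c : ℝ}
    (hc : 0 ≤ c) (h : ∀ v, c * ‖v‖ ≤ ‖B.deriv g x v‖) :
    c ≤ B.bound ^ 2 * tangentConorm d g x := by
  have hK := B.bound_pos
  rw [← inv_mul_le_iff₀ (by positivity)]
  refine le_tangentConorm hd fun v => ?_
  rw [mul_assoc, inv_mul_le_iff₀ (by positivity)]
  calc c * ‖v‖ ≤ c * (B.bound * ‖B.toModel x v‖) := by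
        gcongr; exact B.le_norm_toModel x v
    _ = B.bound * (c * ‖B.toModel x v‖) := by ring
    _ ≤ B.bound * ‖B.deriv g x (B.toModel x v)‖ := by
        gcongr; exact h _
    _ = B.bound * ‖B.toModel (g x) (mfderiv (𝓡 d) (𝓡 d) g x v)‖ := by
        rw [deriv_apply, ofModel_toModel]
    _ ≤ B.bound * (B.bound * ‖mfderiv (𝓡 d) (𝓡 d) g x v‖) := by
        gcongr; exact B.norm_toModel_le _ _
    _ = B.bound ^ 2 * ‖mfderiv (𝓡 d) (𝓡 d) g x v‖ := by ring

lemma norm_deriv_le (B : BoundedFrame d M) {g : M → M} {x : M} {b : ℝ} (hb : 0 ≤ b)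
    (h : ∀ v : TangentSpace (𝓡 d) x, ‖mfderiv (𝓡 d) (𝓡 d) g x v‖ ≤ b * ‖v‖)
    (v : EuclideanSpace ℝ (Fin d)) : ‖B.deriv g x v‖ ≤ b * B.bound ^ 2 * ‖v‖ := by
  have hK := B.bound_pos
  calc ‖B.deriv g x v‖ ≤ B.bound * ‖mfderiv (𝓡 d) (𝓡 d) g x (B.ofModel x v)‖ :=
        B.norm_toModel_le _ _
    _ ≤ B.bound * (b * (B.bound * ‖v‖)) := by
        gcongr
        refine (h _).trans ?_
        gcongr
        exact B.norm_ofModel_le x v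
    _ = b * B.bound ^ 2 * ‖v‖ := by ring

lemma le_norm_deriv (B : BoundedFrame d M) {g : M → M} {x : M} {b : ℝ} (hb : 0 ≤ b)
    (h : ∀ v : TangentSpace (𝓡 d) x, ‖v‖ ≤ b * ‖mfderiv (𝓡 d) (𝓡 d) g x v‖)
    (v : EuclideanSpace ℝ (Fin d)) : ‖v‖ ≤ b * B.bound ^ 2 * ‖B.deriv g x v‖ := by
  have hK := B.bound_pos
  calc ‖v‖ ≤ B.bound * ‖B.ofModel x v‖ := B.le_norm_ofModel x v
    _ ≤ B.bound * (b * (B.bound * ‖B.deriv g x v‖)) := by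
        gcongr
        refine (h _).trans ?_
        gcongr
        exact B.le_norm_toModel _ _
    _ = b * B.bound ^ 2 * ‖B.deriv g x v‖ := by ring

lemma cocycleIterate_deriv (B : BoundedFrame d M) {f : M → M}
    (hf : MDifferentiable (𝓡 d) (𝓡 d) f) (x : M) (n : ℕ) :
    cocycleIterate f (B.deriv f) x n = B.deriv f^[n] x := by
  have h := (B.segmentProd_deriv (F := fun _ : Unit => f) (fun _ => hf) (fun _ => ()) x n).2
  rw [cocycleIterate]
  simpa only [randomIterate_const] using h

lemma inv_pow_le_tangentConorm (B : BoundedFrame d M) (hd : 1 ≤ d) {f : M → M}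
    (hf : MDifferentiable (𝓡 d) (𝓡 d) f) {b : ℝ} (hcoc : IsBoundedCocycle (B.deriv f) b) (n : ℕ)
    (x : M) : (b ^ n)⁻¹ ≤ B.bound ^ 2 * tangentConorm d f^[n] x := by
  have hb := zero_lt_one.trans_le hcoc.one_le
  refine B.le_tangentConorm_of_deriv hd (by positivity) fun v => ?_
  rw [inv_mul_le_iff₀ (by positivity), ← B.cocycleIterate_deriv hf]
  exact hcoc.le_norm_iterate x n v

lemma tangentConorm_iterate_pos (B : BoundedFrame d M) (hd : 1 ≤ d) {f : M → M}
    (hf : MDifferentiable (𝓡 d) (𝓡 d) f) {b : ℝ} (hcoc : IsBoundedCocycle (B.deriv f) b) (n : ℕ)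
    (x : M) : 0 < tangentConorm d f^[n] x := by
  have hb := zero_lt_one.trans_le hcoc.one_le
  have hK := B.bound_pos
  exact pos_of_mul_pos_right ((by positivity : (0 : ℝ) < (b ^ n)⁻¹).trans_le
    (B.inv_pow_le_tangentConorm hd hf hcoc n x)) (by positivity)

/-- For an expanding ergodic invariant measure, the mean of the logarithmic minimal expansion of the
`n`-th iterate tends to infinity. -/
lemma tendsto_integral_log_tangentConorm [CompactSpace M] [BorelSpace M]
    (B : BoundedFrame d M) (hd : 1 ≤ d)
    {f : M → M} (hf : MDifferentiable (𝓡 d) (𝓡 d) f)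
    {b : ℝ} (hcoc : IsBoundedCocycle (B.deriv f) b)
    (hcont : ∀ n, Continuous (tangentConorm d f^[n]))
    {μ : Measure M} [IsProbabilityMeasure μ] (herg : Ergodic f μ)
    (hexp : IsExpandingInvariant (d := d) f μ) :
    Tendsto (fun n => ∫ x, Real.log (tangentConorm d f^[n] x) ∂μ) atTop atTop := by
  have hb := zero_lt_one.trans_le hcoc.one_le
  have hK := B.bound_pos
  have hpos := B.tangentConorm_iterate_pos hd hf hcoc
  have hlogb : 0 ≤ Real.log b := Real.log_nonneg hcoc.one_le
  have hlogK : 0 ≤ Real.log (B.bound ^ 2) := Real.log_nonneg (one_le_pow₀ B.one_le_bound)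
  have hint : ∀ n, Integrable (fun x => Real.log (tangentConorm d f^[n] x)) μ := fun n =>
    ((hcont n).log fun x => (hpos n x).ne').integrable_of_hasCompactSupport
      (HasCompactSupport.of_compactSpace _)
  -- The factor `n + 1` in place of `n` accommodates the constant from the frame.
  have hlow : ∀ (n : ℕ) x, -((Real.log b + Real.log (B.bound ^ 2)) * (n + 1)) ≤
      Real.log (tangentConorm d f^[n] x) := by
    intro n x
    have h := Real.log_le_log (by positivity) (B.inv_pow_le_tangentConorm hd hf hcoc n x)
    rw [Real.log_inv, Real.log_pow, Real.log_mul (by positivity) (hpos n x).ne'] at h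
    have hn : (0 : ℝ) ≤ n := n.cast_nonneg
    nlinarith [mul_nonneg hn hlogK]
  -- This upgrades positivity vector by vector to an expansion that is uniform over vectors.
  obtain ⟨χ, hχ, hexpand⟩ := hcoc.exists_uniform_expansion herg hd (by
    filter_upwards [hexp] with x hx v hv
    have hv' : B.ofModel x v ≠ 0 := fun h => hv (by rw [← B.toModel_ofModel x v, h, map_zero])
    obtain ⟨l, hl, hl0⟩ := hx _ hv'
    refine ⟨l, ?_, hl0⟩
    rw [B.hasLyapunovExponent_iff, B.toModel_ofModel] at hl
    simpa only [B.cocycleIterate_deriv hf] using hl)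
  have hev := eventually_mean_ge hint hχ hlow (by
    filter_upwards [hexpand] with x ⟨D, hD⟩
    refine ⟨D + Real.log (B.bound ^ 2), fun n => ?_⟩
    have h : Real.exp (χ * n - D) ≤ B.bound ^ 2 * tangentConorm d f^[n] x := by
      refine B.le_tangentConorm_of_deriv hd (Real.exp_pos _).le fun v => ?_
      have h1 := hD n v
      rw [B.cocycleIterate_deriv hf, show -χ * n + D = -(χ * n - D) by ring, Real.exp_neg,
        le_inv_mul_iff₀ (Real.exp_pos _)] at h1
      exact h1
    have h2 := Real.log_le_log (Real.exp_pos _) h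
    rw [Real.log_exp, Real.log_mul (by positivity) (hpos n x).ne'] at h2
    linarith)
  exact tendsto_atTop_mono' _ hev
    (tendsto_natCast_atTop_atTop.const_mul_atTop (by positivity))

end BoundedFrame

end FrameComparison

/-! ### Stationary measures and almost sure noise -/

section Stationary

variable {T M : Type*} [MeasurableSpace T] [MeasurableSpace M]

lemma IsStationaryMeasure.map_eq [EMetricSpace M] [BorelSpace M] {F : T → M → M}
    (hF : Measurable (Function.uncurry F)) {θ : Measure T} [IsProbabilityMeasure θ]
    {m : Measure M} [IsProbabilityMeasure m] (h : IsStationaryMeasure F θ m) :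
    (θ.prod m).map (Function.uncurry F) = m := by
  have : IsProbabilityMeasure ((θ.prod m).map (Function.uncurry F)) :=
    Measure.isProbabilityMeasure_map hF.aemeasurable
  refine ext_of_forall_integral_eq_of_IsFiniteMeasure fun φ => ?_
  rw [integral_map hF.aemeasurable φ.continuous.measurable.aestronglyMeasurable, integral_prod]
  · exact h φ.toContinuousMap
  · exact (φ.integrable ((θ.prod m).map (Function.uncurry F))).comp_measurable hF

lemma ae_infinitePi_forall_mem {θ : Measure T} [IsProbabilityMeasure θ] {S : Set T}
    (hS : θ Sᶜ = 0) : ∀ᵐ w ∂(Measure.infinitePi fun _ : ℕ => θ), ∀ n, w n ∈ S := by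
  rw [ae_all_iff]
  intro n
  exact (measurePreserving_eval_infinitePi (fun _ : ℕ => θ) n).quasiMeasurePreserving.ae
    (p := fun t => t ∈ S) hS

end Stationary

/-! ### Expansion criterion for a stationary measure -/

section RandomExpansion

variable {d : ℕ} {M : Type*} [EMetricSpace M] [CompactSpace M] [MeasurableSpace M] [BorelSpace M]
  [ChartedSpace (EuclideanSpace ℝ (Fin d)) M] [IsManifold (𝓡 d) ∞ M]
  [RiemannianBundle (fun x : M => TangentSpace (𝓡 d) x)]

lemma BoundedFrame.isBoundedCocycle_deriv (B : BoundedFrame d M)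
    {T : Type*} [TopologicalSpace T] [MeasurableSpace T] [OpensMeasurableSpace T] {F : T → M → M}
    (hF : Continuous (Function.uncurry F))
    (hTF : Continuous fun p : T × TangentBundle (𝓡 d) M => tangentMap (𝓡 d) (𝓡 d) (F p.1) p.2)
    {t : T} {b : ℝ} (hb : 1 ≤ b)
    (hbd : ∀ x (v : TangentSpace (𝓡 d) x), ‖mfderiv (𝓡 d) (𝓡 d) (F t) x v‖ ≤ b * ‖v‖ ∧
      ‖v‖ ≤ b * ‖mfderiv (𝓡 d) (𝓡 d) (F t) x v‖) :
    IsBoundedCocycle (B.deriv (F t)) (b * B.bound ^ 2) := by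
  have hm : Measurable fun x => B.deriv (F t) x :=
    Measurable.comp (g := fun p : T × M => B.deriv (F p.1) p.2) (f := fun x => (t, x))
      (B.measurable_deriv hF hTF) measurable_prodMk_left
  exact ⟨hm, one_le_mul_of_one_le_of_one_le hb (one_le_pow₀ B.one_le_bound),
    fun x => B.norm_deriv_le (zero_le_one.trans hb) fun v => (hbd x v).1,
    fun x => B.le_norm_deriv (zero_le_one.trans hb) fun v => (hbd x v).2⟩

-- Outside `S` the derivative is replaced by the identity, so that the bounds hold at every point;
-- if `S` carries the noise law, this changes nothing almost surely.
open Classical in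
lemma BoundedFrame.isBoundedCocycle_ite (B : BoundedFrame d M)
    {T : Type*} [TopologicalSpace T] [MeasurableSpace T] [OpensMeasurableSpace T] {F : T → M → M}
    (hF : Continuous (Function.uncurry F))
    (hTF : Continuous fun p : T × TangentBundle (𝓡 d) M => tangentMap (𝓡 d) (𝓡 d) (F p.1) p.2)
    {S : Set T} (hS : MeasurableSet S) {b : ℝ} (hb : 1 ≤ b)
    (hbd : ∀ t ∈ S, ∀ x (v : TangentSpace (𝓡 d) x), ‖mfderiv (𝓡 d) (𝓡 d) (F t) x v‖ ≤ b * ‖v‖ ∧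
      ‖v‖ ≤ b * ‖mfderiv (𝓡 d) (𝓡 d) (F t) x v‖) :
    IsBoundedCocycle (fun p : (ℕ → T) × M =>
      if p.1 0 ∈ S then B.deriv (F (p.1 0)) p.2 else ContinuousLinearMap.id ℝ _)
      (b * B.bound ^ 2) := by
  have h0 : Measurable fun p : (ℕ → T) × M => p.1 0 := (measurable_pi_apply 0).comp measurable_fst
  have hb1 : 1 ≤ b * B.bound ^ 2 := one_le_mul_of_one_le_of_one_le hb (one_le_pow₀ B.one_le_bound)
  have hm : Measurable fun p : (ℕ → T) × M => B.deriv (F (p.1 0)) p.2 :=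
    Measurable.comp (g := fun p : T × M => B.deriv (F p.1) p.2)
      (f := fun p : (ℕ → T) × M => (p.1 0, p.2)) (B.measurable_deriv hF hTF)
      (h0.prodMk measurable_snd)
  have hS' : MeasurableSet {p : (ℕ → T) × M | p.1 0 ∈ S} := h0 hS
  refine ⟨Measurable.ite hS' hm measurable_const, hb1, fun p v => ?_, fun p v => ?_⟩
  · by_cases hp : p.1 0 ∈ S
    · rw [if_pos hp]
      exact B.norm_deriv_le (zero_le_one.trans hb) (fun v => (hbd _ hp _ v).1) v
    · rw [if_neg hp, ContinuousLinearMap.id_apply]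
      exact le_mul_of_one_le_left (norm_nonneg _) hb1
  · by_cases hp : p.1 0 ∈ S
    · rw [if_pos hp]
      exact B.le_norm_deriv (zero_le_one.trans hb) (fun v => (hbd _ hp _ v).2) v
    · rw [if_neg hp, ContinuousLinearMap.id_apply]
      exact le_mul_of_one_le_left (norm_nonneg _) hb1

/-- Here `q` stands for the minimal expansion of the unperturbed `N`-th iterate. The threshold in
`hint` pays for the loss of a factor 2 due to the noise and of `B.bound ^ 2` due to the frame,
leaving a positive logarithmic mean in the frame. -/
lemma BoundedFrame.isExpandingStationary (B : BoundedFrame d M) (hd : 1 ≤ d)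
    {T : Type*} [TopologicalSpace T] [MeasurableSpace T] [OpensMeasurableSpace T] {F : T → M → M}
    (hdiff : ∀ t, MDifferentiable (𝓡 d) (𝓡 d) (F t))
    (hF : Continuous (Function.uncurry F))
    (hTF : Continuous fun p : T × TangentBundle (𝓡 d) M => tangentMap (𝓡 d) (𝓡 d) (F p.1) p.2)
    {θ : Measure T} [IsProbabilityMeasure θ] {S : Set T} (hS : MeasurableSet S) (hθS : θ Sᶜ = 0)
    {b : ℝ} (hb : 1 ≤ b)
    (hbd : ∀ t ∈ S, ∀ x (v : TangentSpace (𝓡 d) x), ‖mfderiv (𝓡 d) (𝓡 d) (F t) x v‖ ≤ b * ‖v‖ ∧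
      ‖v‖ ≤ b * ‖mfderiv (𝓡 d) (𝓡 d) (F t) x v‖)
    {m : Measure M} [IsProbabilityMeasure m] (hst : IsStationaryMeasure F θ m)
    (herg : IsRandomErgodic F θ m) {N : ℕ} (hN : 0 < N) {q : M → ℝ} (hq : Continuous q)
    (hq0 : ∀ x, 0 < q x)
    (hqF : ∀ w : ℕ → T, (∀ i, w i ∈ S) → ∀ x, q x / 2 ≤ tangentConorm d (randomIterate F w N) x)
    (hint : Real.log (2 * B.bound ^ 2) < ∫ x, Real.log (q x) ∂m) :
    IsExpandingStationary (d := d) F θ m := by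
  classical
  have hFm : Measurable (Function.uncurry F) := hF.measurable
  set P := (Measure.infinitePi fun _ : ℕ => θ).prod m with hP
  have hSerg : Ergodic (skewProduct F) P := ergodic_skewProduct hFm (hst.map_eq hFm) herg
  have hK := B.bound_pos
  set A : (ℕ → T) × M → EuclideanSpace ℝ (Fin d) →L[ℝ] EuclideanSpace ℝ (Fin d) := fun p =>
    if p.1 0 ∈ S then B.deriv (F (p.1 0)) p.2 else ContinuousLinearMap.id ℝ _ with hA
  have hcoc : IsBoundedCocycle A (b * B.bound ^ 2) := B.isBoundedCocycle_ite hF hTF hS hb hbd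
  have hae : ∀ᵐ p ∂P, ∀ n, p.1 n ∈ S :=
    Measure.quasiMeasurePreserving_fst.ae (ae_infinitePi_forall_mem hθS)
  have hiter : ∀ p : (ℕ → T) × M, (∀ n, p.1 n ∈ S) → ∀ n,
      cocycleIterate (skewProduct F) A p n = B.deriv (randomIterate F p.1 n) p.2 := by
    intro p hp n
    rw [← (B.segmentProd_deriv hdiff p.1 p.2 n).2, cocycleIterate]
    congr 1
    ext1 j
    simp only [hA, skewProduct_iterate, zero_add, if_pos (hp j)]
  have hqi : Integrable (fun x => Real.log (q x)) m :=
    (hq.log fun x => (hq0 x).ne').integrable_of_hasCompactSupport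
      (HasCompactSupport.of_compactSpace _)
  have hci : Integrable (fun p => Real.log (conorm (cocycleIterate (skewProduct F) A p N))) P := by
    have h := hcoc.isSubadditiveCocycle_neg_log_conorm hSerg.measurable hd
    refine Integrable.of_bound (C := Real.log (b * B.bound ^ 2) * N) ?_ (.of_forall fun p => ?_)
    · simpa only [Pi.neg_def, neg_neg] using (h.measurable N).neg.aestronglyMeasurable
    · simpa using h.bound N p
  have hpos : 0 < ∫ p, Real.log (conorm (cocycleIterate (skewProduct F) A p N)) ∂P := by
    have h1 : ∫ p, (Real.log (q p.2) - Real.log (2 * B.bound ^ 2)) ∂P ≤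
        ∫ p, Real.log (conorm (cocycleIterate (skewProduct F) A p N)) ∂P := by
      refine integral_mono_ae ((hqi.comp_snd _).sub (integrable_const _)) hci ?_
      filter_upwards [hae] with p hp
      have h2 := hqF p.1 hp p.2
      have h3 := B.tangentConorm_le_conorm_deriv hd (randomIterate F p.1 N) p.2
        ((half_pos (hq0 _)).le.trans h2)
      rw [hiter p hp]
      have h4 : q p.2 ≤ 2 * B.bound ^ 2 * conorm (B.deriv (randomIterate F p.1 N) p.2) := by
        linarith
      have h5 : 0 < conorm (B.deriv (randomIterate F p.1 N) p.2) :=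
        pos_of_mul_pos_right ((hq0 _).trans_le h4) (by positivity)
      have h6 := Real.log_le_log (hq0 _) h4
      rw [Real.log_mul (by positivity) h5.ne'] at h6
      linarith
    have h2 : ∫ p, (Real.log (q p.2) - Real.log (2 * B.bound ^ 2)) ∂P =
        ∫ x, Real.log (q x) ∂m - Real.log (2 * B.bound ^ 2) := by
      rw [integral_sub (hqi.comp_snd _) (integrable_const _), integral_const,
        integral_fun_snd (fun x => Real.log (q x))]
      simp
    linarith
  filter_upwards [hae, hcoc.ae_exists_exponent hSerg hd, hcoc.ae_exponent_pos hSerg hd hN hpos]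
    with p hp hex hpo v hv
  have hv' : B.toModel p.2 v ≠ 0 := fun h => hv (by rw [← B.ofModel_toModel p.2 v, h, map_zero])
  obtain ⟨l, hl⟩ := hex _ hv'
  refine ⟨l, (B.hasLyapunovExponent_iff _ _ _ _).2 ?_, hpo _ hv' l hl⟩
  simpa only [hiter p hp] using hl

end RandomExpansion

/-! ### Transfer of integral bounds from the limit measures to aces measures -/

section StochasticStability

variable {d : ℕ} {T M : Type*} [MeasurableSpace T] [EMetricSpace M] [CompactSpace M]
  [MeasurableSpace M] [BorelSpace M]

/-- A strict lower bound for the integral of a continuous function, valid for the limit measures of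
a stochastically stable system, holds for aces measures at small noise levels. -/
lemma IsStochasticallyStable.eventually_lt_integral {f : M → M} {F : T → M → M}
    {θ : ℝ → ProbabilityMeasure T} {p : ℕ} {μ : Fin p → ProbabilityMeasure M}
    (h : IsStochasticallyStable d f F θ μ) {ψ : M → ℝ} (hψ : Continuous ψ) {c : ℝ}
    (hc : ∀ i, c < ∫ x, ψ x ∂(μ i : Measure M)) :
    ∀ᶠ ε in 𝓝[>] (0 : ℝ), ∀ m : ProbabilityMeasure M, IsAces d F (θ ε : Measure T) m →
      c < ∫ x, ψ x ∂(m : Measure M) := by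
  by_contra hcon
  -- If the claim fails, the violating noise levels accumulate at 0. Violating measures chosen at
  -- these levels have an accumulation point, which is a convex combination of the `μ i` and so has
  -- integral above `c`, contradicting weak* continuity of the integral.
  set L : Set ℝ := {ε | 0 < ε ∧ ∃ m : ProbabilityMeasure M, IsAces d F (θ ε : Measure T) m ∧
    ∫ x, ψ x ∂(m : Measure M) ≤ c} with hL
  have hfreq : ∃ᶠ ε in 𝓝 (0 : ℝ), ε ∈ L := by
    rw [Filter.not_eventually] at hcon
    refine (frequently_nhdsWithin_iff.1 hcon).mono ?_
    rintro ε ⟨hε, hε0⟩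
    push Not at hε
    exact ⟨hε0, hε⟩
  have hne : (𝓝[L] (0 : ℝ)).NeBot := mem_closure_iff_nhdsWithin_neBot.1
    (mem_closure_iff_frequently.2 hfreq)
  -- `m₁` is a default value at noise levels outside `L`, where nothing is required.
  obtain ⟨ε₁, -, m₁, -⟩ := hfreq.exists
  have hm : ∀ ε, ∃ m : ProbabilityMeasure M, ε ∈ L → IsAces d F (θ ε : Measure T) m ∧
      ∫ x, ψ x ∂(m : Measure M) ≤ c := by
    intro ε
    by_cases hε : ε ∈ L
    · obtain ⟨-, m, hm⟩ := hε
      exact ⟨m, fun _ => hm⟩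
    · exact ⟨m₁, fun h => absurd h hε⟩
  choose m hm using hm
  obtain ⟨ν, hν⟩ := exists_clusterPt_of_compactSpace (map m (𝓝[L] (0 : ℝ)))
  obtain ⟨a, ha, hνa⟩ := h.accumulation L (fun ε hε => hε.1) m (fun ε hε => (hm ε hε).1) ν hν
  have hint : ∀ ρ : ProbabilityMeasure M, Integrable ψ (ρ : Measure M) := fun ρ =>
    hψ.integrable_of_hasCompactSupport (HasCompactSupport.of_compactSpace _)
  have hνc : c < ∫ x, ψ x ∂(ν : Measure M) := by
    rw [hνa, integral_finsetSum_measure fun i _ => (hint (μ i)).smul_measure_nnreal]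
    simp only [integral_smul_nnreal_measure]
    have h1 : ∑ i, (a i : ℝ) = 1 := by exact_mod_cast ha
    have h2 : c = ∑ i, (a i : ℝ) * c := by rw [← Finset.sum_mul, h1, one_mul]
    -- Some weight is nonzero because they sum to 1; this makes the inequality strict.
    have h3 : ∃ i ∈ Finset.univ, a i ≠ 0 := by
      refine Finset.exists_ne_zero_of_sum_ne_zero ?_
      rw [ha]
      exact one_ne_zero
    obtain ⟨i, hi, hai⟩ := h3
    rw [h2]
    refine Finset.sum_lt_sum (fun j _ => ?_) ⟨i, hi, ?_⟩
    · exact mul_le_mul_of_nonneg_left (hc j).le (a j).coe_nonneg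
    · exact mul_lt_mul_of_pos_left (hc i) (NNReal.coe_pos.2 (pos_iff_ne_zero.2 hai))
  have hcont : Continuous fun ρ : ProbabilityMeasure M => ∫ x, ψ x ∂(ρ : Measure M) :=
    ProbabilityMeasure.continuous_integral_boundedContinuousFunction
      (BoundedContinuousFunction.mkOfCompact ⟨ψ, hψ⟩)
  have hfr : ∃ᶠ ε in 𝓝[L] (0 : ℝ), c < ∫ x, ψ x ∂(m ε : Measure M) :=
    MapClusterPt.frequently hν (hcont.continuousAt.eventually (lt_mem_nhds hνc))
  obtain ⟨ε, hε, hεL⟩ := (hfr.and_eventually self_mem_nhdsWithin).exists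
  exact absurd (hm ε hεL).2 (not_le.2 hε)

end StochasticStability

/-! ### Proof of the main theorem -/

theorem theoremC {d : ℕ} {M : Type*} [EMetricSpace M] [CompactSpace M]
    [MeasurableSpace M] [BorelSpace M]
    [ChartedSpace (EuclideanSpace ℝ (Fin d)) M] [IsManifold (𝓡 d) ∞ M]
    [RiemannianBundle (fun x : M => TangentSpace (𝓡 d) x)]
    [IsContMDiffRiemannianBundle (𝓡 d) ∞ (EuclideanSpace ℝ (Fin d))
      (fun x : M => TangentSpace (𝓡 d) x)]
    [IsRiemannianManifold (𝓡 d) M]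
    (f : M → M) (hf : IsLocalDiffeomorph (𝓡 d) (𝓡 d) 2 f)
    {T : Type*} [MetricSpace T] [MeasurableSpace T] [BorelSpace T]
    (Φ : T → C^2⟮𝓡 d, M; 𝓡 d, M⟯) (hΦ : Continuous[inferInstance, c2Topology d M] Φ)
    (t₀ : T) (ht₀ : ⇑(Φ t₀) = f)
    (θ : ℝ → ProbabilityMeasure T)
    (hθ_supp : ∀ ε > 0, (θ ε : Measure T) (θ ε : Measure T).supportᶜ = 0)
    (hθ : SupportsConvergeTo θ t₀)
    {p : ℕ} (μ : Fin p → ProbabilityMeasure M)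
    (hμ : ∀ i, IsExpandingInvariant (d := d) f (μ i : Measure M))
    (hstab : IsStochasticallyStable d f (fun t => ⇑(Φ t)) θ μ) :
    ∃ ε₀ > 0, ∀ ε : ℝ, 0 < ε → ε < ε₀ → ∀ m : ProbabilityMeasure M,
      IsAces d (fun t => ⇑(Φ t)) (θ ε : Measure T) m →
        IsExpandingStationary (d := d) (fun t => ⇑(Φ t)) (θ ε : Measure T) (m : Measure M) := by
  -- In dimension zero there are no nonzero tangent vectors, and an empty `M` carries no probability
  -- measure.
  rcases Nat.eq_zero_or_pos d with rfl | hd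
  · refine ⟨1, one_pos, fun ε _ _ m _ => .of_forall fun q v hv => absurd ?_ hv⟩
    have : Subsingleton (TangentSpace (𝓡 0) q.2) :=
      inferInstanceAs (Subsingleton (EuclideanSpace ℝ (Fin 0)))
    exact Subsingleton.elim _ _
  rcases isEmpty_or_nonempty M with hM | hM
  · refine ⟨1, one_pos, fun ε _ _ m _ => ?_⟩
    exact absurd (nonempty_of_isProbabilityMeasure (m : Measure M)) (not_nonempty_iff.2 hM)
  subst ht₀
  set F : T → M → M := fun t => ⇑(Φ t) with hF
  have hdiff : ∀ t, MDifferentiable (𝓡 d) (𝓡 d) (F t) := fun t =>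
    (Φ t).contMDiff.mdifferentiable (by norm_num)
  have hFc : Continuous (Function.uncurry F) := continuous_family hΦ
  have hTF : Continuous fun p : T × TangentBundle (𝓡 d) M =>
    tangentMap (𝓡 d) (𝓡 d) (F p.1) p.2 := continuous_tangentMap_family hΦ
  have hinj : ∀ x, Function.Injective (mfderiv (𝓡 d) (𝓡 d) (F t₀) x) := fun x =>
    ((hf x).mfderivToContinuousLinearEquiv (by norm_num)).injective
  obtain ⟨B⟩ := exists_boundedFrame (d := d) (M := M)
  obtain ⟨b, hb, hbd⟩ := exists_eventually_mfderiv_bounds hd hTF hinj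
  have hcoc : IsBoundedCocycle (B.deriv (F t₀)) (b * B.bound ^ 2) :=
    B.isBoundedCocycle_deriv hFc hTF hb hbd.self_of_nhds
  have hcont := continuous_tangentConorm_iterate hdiff hTF t₀
  have hpos := B.tangentConorm_iterate_pos hd (hdiff t₀) hcoc
  -- The finitely many means all tend to infinity, so a single `N` exceeds the threshold for every
  -- limit measure.
  have hall : ∀ᶠ n in atTop, ∀ i, Real.log (2 * B.bound ^ 2) <
      ∫ x, Real.log (tangentConorm d (F t₀)^[n] x) ∂(μ i : Measure M) :=
    eventually_all.2 fun i => (B.tendsto_integral_log_tangentConorm hd (hdiff t₀) hcoc hcont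
      (hstab.ergodic i) (hμ i)).eventually_gt_atTop _
  obtain ⟨N, hN, hN0⟩ := (hall.and (eventually_gt_atTop 0)).exists
  obtain ⟨U, hU, hUq⟩ := eventually_half_tangentConorm_le hdiff hTF (hpos N)
  -- For small noise the support lies both where `N`-step expansion is at least halved and where the
  -- derivatives are uniformly bounded and boundedly invertible.
  have hsupp := hθ _ (inter_mem hU hbd)
  have hmean := hstab.eventually_lt_integral ((hcont N).log fun x => (hpos N x).ne') hN
  obtain ⟨ε₀, hε₀, hsub⟩ := mem_nhdsGT_iff_exists_Ioo_subset.1 (hsupp.and hmean)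
  refine ⟨ε₀, hε₀, fun ε hε hεε₀ m hm => ?_⟩
  obtain ⟨hS, hmε⟩ := hsub ⟨hε, hεε₀⟩
  exact B.isExpandingStationary hd hdiff hFc hTF Measure.isClosed_support.measurableSet
    (hθ_supp ε hε) hb (fun t ht => (hS ht).2) hm.stationary hm.ergodic hN0 (hcont N) (hpos N)
    (fun w hw => hUq w fun i => (hS (hw i)).1) (hmε m hm)
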